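/- Let $d$ be a dimension and $\alpha\in(0,1)$. For $L>0$ put $Q=[0,L]^d$; a function on $\mathbb R^d$ is called periodic if it has period $L$ in each coordinate. For functions $u$ on $\mathbb R^d$ with values in a finite-dimensional normed space set $$[u]_\alpha=\sup_{x,y\in Q,\ x\ne y}L^\alpha\frac{|u(x)-u(y)|}{|x-y|^\alpha},\qquad \|u\|_{k,\alpha}=\sum_{|m|\le k}L^{|m|}\sup_{Q}|D^mu|+\sum_{|m|=k}L^k[D^mu]_\alpha ,$$ where $m$ runs over multi-indices ($|\cdot|$ is the Euclidean norm on vectors and the operator norm on matrices), and write $u\in C^{k,\alpha}$ if $u$ is $k$ times continuously differentiable on $\mathbb R^d$ and $\|u\|_{k,\alpha}<\infty$. Let $\mathbf P$ be the Leray–Hodge projection, i.e. the orthogonal projection of $L^2(Q;\mathbb R^d)$ onto the fields $u$ that are weakly divergence free with periodic boundary conditions ($\int_Q u\cdot\nabla\varphi=0$ for all periodic $\varphi\in C^1$), and let $(\nabla^{T}A)v$ be the vector field with components $\sum_j(\partial_iA_j)v_j$. There is a constant $c=c(d,\alpha)$, independent of $k$ and $L$, such that for every $L>0$, every integer $k\ge1$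 and all $A,v\in C^{k+1,\alpha}$ with values in $\mathbb R^d$ such that $\nabla A$ and $v$ are periodic ($A$ itself need not be periodic), the field $\mathbf P[(\nabla^{T}A)v]$ is (almost everywhere on $Q$ equal to) a periodic field in $C^{k+1,\alpha}$, and $$\big\|\mathbf P[(\nabla^{T}A)v]\big\|_{k+1,\alpha}\le c\,\|\nabla A\|_{k,\alpha}\,\|v\|_{k+1,\alpha}.$$ -/

import Mathlib

open MeasureTheory
open scoped NNReal ENNReal

noncomputable section

namespace PeriodicHolder

/-- The physical space `ℝᵈ` with its Euclidean norm. -/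
abbrev Space (d : ℕ) : Type := EuclideanSpace ℝ (Fin d)

/-- The period cell `[0, L]ᵈ`. -/
def cell (d : ℕ) (L : ℝ) : Set (Space d) :=
  {x | ∀ i, x i ∈ Set.Icc (0 : ℝ) L}

/-- Spatial periodicity with period `L` in every coordinate direction. -/
def IsPeriodic {d : ℕ} {F : Type*} (L : ℝ) (u : Space d → F) : Prop :=
  ∀ (x : Space d) (i : Fin d), u (x + EuclideanSpace.single i L) = u x

section Norms

variable {d : ℕ} {F : Type*} [NormedAddCommGroup F] [NormedSpace ℝ F]

/-- The partial derivative `∂ᵢ u`. -/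
def partialDeriv (i : Fin d) (u : Space d → F) : Space d → F :=
  fun x => fderiv ℝ u x (EuclideanSpace.single i 1)

/-- `Dᵐ u = ∂₀^{m 0} ∂₁^{m 1} ⋯ u` for a multi-index `m`. -/
def multiDeriv (m : Fin d → ℕ) (u : Space d → F) : Space d → F :=
  (List.finRange d).foldr (fun i w => (partialDeriv i)^[m i] w) u

/-- The finite set of multi-indices `m` with `|m| = j`. -/
def multiIndices (d j : ℕ) : Finset (Fin d → ℕ) :=
  Finset.univ.piAntidiag j

/-- The supremum over the period cell of `|u|`, possibly infinite. -/
def supNorm (L : ℝ) (u : Space d → F) : ℝ≥0∞ :=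
  ⨆ x ∈ cell d L, ‖u x‖ₑ

/-- The Hölder semi-norm `[u]_α = sup_{x, y} L^α |u x - u y| / |x - y|^α`, the supremum being over
the period cell, possibly infinite. Pairs with `x = y` contribute `0`. -/
def holderSeminorm (L α : ℝ) (u : Space d → F) : ℝ≥0∞ :=
  ⨆ x ∈ cell d L, ⨆ y ∈ cell d L, ENNReal.ofReal (L ^ α * (‖u x - u y‖ / ‖x - y‖ ^ α))

/-- `‖u‖_k = ∑_{|m| ≤ k} L^{|m|} sup |Dᵐ u|`. -/
def cNorm (L : ℝ) (k : ℕ) (u : Space d → F) : ℝ≥0∞ :=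
  ∑ j ∈ Finset.range (k + 1), ∑ m ∈ multiIndices d j,
    ENNReal.ofReal (L ^ j) * supNorm L (multiDeriv m u)

/-- `‖u‖_{k,α} = ‖u‖_k + ∑_{|m| = k} L^k [Dᵐ u]_α`. -/
def holderNorm (L : ℝ) (k : ℕ) (α : ℝ) (u : Space d → F) : ℝ≥0∞ :=
  cNorm L k u +
    ∑ m ∈ multiIndices d k, ENNReal.ofReal (L ^ k) * holderSeminorm L α (multiDeriv m u)

/-- `u` is `k` times continuously differentiable on `ℝᵈ` and its `C^{k,α}` norm on the period cell
is finite. (For periodic `u` this is membership in the space of periodic `C^{k,α}` functions.) -/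
def IsHolder (L : ℝ) (k : ℕ) (α : ℝ) (u : Space d → F) : Prop :=
  ContDiff ℝ k u ∧ holderNorm L k α u < ⊤

end Norms

/-- Lebesgue measure on the period cell. -/
def cellMeasure (d : ℕ) (L : ℝ) : Measure (Space d) :=
  volume.restrict (cell d L)

/-- Square-integrable vector fields on the period cell. -/
abbrev VectorL2 (d : ℕ) (L : ℝ) : Type :=
  Lp (Space d) 2 (cellMeasure d L)

/-- The square-integrable fields that are gradients of periodic `C¹` functions. -/
def periodicGradients (d : ℕ) (L : ℝ) : Set (VectorL2 d L) :=
  {g | ∃ φ : Space d → ℝ, ContDiff ℝ 1 φ ∧ IsPeriodic L φ ∧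
    (g : Space d → Space d) =ᵐ[cellMeasure d L] gradient φ}

/-- The square-integrable fields whose periodic extension is weakly divergence free, i.e. those `u`
with `∫ u · ∇φ = 0` for every periodic `C¹` function `φ`. -/
def divergenceFree (d : ℕ) (L : ℝ) : Submodule ℝ (VectorL2 d L) :=
  (Submodule.span ℝ (periodicGradients d L))ᗮ

instance divergenceFree_hasOrthogonalProjection (d : ℕ) (L : ℝ) : (divergenceFree d L).HasOrthogonalProjection := by
  have : CompleteSpace (divergenceFree d L) :=
    (Submodule.isClosed_orthogonal (Submodule.span ℝ (periodicGradients d L))).completeSpace_coe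
  exact Submodule.HasOrthogonalProjection.ofCompleteSpace (divergenceFree d L)

/-- The Leray–Hodge projection: the `L²`-orthogonal projection onto divergence free fields. -/
def leray (d : ℕ) (L : ℝ) : VectorL2 d L →L[ℝ] VectorL2 d L :=
  (divergenceFree d L).starProjection

/-- The function `w` is a representative, on the period cell, of the Leray–Hodge projection of the
square-integrable vector field `f`. -/
def IsLerayProjection {d : ℕ} (L : ℝ) (f w : Space d → Space d) : Prop :=
  ∃ hf : MemLp f 2 (cellMeasure d L), w =ᵐ[cellMeasure d L] leray d L (hf.toLp f)

/-- The vector field `(∇ᵀA) v`, with components `∑ⱼ (∂ᵢ Aⱼ) vⱼ`: the transpose of the Jacobian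
matrix of `A` applied to `v`. -/
def gradTransposeMul {d : ℕ} (A v : Space d → Space d) : Space d → Space d :=
  fun x => ContinuousLinearMap.adjoint (fderiv ℝ A x) (v x)

end PeriodicHolder

end

/-! Put `f = (∇ᵀA) v`, that is `f i = ∑ⱼ ∂ᵢAⱼ vⱼ`. A derivative of `f` seems to cost a second
derivative of `A`, but `∂ₗ f i = e l i + ∂ᵢ f l` with `e l i = ∑ⱼ (∂ᵢAⱼ ∂ₗvⱼ - ∂ᵢvⱼ ∂ₗAⱼ)`: the
second derivatives of `A` are symmetric and cancel in `∂ₗ f i - ∂ᵢ f l`. For fixed `l` the field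
`(∂ᵢ f l)ᵢ` is the gradient of a periodic function, so the projection kills it and `∂ₗ P f = P (e
l)`. Since `e l` contains only first derivatives of `A` and `v`, it lies in `C^{k,α}`; hence `P f`
lies in `C^{k+1,α}`. The rest is two estimates with constants independent of `k` and `L`.

Products (`holderNorm_mul_le`). The Leibniz formula for a derivative of order `j` has `2^j` terms,
which would give a constant growing with `k`. Periodicity compensates: for a periodic function, one
derivative is at most `L/4` times the next in sup norm (`norm_deriv_le_of_periodic`), so each
derivative short of order `k` gains a factor `1/4`. In a term where both factors are differentiated,
at most `k` of the `2k` available derivatives are spent, which gains at least `4⁻ʲ`; with `(j+1)^d`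
multi-indices the total is controlled by `∑ (j+1)^d 2⁻ʲ`. The two terms with an undifferentiated
factor are bounded directly by products of norms.

Projection (`IsHolder.holderNorm_scaleIntegral_le`). The operators `∂ᵢ∂ⱼΔ⁻¹` are written as
integrals over scales, `∫₀^∞ (∫ (∂ᵢ∂ⱼζ)(z) u(x + t z) dz) dt/t`, up to sign. Small scales converge
because the kernel has mean zero and `u` is Hölder, large scales because `u` is periodic. The
operators commute with derivatives, so an estimate for sup norm and Hölder seminorm, applied to
every `Dᵐu`, yields all orders with one constant. The kernel satisfies `∇ζ = -zη` with `∫ η = 1`, so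
that `t⁻¹ avg (Δζ)` is formally the `t`-derivative of `avg η`; integrating over `t` gives the
reproducing formula `sum_scaleIntegral_eq_neg`. From it follow that `hodge` kills gradients and has
divergence-free values. With the potential `scalePotential` this is a Helmholtz decomposition, and
`isLerayProjection_of_decomposition` identifies `hodge` with the `L²` projection. All is assembled
in `exists_lerayProjection`. -/

noncomputable section

namespace PeriodicHolder

/-! ### Iterated partial derivatives indexed by words -/

section Words

variable {d : ℕ} {F G : Type*} [NormedAddCommGroup F] [NormedSpace ℝ F]
  [NormedAddCommGroup G] [NormedSpace ℝ G]

/-- The iterated partial derivative along a word of coordinate directions, the last letter being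
applied first. -/
def wordDeriv (p : List (Fin d)) (u : Space d → F) : Space d → F :=
  p.foldr partialDeriv u

@[simp] lemma wordDeriv_nil (u : Space d → F) : wordDeriv [] u = u := rfl

@[simp] lemma wordDeriv_cons (i : Fin d) (p : List (Fin d)) (u : Space d → F) :
    wordDeriv (i :: p) u = partialDeriv i (wordDeriv p u) := rfl

lemma wordDeriv_append (p q : List (Fin d)) (u : Space d → F) :
    wordDeriv (p ++ q) u = wordDeriv p (wordDeriv q u) := by
  simp [wordDeriv]

/-- The sorted word in which the letter `i` occurs `m i` times. -/
def indexWord (m : Fin d → ℕ) : List (Fin d) :=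
  (List.finRange d).flatMap fun i => List.replicate (m i) i

lemma wordDeriv_replicate (n : ℕ) (i : Fin d) (u : Space d → F) :
    wordDeriv (List.replicate n i) u = (partialDeriv i)^[n] u := by
  induction n with
  | zero => rfl
  | succ n ih => rw [List.replicate_succ, wordDeriv_cons, ih, Function.iterate_succ_apply']

lemma multiDeriv_eq_wordDeriv (m : Fin d → ℕ) (u : Space d → F) :
    multiDeriv m u = wordDeriv (indexWord m) u := by
  unfold multiDeriv indexWord
  induction List.finRange d with
  | nil => rfl
  | cons i l ih =>
    rw [List.foldr_cons, ih, List.flatMap_cons, wordDeriv_append, wordDeriv_replicate]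

lemma count_indexWord (m : Fin d → ℕ) (i : Fin d) : (indexWord m).count i = m i := by
  have key : ∀ l : List (Fin d), l.Nodup →
      (l.flatMap fun j => List.replicate (m j) j).count i = if i ∈ l then m i else 0 := by
    intro l
    induction l with
    | nil => simp
    | cons j l ih =>
      intro h
      rw [List.nodup_cons] at h
      rw [List.flatMap_cons, List.count_append, ih h.2, List.count_replicate]
      by_cases hij : i = j
      · subst hij; simp [h.1]
      · simp [hij, Ne.symm hij]
  rw [indexWord, key _ (List.nodup_finRange d)]
  simp

lemma length_indexWord (m : Fin d → ℕ) : (indexWord m).length = ∑ i, m i := by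
  rw [indexWord, List.length_flatMap]
  simp [Finset.sum, List.finRange_eq_pmap_range, Fin.univ_def]

lemma mem_multiIndices {m : Fin d → ℕ} {j : ℕ} : m ∈ multiIndices d j ↔ ∑ i, m i = j := by
  simp [multiIndices, Finset.mem_piAntidiag]

lemma length_indexWord_of_mem {m : Fin d → ℕ} {j : ℕ} (hm : m ∈ multiIndices d j) :
    (indexWord m).length = j := by
  rw [length_indexWord, mem_multiIndices.1 hm]

/-- The multi-index counting the letters of a word. -/
def wordIndex (p : List (Fin d)) : Fin d → ℕ := fun i => p.count i

lemma indexWord_wordIndex_perm (p : List (Fin d)) : (indexWord (wordIndex p)).Perm p := by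
  rw [List.perm_iff_count]
  intro i
  rw [count_indexWord]
  rfl

lemma wordIndex_mem (p : List (Fin d)) : wordIndex p ∈ multiIndices d p.length := by
  rw [mem_multiIndices, ← length_indexWord, (indexWord_wordIndex_perm p).length_eq]

lemma indexWord_add_single_perm (m : Fin d → ℕ) (i : Fin d) :
    (indexWord (m + Pi.single i 1)).Perm (i :: indexWord m) := by
  rw [List.perm_iff_count]
  intro j
  rw [count_indexWord, List.count_cons, count_indexWord]
  by_cases h : i = j
  · subst h; simp
  · simp [h, Ne.symm h]

lemma contDiff_partialDeriv {n : ℕ} {u : Space d → F} (hu : ContDiff ℝ (n + 1 : ℕ) u) (i : Fin d) :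
    ContDiff ℝ n (partialDeriv i u) := by
  have h : ContDiff ℝ n (fderiv ℝ u) := hu.fderiv_right (by norm_cast)
  exact h.clm_apply contDiff_const

lemma contDiff_wordDeriv {n : ℕ} {u : Space d → F} (p : List (Fin d))
    (hu : ContDiff ℝ (n + p.length : ℕ) u) : ContDiff ℝ n (wordDeriv p u) := by
  induction p generalizing n with
  | nil => simpa using hu
  | cons i p ih =>
    refine contDiff_partialDeriv (ih ?_) i
    convert hu using 2
    simp; ring

lemma contDiff_wordDeriv' {n k : ℕ} {u : Space d → F} (p : List (Fin d))
    (hu : ContDiff ℝ k u) (h : n + p.length ≤ k) : ContDiff ℝ n (wordDeriv p u) :=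
  contDiff_wordDeriv p (hu.of_le (by exact_mod_cast h))

lemma differentiable_wordDeriv {k : ℕ} {u : Space d → F} (p : List (Fin d))
    (hu : ContDiff ℝ k u) (h : p.length < k) : Differentiable ℝ (wordDeriv p u) :=
  (contDiff_wordDeriv' (n := 1) p hu (by omega)).differentiable (by norm_num)

lemma partialDeriv_comm {u : Space d → F} (hu : ContDiff ℝ 2 u) (i j : Fin d) :
    partialDeriv i (partialDeriv j u) = partialDeriv j (partialDeriv i u) := by
  have h1 : ContDiff ℝ 1 (fderiv ℝ u) := hu.fderiv_right (by norm_num)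
  have h2 : Differentiable ℝ (fderiv ℝ u) := h1.differentiable (by norm_num)
  have key : ∀ (a b : Fin d) (x : Space d), partialDeriv a (partialDeriv b u) x =
      fderiv ℝ (fderiv ℝ u) x (EuclideanSpace.single a 1) (EuclideanSpace.single b 1) := by
    intro a b x
    have := ((h2 x).hasFDerivAt.clm_apply
      (hasFDerivAt_const (EuclideanSpace.single b (1 : ℝ)) x)).fderiv
    unfold partialDeriv
    rw [this]
    simp
  funext x
  rw [key, key]
  have hs : IsSymmSndFDerivAt ℝ u x :=
    (hu.contDiffAt).isSymmSndFDerivAt (by simp)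
  exact hs _ _

/-- Symmetry of second derivatives gives an adjacent swap, and swaps generate all permutations.
Derivatives can thus be handled as words with letters in any order, while the norms use sorted
multi-indices. -/
lemma wordDeriv_perm {p q : List (Fin d)} (h : p.Perm q) {u : Space d → F}
    (hu : ContDiff ℝ p.length u) : wordDeriv p u = wordDeriv q u := by
  induction h with
  | nil => rfl
  | cons i _ ih =>
    rw [wordDeriv_cons, wordDeriv_cons, ih (hu.of_le (by simp))]
  | swap i j l =>
    simp only [wordDeriv_cons]
    refine partialDeriv_comm (contDiff_wordDeriv' (n := 2) l hu ?_) _ _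
    simp; omega
  | trans h1 _ ih1 ih2 =>
    rw [ih1 hu, ih2 (by rwa [← h1.length_eq])]

lemma wordDeriv_eq_multiDeriv (p : List (Fin d)) {u : Space d → F}
    (hu : ContDiff ℝ p.length u) : wordDeriv p u = multiDeriv (wordIndex p) u := by
  rw [multiDeriv_eq_wordDeriv]
  exact wordDeriv_perm (indexWord_wordIndex_perm p).symm hu

lemma wordDeriv_cons_eq_multiDeriv {m : Fin d → ℕ} {j : ℕ} (hm : m ∈ multiIndices d j) (i : Fin d)
    {u : Space d → F} (hu : ContDiff ℝ (j + 1 : ℕ) u) :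
    partialDeriv i (multiDeriv m u) = multiDeriv (m + Pi.single i 1) u := by
  rw [multiDeriv_eq_wordDeriv, multiDeriv_eq_wordDeriv, ← wordDeriv_cons]
  refine wordDeriv_perm (indexWord_add_single_perm m i).symm ?_
  simpa [length_indexWord_of_mem hm] using hu

lemma multiDeriv_partialDeriv {m : Fin d → ℕ} {j : ℕ} (hm : m ∈ multiIndices d j) (i : Fin d)
    {u : Space d → F} (hu : ContDiff ℝ (j + 1 : ℕ) u) :
    multiDeriv m (partialDeriv i u) = multiDeriv (m + Pi.single i 1) u := by
  rw [multiDeriv_eq_wordDeriv, multiDeriv_eq_wordDeriv]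
  have : wordDeriv (indexWord m) (partialDeriv i u) = wordDeriv (indexWord m ++ [i]) u := by
    rw [wordDeriv_append]; rfl
  rw [this]
  refine wordDeriv_perm ?_ ?_
  · exact (List.perm_append_singleton _ _).trans (indexWord_add_single_perm m i).symm
  · simpa [length_indexWord_of_mem hm] using hu

lemma add_single_mem {m : Fin d → ℕ} {j : ℕ} (hm : m ∈ multiIndices d j) (i : Fin d) :
    m + Pi.single i 1 ∈ multiIndices d (j + 1) := by
  rw [mem_multiIndices] at *
  simp [Finset.sum_add_distrib, hm]

lemma exists_eq_add_single {m : Fin d → ℕ} {j : ℕ} (hm : m ∈ multiIndices d (j + 1)) :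
    ∃ i, ∃ m' ∈ multiIndices d j, m = m' + Pi.single i 1 := by
  rw [mem_multiIndices] at hm
  obtain ⟨i, -, hi⟩ : ∃ i ∈ Finset.univ, m i ≠ 0 := by
    by_contra! h
    rw [Finset.sum_eq_zero h] at hm
    omega
  have hle : Pi.single i 1 ≤ m := by
    intro l
    by_cases h : l = i
    · subst h; simp; omega
    · simp [h]
  refine ⟨i, m - Pi.single i 1, ?_, (tsub_add_cancel_of_le hle).symm⟩
  have h2 : ∑ l, ((m - Pi.single i 1 : Fin d → ℕ) + Pi.single i 1 : Fin d → ℕ) l = j + 1 := by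
    rw [tsub_add_cancel_of_le hle]; exact hm
  simp only [Pi.add_apply, Finset.sum_add_distrib, Finset.sum_pi_single', Finset.mem_univ,
    if_true] at h2
  rw [mem_multiIndices]
  omega

lemma partialDeriv_clm_comp (T : F →L[ℝ] G) {u : Space d → F} (hu : Differentiable ℝ u)
    (i : Fin d) : partialDeriv i (fun x => T (u x)) = fun x => T (partialDeriv i u x) := by
  funext x
  have := (T.hasFDerivAt.comp x (hu x).hasFDerivAt).fderiv
  unfold partialDeriv
  rw [show (fun x => T (u x)) = T ∘ u from rfl, this]
  rfl

lemma wordDeriv_clm_comp (T : F →L[ℝ] G) {u : Space d → F} (p : List (Fin d))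
    (hu : ContDiff ℝ p.length u) :
    wordDeriv p (fun x => T (u x)) = fun x => T (wordDeriv p u x) := by
  induction p with
  | nil => rfl
  | cons i p ih =>
    rw [wordDeriv_cons, ih (hu.of_le (by simp)), partialDeriv_clm_comp T _ i, wordDeriv_cons]
    exact differentiable_wordDeriv p hu (by simp)

lemma multiDeriv_clm_comp (T : F →L[ℝ] G) {u : Space d → F} {m : Fin d → ℕ} {j : ℕ}
    (hm : m ∈ multiIndices d j) (hu : ContDiff ℝ j u) :
    multiDeriv m (fun x => T (u x)) = fun x => T (multiDeriv m u x) := by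
  rw [multiDeriv_eq_wordDeriv, multiDeriv_eq_wordDeriv]
  exact wordDeriv_clm_comp T _ (by rwa [length_indexWord_of_mem hm])

lemma partialDeriv_add {u v : Space d → F} (hu : Differentiable ℝ u) (hv : Differentiable ℝ v)
    (i : Fin d) : partialDeriv i (fun x => u x + v x) =
      fun x => partialDeriv i u x + partialDeriv i v x := by
  funext x
  simp [partialDeriv, fderiv_fun_add (hu x) (hv x)]

lemma partialDeriv_sum {ι : Type*} (s : Finset ι) {u : ι → Space d → F}
    (hu : ∀ a ∈ s, Differentiable ℝ (u a)) (i : Fin d) :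
    partialDeriv i (fun x => ∑ a ∈ s, u a x) = fun x => ∑ a ∈ s, partialDeriv i (u a) x := by
  funext x
  have := (HasFDerivAt.fun_sum (fun a ha => (hu a ha x).hasFDerivAt)).fderiv
  unfold partialDeriv
  rw [this]
  simp

lemma wordDeriv_sum {ι : Type*} (s : Finset ι) {u : ι → Space d → F} (p : List (Fin d))
    (hu : ∀ a ∈ s, ContDiff ℝ p.length (u a)) :
    wordDeriv p (fun x => ∑ a ∈ s, u a x) = fun x => ∑ a ∈ s, wordDeriv p (u a) x := by
  induction p with
  | nil => rfl
  | cons i p ih =>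
    rw [wordDeriv_cons, ih fun a ha => (hu a ha).of_le (by simp), partialDeriv_sum]
    · rfl
    · exact fun a ha => differentiable_wordDeriv p (hu a ha) (by simp)

lemma partialDeriv_mul {u v : Space d → ℝ} (hu : Differentiable ℝ u) (hv : Differentiable ℝ v)
    (i : Fin d) : partialDeriv i (fun x => u x * v x) =
      fun x => partialDeriv i u x * v x + u x * partialDeriv i v x := by
  funext x
  have := ((hu x).hasFDerivAt.mul (hv x).hasFDerivAt).fderiv
  unfold partialDeriv
  rw [show (fun x => u x * v x) = u * v from rfl, this]
  simp
  ring

end Words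

/-! ### Periodicity, lattice translations and the period cell -/

section Periodic

variable {d : ℕ} {F : Type*} [NormedAddCommGroup F] [NormedSpace ℝ F] {L : ℝ}

lemma IsPeriodic.fderiv {u : Space d → F} (hu : IsPeriodic L u) : IsPeriodic L (fderiv ℝ u) := by
  intro x i
  rw [← fderiv_comp_add_right]
  congr 1
  funext y
  exact hu y i

lemma IsPeriodic.partialDeriv {u : Space d → F} (hu : IsPeriodic L u) (i : Fin d) :
    IsPeriodic L (partialDeriv i u) := by
  intro x j
  simp only [PeriodicHolder.partialDeriv, hu.fderiv x j]

lemma IsPeriodic.wordDeriv {u : Space d → F} (hu : IsPeriodic L u) (p : List (Fin d)) :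
    IsPeriodic L (wordDeriv p u) := by
  induction p with
  | nil => exact hu
  | cons i p ih => exact ih.partialDeriv i

lemma IsPeriodic.multiDeriv {u : Space d → F} (hu : IsPeriodic L u) (m : Fin d → ℕ) :
    IsPeriodic L (multiDeriv m u) := by
  rw [multiDeriv_eq_wordDeriv]; exact hu.wordDeriv _

end Periodic

section Lattice

variable {d : ℕ} {F : Type*} {L : ℝ}

lemma IsPeriodic.add_lattice {u : Space d → F} (hu : IsPeriodic L u) (n : Fin d → ℤ)
    (s : Finset (Fin d)) (x : Space d) :
    u (x + ∑ i ∈ s, n i • EuclideanSpace.single i L) = u x := by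
  induction s using Finset.induction_on with
  | empty => simp
  | insert i s hi ih =>
    have h : Function.Periodic u (EuclideanSpace.single i L) := fun y => hu y i
    rw [Finset.sum_insert hi, add_comm (n i • _), ← add_assoc, h.zsmul (n i), ih]

lemma lattice_apply (n : Fin d → ℤ) (j : Fin d) :
    (∑ i, n i • EuclideanSpace.single i L : Space d) j = n j * L := by
  simp [WithLp.ofLp_sum, Finset.sum_apply, Pi.single_apply]

/-- Every point has a translate by a lattice vector in the half-open period cell. -/
lemma exists_lattice (hL : 0 < L) (x : Space d) : ∃ n : Fin d → ℤ,
    ∀ j, (x + ∑ i, n i • EuclideanSpace.single i L) j ∈ Set.Ico 0 L := by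
  refine ⟨fun i => -⌊x i / L⌋, fun j => ?_⟩
  rw [PiLp.add_apply, lattice_apply]
  have h1 := Int.floor_le (x j / L)
  have h2 := Int.lt_floor_add_one (x j / L)
  rw [le_div_iff₀ hL] at h1
  rw [div_lt_iff₀ hL] at h2
  push_cast
  constructor <;> linarith

lemma IsPeriodic.exists_mem_cell {u : Space d → F} (hL : 0 < L) (hu : IsPeriodic L u)
    (x : Space d) : ∃ y ∈ cell d L, u y = u x := by
  obtain ⟨n, hn⟩ := exists_lattice hL x
  exact ⟨_, fun i => Set.Ico_subset_Icc_self (hn i), hu.add_lattice n _ x⟩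

end Lattice

lemma isCompact_cell (d : ℕ) (L : ℝ) : IsCompact (cell d L) := by
  have h : cell d L = (EuclideanSpace.equiv (Fin d) ℝ).toHomeomorph ⁻¹'
      (Set.univ.pi fun _ => Set.Icc 0 L) := by
    ext x
    simp only [cell, Set.mem_ofPred_eq, Set.mem_preimage, Set.mem_univ_pi]
    rfl
  rw [h, Homeomorph.isCompact_preimage]
  exact isCompact_univ_pi fun _ => isCompact_Icc

lemma convex_cell (d : ℕ) (L : ℝ) : Convex ℝ (cell d L) := by
  intro x hx y hy a b ha hb hab i
  exact (convex_Icc (0 : ℝ) L) (hx i) (hy i) ha hb hab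

lemma eq_sum_single {d : ℕ} (x : Space d) :
    x = ∑ i, x i • EuclideanSpace.single i (1 : ℝ) := by
  ext j; simp [WithLp.ofLp_sum, Finset.sum_apply, Pi.single_apply]

lemma single_add {d : ℕ} (i : Fin d) (a b : ℝ) :
    (EuclideanSpace.single i (a + b) : Space d) =
      EuclideanSpace.single i a + EuclideanSpace.single i b := by
  ext j
  by_cases h : j = i <;> simp [h]

lemma norm_le_sum_abs {d : ℕ} (x : Space d) : ‖x‖ ≤ ∑ i, |x i| := by
  calc ‖x‖ = ‖∑ i, x i • EuclideanSpace.single i (1 : ℝ)‖ := by rw [← eq_sum_single x]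
    _ ≤ ∑ i, ‖x i • EuclideanSpace.single i (1 : ℝ)‖ := norm_sum_le _ _
    _ = ∑ i, |x i| := by simp [norm_smul]

lemma abs_apply_le_norm {d : ℕ} (x : Space d) (i : Fin d) : |x i| ≤ ‖x‖ := by
  simpa using PiLp.norm_apply_le x i

lemma norm_sub_le_of_mem_cell {d : ℕ} {L : ℝ} {x y : Space d} (hx : x ∈ cell d L)
    (hy : y ∈ cell d L) : ‖x - y‖ ≤ d * L := by
  refine (norm_le_sum_abs _).trans ?_
  have : ∀ i ∈ (Finset.univ : Finset (Fin d)), |(x - y) i| ≤ L := by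
    intro i _
    have h1 := hx i
    have h2 := hy i
    rw [PiLp.sub_apply, abs_le]
    constructor <;> linarith [h1.1, h1.2, h2.1, h2.2]
  simpa using Finset.sum_le_sum this

section Clm

variable {d : ℕ} {F : Type*} [NormedAddCommGroup F] [NormedSpace ℝ F]

lemma clm_apply_eq_sum (T : Space d →L[ℝ] F) (x : Space d) :
    T x = ∑ i, x i • T (EuclideanSpace.single i 1) := by
  conv_lhs => rw [eq_sum_single x]
  simp

lemma opNorm_le_sum (T : Space d →L[ℝ] F) : ‖T‖ ≤ ∑ i, ‖T (EuclideanSpace.single i 1)‖ := by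
  refine T.opNorm_le_bound (Finset.sum_nonneg fun _ _ => norm_nonneg _) fun x => ?_
  rw [clm_apply_eq_sum, Finset.sum_mul]
  refine norm_sum_le_of_le _ fun i _ => ?_
  rw [norm_smul, mul_comm]
  gcongr
  exact abs_apply_le_norm x i

end Clm

/-! ### From bounds on the cell to bounds on the whole space -/

section Extension

variable {d : ℕ} {F : Type*} [NormedAddCommGroup F] {L : ℝ}

lemma enorm_le_supNorm {u : Space d → F} {x : Space d} (hx : x ∈ cell d L) :
    ‖u x‖ₑ ≤ supNorm L u :=
  le_iSup₂ (f := fun x (_ : x ∈ cell d L) => ‖u x‖ₑ) x hx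

lemma supNorm_le {u : Space d → F} {C : ℝ≥0∞} (h : ∀ x ∈ cell d L, ‖u x‖ₑ ≤ C) :
    supNorm L u ≤ C := iSup₂_le h

lemma IsPeriodic.enorm_le_supNorm {u : Space d → F} (hL : 0 < L) (hu : IsPeriodic L u)
    (x : Space d) : ‖u x‖ₑ ≤ supNorm L u := by
  obtain ⟨y, hy, h⟩ := hu.exists_mem_cell hL x
  rw [← h]; exact PeriodicHolder.enorm_le_supNorm hy

lemma IsPeriodic.norm_le_supNorm {u : Space d → F} (hL : 0 < L) (hu : IsPeriodic L u)
    (hfin : supNorm L u ≠ ⊤) (x : Space d) : ‖u x‖ ≤ (supNorm L u).toReal := by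
  have := ENNReal.toReal_mono hfin (hu.enorm_le_supNorm hL x)
  simpa using this

lemma supNorm_ne_top {u : Space d → F} (hu : Continuous u) : supNorm L u ≠ ⊤ := by
  obtain ⟨C, hC⟩ := (isCompact_cell d L).exists_bound_of_continuousOn hu.continuousOn
  refine ne_top_of_le_ne_top (b := ENNReal.ofReal C) ENNReal.ofReal_ne_top (supNorm_le fun x hx => ?_)
  rw [← ofReal_norm]
  exact ENNReal.ofReal_le_ofReal (hC x hx)

lemma norm_sub_le_of_holderSeminorm {u : Space d → F} {α : ℝ} (hL : 0 < L)
    (hfin : holderSeminorm L α u ≠ ⊤) {x y : Space d} (hx : x ∈ cell d L) (hy : y ∈ cell d L) :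
    ‖u x - u y‖ ≤ (holderSeminorm L α u).toReal / L ^ α * ‖x - y‖ ^ α := by
  by_cases hxy : x = y
  · subst hxy
    simp only [sub_self, norm_zero]
    positivity
  have hpos : 0 < ‖x - y‖ ^ α := Real.rpow_pos_of_pos (norm_pos_iff.2 (sub_ne_zero.2 hxy)) _
  have hLα : 0 < L ^ α := Real.rpow_pos_of_pos hL _
  have h1 : ENNReal.ofReal (L ^ α * (‖u x - u y‖ / ‖x - y‖ ^ α)) ≤ holderSeminorm L α u :=
    (le_iSup₂ (f := fun y (_ : y ∈ cell d L) =>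
      ENNReal.ofReal (L ^ α * (‖u x - u y‖ / ‖x - y‖ ^ α))) y hy).trans
    (le_iSup₂ (f := fun x (_ : x ∈ cell d L) => ⨆ y ∈ cell d L,
      ENNReal.ofReal (L ^ α * (‖u x - u y‖ / ‖x - y‖ ^ α))) x hx)
  rw [ENNReal.ofReal_le_iff_le_toReal hfin] at h1
  rw [div_mul_eq_mul_div, le_div_iff₀ hLα]
  have h2 := mul_le_mul_of_nonneg_right h1 hpos.le
  calc ‖u x - u y‖ * L ^ α = L ^ α * (‖u x - u y‖ / ‖x - y‖ ^ α) * ‖x - y‖ ^ α := by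
        field_simp
    _ ≤ _ := h2

lemma holderSeminorm_le {u : Space d → F} {α : ℝ} {C : ℝ≥0∞} {H : ℝ} (hL : 0 < L)
    (hH : 0 ≤ H) (hC : ENNReal.ofReal (L ^ α * H) ≤ C)
    (h : ∀ x ∈ cell d L, ∀ y ∈ cell d L, ‖u x - u y‖ ≤ H * ‖x - y‖ ^ α) :
    holderSeminorm L α u ≤ C := by
  refine iSup₂_le fun x hx => iSup₂_le fun y hy => le_trans (ENNReal.ofReal_le_ofReal ?_) hC
  have hLα : 0 < L ^ α := Real.rpow_pos_of_pos hL _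
  gcongr
  exact div_le_of_le_mul₀ (by positivity) hH (h x hx y hy)

/-- Translate the smaller point into `[0, L)`. If the points are at least a period apart, the other
one may be moved into the same period without increasing the distance. If they are closer, the
segment crosses the endpoint `L` at most once, and splitting there costs the factor `2`. -/
lemma norm_sub_le_of_periodic_real {α H : ℝ} {g : ℝ → F} (hα : 0 < α) (hL : 0 < L)
    (hg : Function.Periodic g L)
    (h : ∀ s ∈ Set.Icc 0 L, ∀ t ∈ Set.Icc 0 L, ‖g s - g t‖ ≤ H * |s - t| ^ α) (s t : ℝ) :
    ‖g s - g t‖ ≤ 2 * H * |s - t| ^ α := by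
  -- The sign of `H` is not assumed; the pair `0, L` forces it.
  have hH : 0 ≤ H := by
    have := h 0 ⟨le_rfl, hL.le⟩ L ⟨hL.le, le_rfl⟩
    have h2 : 0 < |0 - L| ^ α := Real.rpow_pos_of_pos (by simp [hL.ne']) _
    exact nonneg_of_mul_nonneg_left ((norm_nonneg _).trans this) h2
  have main : ∀ s ∈ Set.Ico 0 L, ∀ t, s ≤ t → ‖g s - g t‖ ≤ 2 * H * |s - t| ^ α := by
    intro s hs t hst
    have habs : |s - t| = t - s := by rw [abs_sub_comm, abs_of_nonneg (by linarith)]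
    by_cases hbig : L ≤ t - s
    · obtain ⟨t', ht', hgt⟩ := hg.exists_mem_Ico₀ hL t
      rw [hgt]
      refine (h s (Set.Ico_subset_Icc_self hs) t' (Set.Ico_subset_Icc_self ht')).trans ?_
      have h1 : |s - t'| ≤ |s - t| := by
        rw [habs, abs_le]; constructor <;> linarith [hs.1, hs.2, ht'.1, ht'.2]
      have h2 : |s - t'| ^ α ≤ |s - t| ^ α := Real.rpow_le_rpow (abs_nonneg _) h1 hα.le
      have h3 : 0 ≤ |s - t| ^ α := by positivity
      nlinarith
    push Not at hbig
    by_cases htL : t ≤ L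
    · refine (h s (Set.Ico_subset_Icc_self hs) t ⟨hs.1.trans hst, htL⟩).trans ?_
      have h3 : 0 ≤ |s - t| ^ α := by positivity
      nlinarith
    push Not at htL
    have e1 := h s (Set.Ico_subset_Icc_self hs) L ⟨hL.le, le_rfl⟩
    have e2 := h 0 ⟨le_rfl, hL.le⟩ (t - L) ⟨by linarith, by linarith [hs.1, hs.2]⟩
    have e3 : g 0 = g L := by simpa using (hg 0).symm
    have e4 : g (t - L) = g t := hg.sub_eq t
    rw [e3, e4] at e2
    have f1 : |s - L| ^ α ≤ |s - t| ^ α := by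
      refine Real.rpow_le_rpow (abs_nonneg _) ?_ hα.le
      rw [habs, abs_le]; constructor <;> linarith [hs.1, hs.2]
    have f2 : |0 - (t - L)| ^ α ≤ |s - t| ^ α := by
      refine Real.rpow_le_rpow (abs_nonneg _) ?_ hα.le
      rw [habs, abs_le]; constructor <;> linarith [hs.1, hs.2]
    calc ‖g s - g t‖ ≤ ‖g s - g L‖ + ‖g L - g t‖ := norm_sub_le_norm_sub_add_norm_sub _ _ _
      _ ≤ H * |s - t| ^ α + H * |s - t| ^ α := by
        gcongr
        · exact e1.trans (by gcongr)
        · exact e2.trans (by gcongr)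
      _ = 2 * H * |s - t| ^ α := by ring
  have main2 : ∀ s t, s ≤ t → ‖g s - g t‖ ≤ 2 * H * |s - t| ^ α := by
    intro s t hst
    have hs := main (toIcoMod hL 0 s) (by simpa using toIcoMod_mem_Ico hL 0 s)
      (t - toIcoDiv hL 0 s • L) (by rw [toIcoMod]; linarith)
    rwa [hg.sub_zsmul_eq, toIcoMod, hg.sub_zsmul_eq, sub_sub_sub_cancel_right] at hs
  rcases le_total s t with hst | hst
  · exact main2 s t hst
  · rw [norm_sub_rev, abs_sub_comm]; exact main2 t s hst

/-- A periodic function that is Hölder continuous on the closed cell is so on the whole space. -/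
lemma IsPeriodic.norm_sub_le {u : Space d → F} {α H : ℝ} (hα : 0 < α) (hL : 0 < L)
    (hu : IsPeriodic L u)
    (h : ∀ x ∈ cell d L, ∀ y ∈ cell d L, ‖u x - u y‖ ≤ H * ‖x - y‖ ^ α) (x y : Space d) :
    ‖u x - u y‖ ≤ d * (2 * H) * ‖x - y‖ ^ α := by
  -- Go from `x` to `y` along the axes, one coordinate at a time, whence the factor `d`. For a
  -- single leg, translate the starting point into the cell: the other coordinates stay there, so
  -- the restriction to the line satisfies the one-dimensional hypothesis.
  have step : ∀ (x : Space d) (i : Fin d) (s : ℝ),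
      ‖u x - u (x + EuclideanSpace.single i s)‖ ≤ 2 * H * |s| ^ α := by
    intro x i s
    obtain ⟨n, hn⟩ := exists_lattice hL x
    set z := x + ∑ i, n i • EuclideanSpace.single i L with hz
    have e1 : u x = u z := (hu.add_lattice n _ x).symm
    have e2 : u (x + EuclideanSpace.single i s) = u (z + EuclideanSpace.single i s) := by
      rw [hz, add_right_comm, hu.add_lattice]
    set g : ℝ → F := fun r => u (z + EuclideanSpace.single i (r - z i)) with hg
    have hper : Function.Periodic g L := by
      intro r
      simp only [hg]
      rw [show r + L - z i = (r - z i) + L by ring, single_add, ← add_assoc, hu]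
    have hgb : ∀ s ∈ Set.Icc 0 L, ∀ t ∈ Set.Icc 0 L, ‖g s - g t‖ ≤ H * |s - t| ^ α := by
      have hmem : ∀ s ∈ Set.Icc 0 L, z + EuclideanSpace.single i (s - z i) ∈ cell d L := by
        intro s hs j
        by_cases hj : j = i
        · subst hj; simpa using hs
        · simpa [hj] using Set.Ico_subset_Icc_self (hn j)
      intro s hs t ht
      refine (h _ (hmem s hs) _ (hmem t ht)).trans_eq ?_
      rw [add_sub_add_left_eq_sub, show s - z i = (s - t) + (t - z i) by ring, single_add]
      simp
    have := norm_sub_le_of_periodic_real hα hL hper hgb (z i) (z i + s)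
    have h0 : (EuclideanSpace.single i (0 : ℝ) : Space d) = 0 := by
      ext j; by_cases h : j = i <;> simp [h]
    rw [e1, e2]
    simpa [hg, h0] using this
  have main : ∀ s : Finset (Fin d),
      ‖u x - u (x + ∑ i ∈ s, EuclideanSpace.single i (y i - x i))‖ ≤
        s.card * (2 * H) * ‖x - y‖ ^ α := by
    intro s
    induction s using Finset.induction_on with
    | empty => simp
    | insert i s hi ih =>
      have hst := step (x + ∑ i ∈ s, EuclideanSpace.single i (y i - x i)) i (y i - x i)
      have hH : 0 ≤ 2 * H := by
        have h0 := step 0 i 1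
        simp only [abs_one, Real.one_rpow, mul_one] at h0
        exact (norm_nonneg _).trans h0
      have h2 : |y i - x i| ^ α ≤ ‖x - y‖ ^ α := by
        refine Real.rpow_le_rpow (abs_nonneg _) ?_ hα.le
        rw [norm_sub_rev]
        exact abs_apply_le_norm (y - x) i
      rw [Finset.sum_insert hi, add_comm (EuclideanSpace.single i _), ← add_assoc,
        Finset.card_insert_of_notMem hi]
      refine (norm_sub_le_norm_sub_add_norm_sub _ _ _).trans ((add_le_add ih hst).trans ?_)
      push_cast
      nlinarith [mul_le_mul_of_nonneg_left h2 hH]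
  have hy : y = x + ∑ i, EuclideanSpace.single i (y i - x i) := by
    ext j; simp [WithLp.ofLp_sum, Finset.sum_apply, Pi.single_apply]
  have := main Finset.univ
  rw [← hy] at this
  simpa using this

lemma IsPeriodic.norm_sub_le_holderSeminorm {u : Space d → F} {α : ℝ} (hα : 0 < α) (hL : 0 < L)
    (hu : IsPeriodic L u) (hfin : holderSeminorm L α u ≠ ⊤) (x y : Space d) :
    ‖u x - u y‖ ≤ d * (2 * ((holderSeminorm L α u).toReal / L ^ α)) * ‖x - y‖ ^ α :=
  hu.norm_sub_le hα hL (fun _ hx _ hy => norm_sub_le_of_holderSeminorm hL hfin hx hy) x y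

end Extension

/-! ### Calculus of the Hölder norms: sums, components, change of order -/

section Comparison

variable {d : ℕ} {F G : Type*} [NormedAddCommGroup F] [NormedAddCommGroup G] {L α : ℝ}

lemma supNorm_le_of_norm_le_sum {ι : Type*} (s : Finset ι) {w : Space d → F} {u : ι → Space d → G}
    (h : ∀ x, ‖w x‖ ≤ ∑ a ∈ s, ‖u a x‖) : supNorm L w ≤ ∑ a ∈ s, supNorm L (u a) := by
  refine supNorm_le fun x hx => ?_
  calc ‖w x‖ₑ = ENNReal.ofReal ‖w x‖ := (ofReal_norm _).symm
    _ ≤ ENNReal.ofReal (∑ a ∈ s, ‖u a x‖) := ENNReal.ofReal_le_ofReal (h x)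
    _ = ∑ a ∈ s, ‖u a x‖ₑ := by
      rw [ENNReal.ofReal_sum_of_nonneg fun _ _ => norm_nonneg _]
      simp
    _ ≤ _ := Finset.sum_le_sum fun a _ => enorm_le_supNorm hx

lemma holderSeminorm_le_of_norm_le_sum {ι : Type*} (s : Finset ι) {w : Space d → F}
    {u : ι → Space d → G} (hL : 0 < L)
    (h : ∀ x y, ‖w x - w y‖ ≤ ∑ a ∈ s, ‖u a x - u a y‖) :
    holderSeminorm L α w ≤ ∑ a ∈ s, holderSeminorm L α (u a) := by
  refine iSup₂_le fun x hx => iSup₂_le fun y hy => ?_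
  have hLα : 0 < L ^ α := Real.rpow_pos_of_pos hL _
  calc ENNReal.ofReal (L ^ α * (‖w x - w y‖ / ‖x - y‖ ^ α))
      ≤ ENNReal.ofReal (∑ a ∈ s, L ^ α * (‖u a x - u a y‖ / ‖x - y‖ ^ α)) := by
        rw [← Finset.mul_sum, ← Finset.sum_div]
        gcongr
        exact h x y
    _ = ∑ a ∈ s, ENNReal.ofReal (L ^ α * (‖u a x - u a y‖ / ‖x - y‖ ^ α)) :=
        ENNReal.ofReal_sum_of_nonneg fun _ _ => by positivity
    _ ≤ _ := Finset.sum_le_sum fun a _ =>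
        (le_iSup₂ (f := fun y (_ : y ∈ cell d L) =>
          ENNReal.ofReal (L ^ α * (‖u a x - u a y‖ / ‖x - y‖ ^ α))) y hy).trans
        (le_iSup₂ (f := fun x (_ : x ∈ cell d L) => ⨆ y ∈ cell d L,
          ENNReal.ofReal (L ^ α * (‖u a x - u a y‖ / ‖x - y‖ ^ α))) x hx)

end Comparison

section NormLemmas

variable {d : ℕ} {F G : Type*} [NormedAddCommGroup F] [NormedSpace ℝ F]
  [NormedAddCommGroup G] [NormedSpace ℝ G] {L α : ℝ}

lemma sum_holderNorm {ι : Type*} (s : Finset ι) (u : ι → Space d → G) (k : ℕ) :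
    ∑ a ∈ s, holderNorm L k α (u a) =
      (∑ j ∈ Finset.range (k + 1), ∑ m ∈ multiIndices d j,
        ENNReal.ofReal (L ^ j) * ∑ a ∈ s, supNorm L (multiDeriv m (u a))) +
      ∑ m ∈ multiIndices d k,
        ENNReal.ofReal (L ^ k) * ∑ a ∈ s, holderSeminorm L α (multiDeriv m (u a)) := by
  simp only [holderNorm, cNorm, Finset.sum_add_distrib, Finset.mul_sum]
  congr 1
  · rw [Finset.sum_comm]
    refine Finset.sum_congr rfl fun j _ => ?_
    rw [Finset.sum_comm]
  · rw [Finset.sum_comm]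

/-- A comparison valid separately for each multi-index passes to the full norm with the same
constant, so nothing accumulates with `k`. -/
lemma holderNorm_le_sum {ι : Type*} (s : Finset ι) {w : Space d → F} {u : ι → Space d → G}
    {c : ℝ≥0∞} {k : ℕ}
    (h₁ : ∀ j ≤ k, ∀ m ∈ multiIndices d j,
      supNorm L (multiDeriv m w) ≤ c * ∑ a ∈ s, supNorm L (multiDeriv m (u a)))
    (h₂ : ∀ m ∈ multiIndices d k, holderSeminorm L α (multiDeriv m w) ≤
      c * ∑ a ∈ s, holderSeminorm L α (multiDeriv m (u a))) :
    holderNorm L k α w ≤ c * ∑ a ∈ s, holderNorm L k α (u a) := by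
  rw [sum_holderNorm, mul_add, holderNorm, cNorm]
  refine add_le_add ?_ ?_
  · rw [Finset.mul_sum]
    refine Finset.sum_le_sum fun j hj => ?_
    rw [Finset.mul_sum]
    refine Finset.sum_le_sum fun m hm => ?_
    rw [mul_left_comm]
    gcongr
    exact h₁ j (by simpa [Nat.lt_succ_iff] using hj) m hm
  · rw [Finset.mul_sum]
    refine Finset.sum_le_sum fun m hm => ?_
    rw [mul_left_comm]
    gcongr
    exact h₂ m hm

lemma holderNorm_clm_comp_le (hL : 0 < L) {k : ℕ} (T : F →L[ℝ] G) (hT : ‖T‖ ≤ 1)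
    {u : Space d → F} (hu : ContDiff ℝ k u) :
    holderNorm L k α (fun x => T (u x)) ≤ holderNorm L k α u := by
  have hT' : ∀ y, ‖T y‖ ≤ ‖y‖ := fun y =>
    (T.le_opNorm y).trans (mul_le_of_le_one_left (norm_nonneg _) hT)
  have := holderNorm_le_sum (L := L) (α := α) (k := k) (Finset.univ : Finset Unit)
    (w := fun x => T (u x)) (u := fun _ => u) (c := 1) ?_ ?_
  · simpa using this
  · intro j hj m hm
    rw [one_mul, multiDeriv_clm_comp T hm (hu.of_le (by exact_mod_cast hj))]
    exact supNorm_le_of_norm_le_sum _ fun x => by simpa using hT' _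
  · intro m hm
    rw [one_mul, multiDeriv_clm_comp T hm hu]
    exact holderSeminorm_le_of_norm_le_sum _ hL fun x y => by
      simpa [← map_sub] using hT' _

lemma multiDeriv_sum {ι : Type*} (s : Finset ι) {u : ι → Space d → F} {m : Fin d → ℕ} {j : ℕ}
    (hm : m ∈ multiIndices d j) (hu : ∀ a ∈ s, ContDiff ℝ j (u a)) :
    multiDeriv m (fun x => ∑ a ∈ s, u a x) = fun x => ∑ a ∈ s, multiDeriv m (u a) x := by
  simp only [multiDeriv_eq_wordDeriv]
  refine wordDeriv_sum s _ fun a ha => ?_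
  rw [length_indexWord_of_mem hm]
  exact hu a ha

lemma holderNorm_sum_le (hL : 0 < L) {ι : Type*} (s : Finset ι) {u : ι → Space d → F} {k : ℕ}
    (hu : ∀ a ∈ s, ContDiff ℝ k (u a)) :
    holderNorm L k α (fun x => ∑ a ∈ s, u a x) ≤ ∑ a ∈ s, holderNorm L k α (u a) := by
  rw [← one_mul (∑ a ∈ s, _)]
  refine holderNorm_le_sum s ?_ ?_
  · intro j hj m hm
    rw [one_mul, multiDeriv_sum s hm fun a ha => (hu a ha).of_le (by exact_mod_cast hj)]
    exact supNorm_le_of_norm_le_sum _ fun x => norm_sum_le _ _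
  · intro m hm
    rw [one_mul, multiDeriv_sum s hm hu]
    refine holderSeminorm_le_of_norm_le_sum _ hL fun x y => ?_
    rw [← Finset.sum_sub_distrib]
    exact norm_sum_le _ _

lemma holderNorm_add_le (hL : 0 < L) {u v : Space d → F} {k : ℕ}
    (hu : ContDiff ℝ k u) (hv : ContDiff ℝ k v) :
    holderNorm L k α (fun x => u x + v x) ≤ holderNorm L k α u + holderNorm L k α v := by
  have := holderNorm_sum_le (L := L) (α := α) hL (Finset.univ : Finset (Fin 2)) (u := ![u, v])
    (k := k) (fun a _ => by fin_cases a <;> simpa)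
  simpa [Fin.sum_univ_two] using this

lemma holderNorm_neg_le (hL : 0 < L) {u : Space d → F} {k : ℕ} (hu : ContDiff ℝ k u) :
    holderNorm L k α (fun x => - u x) ≤ holderNorm L k α u := by
  refine holderNorm_clm_comp_le hL (-ContinuousLinearMap.id ℝ F) ?_ hu
  rw [norm_neg]; exact ContinuousLinearMap.norm_id_le

lemma holderNorm_sub_le (hL : 0 < L) {u v : Space d → F} {k : ℕ}
    (hu : ContDiff ℝ k u) (hv : ContDiff ℝ k v) :
    holderNorm L k α (fun x => u x - v x) ≤ holderNorm L k α u + holderNorm L k α v := by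
  simp only [sub_eq_add_neg]
  exact (holderNorm_add_le hL hu hv.neg).trans (add_le_add le_rfl (holderNorm_neg_le hL hv))

lemma holderNorm_le_sum_components (hL : 0 < L) {w : Space d → Space d} {k : ℕ}
    (hw : ContDiff ℝ k w) :
    holderNorm L k α w ≤ ∑ i, holderNorm L k α (fun x => w x i) := by
  have hc : ∀ {j : ℕ} {m : Fin d → ℕ}, m ∈ multiIndices d j → j ≤ k → ∀ i,
      multiDeriv m (fun x => w x i) = fun x => multiDeriv m w x i := fun {j m} hm hj i =>
    multiDeriv_clm_comp (EuclideanSpace.proj i : Space d →L[ℝ] ℝ) hm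
      (hw.of_le (by exact_mod_cast hj))
  rw [← one_mul (∑ i, _)]
  refine holderNorm_le_sum _ ?_ ?_
  · intro j hj m hm
    simp only [one_mul, hc hm hj]
    exact supNorm_le_of_norm_le_sum _ fun x => norm_le_sum_abs _
  · intro m hm
    simp only [one_mul, hc hm le_rfl]
    exact holderSeminorm_le_of_norm_le_sum _ hL fun x y => norm_le_sum_abs _

lemma sum_multiIndices_add_single_le (g : (Fin d → ℕ) → ℝ≥0∞) (j : ℕ) (i : Fin d) :
    ∑ m ∈ multiIndices d j, g (m + Pi.single i 1) ≤ ∑ m ∈ multiIndices d (j + 1), g m := by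
  have h : ∑ m ∈ multiIndices d j, g (m + Pi.single i 1) =
      ∑ m ∈ (multiIndices d j).image (· + Pi.single i 1), g m := by
    rw [Finset.sum_image]
    intro a _ b _ hab
    exact add_right_cancel hab
  rw [h]
  refine Finset.sum_le_sum_of_subset ?_
  intro m hm
  obtain ⟨m', hm', rfl⟩ := Finset.mem_image.1 hm
  exact add_single_mem hm' i

lemma sum_multiIndices_succ_le (g : (Fin d → ℕ) → ℝ≥0∞) (j : ℕ) :
    ∑ m ∈ multiIndices d (j + 1), g m ≤
      ∑ i, ∑ m ∈ multiIndices d j, g (m + Pi.single i 1) := by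
  rw [← Finset.sum_product']
  have hsub : multiIndices d (j + 1) ⊆
      (Finset.univ ×ˢ multiIndices d j).image
        (fun q : Fin d × (Fin d → ℕ) => q.2 + Pi.single q.1 1) := by
    intro m hm
    obtain ⟨i, m', hm', rfl⟩ := exists_eq_add_single hm
    exact Finset.mem_image.2 ⟨(i, m'), by simp [hm'], rfl⟩
  refine (Finset.sum_le_sum_of_subset hsub).trans ?_
  exact Finset.sum_image_le_of_nonneg (fun _ _ => bot_le)

lemma ofReal_pow_succ (hL : 0 < L) (j : ℕ) :
    ENNReal.ofReal (L ^ (j + 1)) = ENNReal.ofReal L * ENNReal.ofReal (L ^ j) := by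
  rw [← ENNReal.ofReal_mul hL.le, pow_succ']

lemma multiIndices_zero (d : ℕ) : multiIndices d 0 = {0} := by
  simp [multiIndices]

lemma multiDeriv_zero (u : Space d → F) : multiDeriv 0 u = u := by
  have : indexWord (0 : Fin d → ℕ) = [] := by
    rw [← List.length_eq_zero_iff, length_indexWord]; simp
  rw [multiDeriv_eq_wordDeriv, this]; rfl

/-- The map `m ↦ m + eᵢ` is injective, so each term on the right is used at most once. The factor
`L` matches the weights of orders `j` and `j + 1`. -/
lemma holderNorm_partialDeriv_le (hL : 0 < L) {k : ℕ} {u : Space d → F}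
    (hu : ContDiff ℝ (k + 1 : ℕ) u) (i : Fin d) :
    ENNReal.ofReal L * holderNorm L k α (partialDeriv i u) ≤ holderNorm L (k + 1) α u := by
  rw [holderNorm, holderNorm, cNorm, cNorm, Finset.sum_range_succ' _ (k + 1), mul_add,
    Finset.mul_sum]
  refine add_le_add (le_add_right (Finset.sum_le_sum fun j hj => ?_)) ?_
  · have hj' : j + 1 ≤ k + 1 := by simpa [Nat.lt_succ_iff] using hj
    refine le_trans (le_of_eq ?_) (sum_multiIndices_add_single_le
      (fun m => ENNReal.ofReal (L ^ (j + 1)) * supNorm L (multiDeriv m u)) j i)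
    rw [Finset.mul_sum]
    refine Finset.sum_congr rfl fun m hm => ?_
    rw [multiDeriv_partialDeriv hm i (hu.of_le (by exact_mod_cast hj')), ofReal_pow_succ hL,
      mul_assoc]
  · refine le_trans (le_of_eq ?_) (sum_multiIndices_add_single_le
      (fun m => ENNReal.ofReal (L ^ (k + 1)) * holderSeminorm L α (multiDeriv m u)) k i)
    rw [Finset.mul_sum]
    refine Finset.sum_congr rfl fun m hm => ?_
    rw [multiDeriv_partialDeriv hm i hu, ofReal_pow_succ hL, mul_assoc]

/-- Every nonzero multi-index is some `m + eᵢ`; counting it once for each admissible `i` only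
increases the right side. This turns bounds on `∂ₗ P f` into a bound on `P f` one order higher. -/
lemma holderNorm_succ_le (hL : 0 < L) {k : ℕ} {u : Space d → F}
    (hu : ContDiff ℝ (k + 1 : ℕ) u) :
    holderNorm L (k + 1) α u ≤
      supNorm L u + ∑ i, ENNReal.ofReal L * holderNorm L k α (partialDeriv i u) := by
  rw [← Finset.mul_sum, sum_holderNorm, holderNorm, cNorm, Finset.sum_range_succ' _ (k + 1),
    multiIndices_zero, Finset.sum_singleton, multiDeriv_zero, pow_zero, ENNReal.ofReal_one,
    one_mul, add_right_comm, add_comm _ (supNorm L u), mul_add]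
  refine add_le_add le_rfl (add_le_add ?_ ?_)
  · rw [Finset.mul_sum]
    refine Finset.sum_le_sum fun j hj => ?_
    have hj' : j + 1 ≤ k + 1 := by simpa [Nat.lt_succ_iff] using hj
    refine (sum_multiIndices_succ_le _ j).trans (le_of_eq ?_)
    rw [Finset.sum_comm, Finset.mul_sum]
    refine Finset.sum_congr rfl fun m hm => ?_
    rw [← mul_assoc, ← ofReal_pow_succ hL, Finset.mul_sum]
    refine Finset.sum_congr rfl fun i _ => ?_
    rw [multiDeriv_partialDeriv hm i (hu.of_le (by exact_mod_cast hj'))]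
  · refine (sum_multiIndices_succ_le _ k).trans (le_of_eq ?_)
    rw [Finset.sum_comm, Finset.mul_sum]
    refine Finset.sum_congr rfl fun m hm => ?_
    rw [← mul_assoc, ← ofReal_pow_succ hL, Finset.mul_sum]
    refine Finset.sum_congr rfl fun i _ => ?_
    rw [multiDeriv_partialDeriv hm i hu]

lemma norm_fderiv_le {u : Space d → F} {x : Space d} (hx : x ∈ cell d L)
    (hfin : ∑ i, supNorm L (partialDeriv i u) ≠ ⊤) :
    ‖fderiv ℝ u x‖ ≤ (∑ i, supNorm L (partialDeriv i u)).toReal := by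
  refine (opNorm_le_sum _).trans ?_
  rw [ENNReal.toReal_sum fun i _ h => hfin (by
    rw [ENNReal.sum_eq_top]; exact ⟨i, Finset.mem_univ i, h⟩)]
  refine Finset.sum_le_sum fun i _ => ?_
  have hi : supNorm L (partialDeriv i u) ≠ ⊤ := fun h => hfin (by
    rw [ENNReal.sum_eq_top]; exact ⟨i, Finset.mem_univ i, h⟩)
  have := ENNReal.toReal_mono hi (enorm_le_supNorm (u := partialDeriv i u) hx)
  rwa [toReal_enorm] at this

/-- The cell is convex with diameter at most `dL`. Combine the mean value inequality with `|x - y| ≤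
(dL)^(1-α) |x - y|^α` and `d^(1-α) ≤ d`. -/
lemma holderSeminorm_le_partialDeriv (hL : 0 < L) (hα₀ : 0 < α) (hα₁ : α < 1) {u : Space d → F}
    (hu : Differentiable ℝ u) :
    holderSeminorm L α u ≤ d * ∑ i, ENNReal.ofReal L * supNorm L (partialDeriv i u) := by
  rw [← Finset.mul_sum]
  set S := ∑ i, supNorm L (partialDeriv i u) with hS
  rcases Nat.eq_zero_or_pos d with rfl | hd
  · refine iSup₂_le fun x _ => iSup₂_le fun y _ => ?_
    rw [Subsingleton.elim x y]; simp
  -- The derivatives are not assumed bounded. If their suprema are infinite, so is the right side,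
  -- because `d` and `L` are positive.
  by_cases hfin : S = ⊤
  · have h1 : (d : ℝ≥0∞) ≠ 0 := by exact_mod_cast hd.ne'
    have h2 : ENNReal.ofReal L ≠ 0 := by simpa using hL
    rw [hfin, ENNReal.mul_top h2, ENNReal.mul_top h1]
    exact le_top
  have hd1 : (1 : ℝ) ≤ d := by exact_mod_cast hd
  have hLα : 0 < L ^ α := Real.rpow_pos_of_pos hL _
  refine holderSeminorm_le (H := S.toReal * (d * L) ^ (1 - α)) hL (by positivity) ?_ ?_
  · have h3 : (d * L : ℝ) ^ (1 - α) ≤ d * L ^ (1 - α) := by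
      rw [Real.mul_rpow (by positivity) hL.le]
      gcongr
      exact (Real.rpow_le_rpow_of_exponent_le hd1 (by linarith)).trans_eq (Real.rpow_one _)
    have h4 : L ^ α * L ^ (1 - α) = L := by
      rw [← Real.rpow_add hL]; simp
    have h5 : (d : ℝ≥0∞) * (ENNReal.ofReal L * S) = ENNReal.ofReal (d * (L * S.toReal)) := by
      rw [ENNReal.ofReal_mul (by positivity), ENNReal.ofReal_mul hL.le, ENNReal.ofReal_toReal hfin,
        ENNReal.ofReal_natCast]
    rw [h5]
    apply ENNReal.ofReal_le_ofReal
    calc L ^ α * (S.toReal * (d * L : ℝ) ^ (1 - α))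
        ≤ L ^ α * (S.toReal * (d * L ^ (1 - α))) := by gcongr
      _ = d * ((L ^ α * L ^ (1 - α)) * S.toReal) := by ring
      _ = _ := by rw [h4]
  · intro x hx y hy
    have h1 := (convex_cell d L).norm_image_sub_le_of_norm_fderiv_le (𝕜 := ℝ)
      (fun z _ => hu z) (fun z hz => norm_fderiv_le hz hfin) hy hx
    by_cases hxy : x = y
    · subst hxy; simp; positivity
    have hpos : 0 < ‖x - y‖ := norm_pos_iff.2 (sub_ne_zero.2 hxy)
    refine h1.trans ?_
    rw [mul_assoc]
    refine mul_le_mul_of_nonneg_left ?_ ENNReal.toReal_nonneg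
    calc ‖x - y‖ = ‖x - y‖ ^ (1 - α) * ‖x - y‖ ^ α := by rw [← Real.rpow_add hpos]; simp
      _ ≤ _ := by
        gcongr
        exact norm_sub_le_of_mem_cell hx hy

/-- All the Hölder semi-norms of the derivatives of order at most `k` are controlled by the
`C^{k,α}` norm. -/
lemma sum_holderSeminorm_le (hL : 0 < L) (hα₀ : 0 < α) (hα₁ : α < 1) {k : ℕ} {u : Space d → F}
    (hu : ContDiff ℝ k u) :
    ∑ j ∈ Finset.range (k + 1), ∑ m ∈ multiIndices d j,
      ENNReal.ofReal (L ^ j) * holderSeminorm L α (multiDeriv m u) ≤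
      (d * d + 1) * holderNorm L k α u := by
  have h : ∑ j ∈ Finset.range k, ∑ m ∈ multiIndices d j,
      ENNReal.ofReal (L ^ j) * holderSeminorm L α (multiDeriv m u) ≤
      d * d * cNorm L k u := by
    calc _ ≤ ∑ j ∈ Finset.range k, d * d * ∑ m ∈ multiIndices d (j + 1),
          ENNReal.ofReal (L ^ (j + 1)) * supNorm L (multiDeriv m u) := by
          refine Finset.sum_le_sum fun j hj => ?_
          have hj' : j + 1 ≤ k := by simpa using hj
          have hu' : ContDiff ℝ (j + 1 : ℕ) u := hu.of_le (by exact_mod_cast hj')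
          -- One factor `d` comes from the diameter of the cell, the other from the sum over the `d`
          -- directions `i`.
          have e1 : ∀ m ∈ multiIndices d j,
              ENNReal.ofReal (L ^ j) * holderSeminorm L α (multiDeriv m u) ≤
              d * ∑ i, ENNReal.ofReal (L ^ (j + 1)) *
                supNorm L (multiDeriv (m + Pi.single i 1) u) := by
            intro m hm
            have hdiff : Differentiable ℝ (multiDeriv m u) := by
              rw [multiDeriv_eq_wordDeriv]
              exact differentiable_wordDeriv _ hu' (by rw [length_indexWord_of_mem hm]; omega)
            refine (mul_le_mul_right (holderSeminorm_le_partialDeriv hL hα₀ hα₁ hdiff) _).trans_eq ?_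
            rw [mul_left_comm, Finset.mul_sum]
            congr 1
            refine Finset.sum_congr rfl fun i _ => ?_
            rw [wordDeriv_cons_eq_multiDeriv hm i hu', ← mul_assoc, mul_comm (ENNReal.ofReal (L ^ j)),
              ofReal_pow_succ hL]
          refine (Finset.sum_le_sum e1).trans ?_
          rw [← Finset.mul_sum, Finset.sum_comm, mul_assoc]
          refine mul_le_mul_right ?_ _
          refine (Finset.sum_le_sum fun i _ => sum_multiIndices_add_single_le
            (fun m => ENNReal.ofReal (L ^ (j + 1)) * supNorm L (multiDeriv m u)) j i).trans ?_
          simp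
      _ = d * d * ∑ j ∈ Finset.range k, ∑ m ∈ multiIndices d (j + 1),
          ENNReal.ofReal (L ^ (j + 1)) * supNorm L (multiDeriv m u) := by rw [Finset.mul_sum]
      _ ≤ _ := by
        refine mul_le_mul_right ?_ _
        rw [cNorm, Finset.sum_range_succ' _ k]
        exact le_self_add
  rw [Finset.sum_range_succ, add_mul, one_mul]
  refine add_le_add (h.trans ?_) ?_
  · exact mul_le_mul_right le_self_add _
  · exact le_add_self

lemma holderNorm_le_succ (hL : 0 < L) (hα₀ : 0 < α) (hα₁ : α < 1) {k : ℕ} {u : Space d → F}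
    (hu : ContDiff ℝ (k + 1 : ℕ) u) :
    holderNorm L k α u ≤ (d * d + 2) * holderNorm L (k + 1) α u := by
  have h := sum_holderSeminorm_le hL hα₀ hα₁ hu
  rw [Finset.sum_range_succ, Finset.sum_range_succ] at h
  have h1 : cNorm L k u ≤ holderNorm L (k + 1) α u := by
    rw [holderNorm, cNorm, cNorm, Finset.sum_range_succ _ (k + 1)]
    exact le_self_add.trans le_self_add
  calc holderNorm L k α u ≤ holderNorm L (k + 1) α u + (d * d + 1) * holderNorm L (k + 1) α u :=
        add_le_add h1 (((le_add_self).trans le_self_add).trans h)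
    _ = _ := by ring

lemma supNorm_le_holderNorm (k : ℕ) (u : Space d → F) : supNorm L u ≤ holderNorm L k α u := by
  rw [holderNorm, cNorm, Finset.sum_range_succ' _ k, multiIndices_zero, Finset.sum_singleton,
    multiDeriv_zero, pow_zero, ENNReal.ofReal_one, one_mul]
  exact le_add_self.trans le_self_add

end NormLemmas

/-! ### A Poincaré inequality for derivatives of periodic functions -/

section Poincare

variable {d : ℕ} {F : Type*} [NormedAddCommGroup F] [NormedSpace ℝ F] {L : ℝ}

/-- The symmetric Taylor remainder `g(s+r) - g(s-r) - 2r g'(s)` is at most `B r²`. At `r = L/2`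
periodicity cancels the two values of `g`, leaving `L ‖g'(s)‖ ≤ B L²/4`. A factor below `L/2`
matters: its square root of nothing is lost later, since `2 · 1/4 < 1` is what makes the Leibniz
count summable. -/
lemma norm_deriv_le_of_periodic {g u u' : ℝ → F} {B : ℝ} (hL : 0 < L)
    (hg : Function.Periodic g L) (h₁ : ∀ s, HasDerivAt g (u s) s)
    (h₂ : ∀ s, HasDerivAt u (u' s) s) (hB : ∀ s, ‖u' s‖ ≤ B) (s : ℝ) :
    ‖u s‖ ≤ L / 4 * B := by
  have hlip : ∀ a b, ‖u a - u b‖ ≤ B * |a - b| := fun a b => by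
    have := convex_univ.norm_image_sub_le_of_norm_hasDerivWithin_le (f := u) (f' := u') (C := B)
      (fun x _ => (h₂ x).hasDerivWithinAt) (fun x _ => hB x) (Set.mem_univ b) (Set.mem_univ a)
    simpa using this
  set G : ℝ → F := fun r => g (s + r) - g (s - r) - (2 * r) • u s with hG
  have hGd : ∀ r, HasDerivAt G (u (s + r) + u (s - r) - (2 : ℝ) • u s) r := by
    intro r
    have e1 : HasDerivAt (fun r => g (s + r)) (u (s + r)) r := (h₁ (s + r)).comp_const_add s r
    have e2 : HasDerivAt (fun r => g (s - r)) (-u (s - r)) r := (h₁ (s - r)).comp_const_sub s r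
    have e3 : HasDerivAt (fun r : ℝ => (2 * r) • u s) ((2 : ℝ) • u s) r := by
      simpa using ((hasDerivAt_id r).const_mul 2).smul_const (u s)
    refine ((e1.sub e2).sub e3).congr_deriv ?_
    simp
  have key : ∀ ⦃r⦄, r ∈ Set.Icc 0 (L / 2) → ‖G r‖ ≤ B * r ^ 2 := by
    refine image_norm_le_of_norm_deriv_right_le_deriv_boundary
      (fun r _ => (hGd r).continuousAt.continuousWithinAt)
      (fun r _ => (hGd r).hasDerivWithinAt) (B := fun r => B * r ^ 2)
      (B' := fun r => B * (2 * r)) ?_ ?_ ?_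
    · simp [hG]
    · intro r
      have := ((hasDerivAt_id r).pow 2).const_mul B
      simpa using this
    · intro r hr
      have e : u (s + r) + u (s - r) - (2 : ℝ) • u s =
          (u (s + r) - u s) + (u (s - r) - u s) := by
        rw [two_smul]; abel
      rw [e]
      refine (norm_add_le _ _).trans ((add_le_add (hlip _ _) (hlip _ _)).trans_eq ?_)
      simp [abs_of_nonneg hr.1]; ring
  have h := key (Set.right_mem_Icc.2 (by positivity))
  have hper : g (s + L / 2) = g (s - L / 2) := by
    rw [← hg (s - L / 2)]; congr 1; ring
  simp only [hG, hper, sub_self, zero_sub, norm_neg, norm_smul] at h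
  rw [Real.norm_of_nonneg (by linarith)] at h
  have h3 : L * ‖u s‖ ≤ L * (L / 4 * B) := by nlinarith
  exact le_of_mul_le_mul_left h3 hL

lemma hasDerivAt_line {u : Space d → F} (hu : Differentiable ℝ u) (x : Space d) (i : Fin d)
    (s : ℝ) : HasDerivAt (fun s => u (x + EuclideanSpace.single i s))
      (partialDeriv i u (x + EuclideanSpace.single i s)) s := by
  have h1 : HasDerivAt (fun s : ℝ => x + EuclideanSpace.single i s)
      (EuclideanSpace.single i (1 : ℝ)) s := by
    have : (fun s : ℝ => x + EuclideanSpace.single i s) =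
        fun s : ℝ => x + s • EuclideanSpace.single i (1 : ℝ) := by
      funext s; congr 1; ext j; by_cases h : j = i <;> simp [h]
    rw [this]
    simpa using ((hasDerivAt_id s).smul_const (EuclideanSpace.single i (1 : ℝ))).const_add x
  exact (hu _).hasFDerivAt.comp_hasDerivAt s h1

lemma IsPeriodic.line {F : Type*} {u : Space d → F} (hu : IsPeriodic L u) (x : Space d)
    (i : Fin d) : Function.Periodic (fun s => u (x + EuclideanSpace.single i s)) L := by
  intro s
  simp only [single_add, ← add_assoc]
  exact hu _ i

lemma single_zero (i : Fin d) : (EuclideanSpace.single i (0 : ℝ) : Space d) = 0 := by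
  ext j; by_cases h : j = i <;> simp [h]

lemma supNorm_partialDeriv_le (hL : 0 < L) {u : Space d → F} (hu : ContDiff ℝ 2 u)
    (hper : IsPeriodic L u) (i : Fin d) :
    supNorm L (partialDeriv i u) ≤
      4⁻¹ * (ENNReal.ofReal L * supNorm L (partialDeriv i (partialDeriv i u))) := by
  have hu1 : ContDiff ℝ (1 : ℕ) (partialDeriv i u) := contDiff_partialDeriv (n := 1) hu i
  have hu2 : Continuous (partialDeriv i (partialDeriv i u)) :=
    (contDiff_partialDeriv (n := 0) hu1 i).continuous
  have hfin := supNorm_ne_top (L := L) hu2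
  refine supNorm_le fun x hx => ?_
  have h := norm_deriv_le_of_periodic hL (hper.line x i)
    (hasDerivAt_line (hu.differentiable (by norm_num)) x i)
    (hasDerivAt_line (hu1.differentiable (by norm_num)) x i)
    (fun s => ((hper.partialDeriv i).partialDeriv i).norm_le_supNorm hL hfin _) 0
  rw [single_zero, add_zero] at h
  rw [← ofReal_norm]
  refine (ENNReal.ofReal_le_ofReal h).trans_eq ?_
  rw [ENNReal.ofReal_mul (by positivity), ENNReal.ofReal_toReal hfin, div_eq_inv_mul,
    ENNReal.ofReal_mul (by positivity), mul_assoc]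
  congr 1
  rw [ENNReal.ofReal_inv_of_pos (by norm_num)]
  norm_num

/-- Repeat the first letter until the word has length `k`; each repetition gains `1/4` by the
preceding inequality and absorbs one `L`. The word must be nonempty: a periodic function itself is
not controlled by its derivatives. -/
lemma supNorm_wordDeriv_le (hL : 0 < L) {α : ℝ} {k : ℕ} {u : Space d → F} (hu : ContDiff ℝ k u)
    (hper : IsPeriodic L u) (n : ℕ) (p : List (Fin d)) (hp : p ≠ []) (hn : p.length + n = k) :
    ENNReal.ofReal (L ^ p.length) * supNorm L (wordDeriv p u) ≤
      4⁻¹ ^ n * holderNorm L k α u := by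
  induction n generalizing p with
  | zero =>
    have hk : p.length = k := hn
    rw [wordDeriv_eq_multiDeriv p (hu.of_le (by exact_mod_cast hk.le)), pow_zero, one_mul]
    have hm : wordIndex p ∈ multiIndices d k := hk ▸ wordIndex_mem p
    rw [holderNorm, cNorm, Finset.sum_range_succ]
    refine le_trans ?_ le_self_add
    refine le_trans ?_ le_add_self
    rw [hk]
    exact Finset.single_le_sum (f := fun m => ENNReal.ofReal (L ^ k) *
      supNorm L (multiDeriv m u)) (fun _ _ => bot_le) hm
  | succ n ih =>
    obtain ⟨i, q, rfl⟩ := List.exists_cons_of_ne_nil hp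
    have h1 := ih (i :: i :: q) (by simp) (by simp at hn ⊢; omega)
    have h2 := supNorm_partialDeriv_le hL (contDiff_wordDeriv' (n := 2) q hu
      (by simp at hn; omega)) (hper.wordDeriv q) i
    calc ENNReal.ofReal (L ^ (i :: q).length) * supNorm L (wordDeriv (i :: q) u)
        ≤ ENNReal.ofReal (L ^ (i :: q).length) * (4⁻¹ * (ENNReal.ofReal L *
          supNorm L (wordDeriv (i :: i :: q) u))) := mul_le_mul_right h2 _
      _ = 4⁻¹ * (ENNReal.ofReal (L ^ (i :: i :: q).length) *
          supNorm L (wordDeriv (i :: i :: q) u)) := by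
        rw [List.length_cons (a := i) (as := i :: q), ofReal_pow_succ hL]; ring
      _ ≤ 4⁻¹ * (4⁻¹ ^ n * holderNorm L k α u) := mul_le_mul_right h1 _
      _ = _ := by rw [pow_succ]; ring

end Poincare

/-! ### The Leibniz formula with the extreme terms split off -/

section Leibniz

variable {d : ℕ}

/-- The pairs of nonempty complementary subwords of a word, with multiplicity. -/
def properSplits {ι : Type*} : List ι → List (List ι × List ι)
  | [] => []
  | [_] => []
  | i :: j :: w => (j :: w, [i]) :: ([i], j :: w) ::
      ((properSplits (j :: w)).flatMap fun r => [(i :: r.1, r.2), (r.1, i :: r.2)])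

lemma properSplits_spec {ι : Type*} (w : List ι) : ∀ r ∈ properSplits w,
    r.1 ≠ [] ∧ r.2 ≠ [] ∧ r.1.length + r.2.length = w.length := by
  induction w with
  | nil => simp [properSplits]
  | cons i w ih =>
    cases w with
    | nil => simp [properSplits]
    | cons j w =>
      intro r hr
      simp only [properSplits, List.mem_cons, List.mem_flatMap, List.not_mem_nil, or_false] at hr
      rcases hr with rfl | rfl | ⟨s, hs, rfl | rfl⟩
      · simp
      · simp; omega
      · obtain ⟨h1, h2, h3⟩ := ih s hs
        refine ⟨by simp, h2, ?_⟩
        simp at h3 ⊢; omega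
      · obtain ⟨h1, h2, h3⟩ := ih s hs
        refine ⟨h1, by simp, ?_⟩
        simp at h3 ⊢; omega

lemma length_properSplits_le {ι : Type*} (w : List ι) :
    (properSplits w).length ≤ 2 ^ w.length := by
  -- Of the `2ⁿ` splittings the two trivial ones are missing; keeping the `+ 2` makes the induction
  -- close.
  have key : w ≠ [] → (properSplits w).length + 2 ≤ 2 ^ w.length := by
    induction w with
    | nil => simp
    | cons i w ih =>
      intro _
      cases w with
      | nil => simp [properSplits]
      | cons j w =>
        have := ih (by simp)
        simp only [properSplits, List.length_cons, List.length_flatMap, List.length_nil,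
          List.map_const', List.sum_replicate, smul_eq_mul] at this ⊢
        rw [pow_succ]
        omega
  cases w with
  | nil => simp [properSplits]
  | cons i w => have := key (by simp); omega

/-- The terms of the Leibniz formula in which both factors are differentiated. -/
def leibnizRest (w : List (Fin d)) (u v : Space d → ℝ) : Space d → ℝ :=
  fun x => ((properSplits w).map fun r => wordDeriv r.1 u x * wordDeriv r.2 v x).sum

lemma differentiable_list_sum {ι : Type*} {l : List ι} {f : ι → Space d → ℝ}
    (h : ∀ a ∈ l, Differentiable ℝ (f a)) : Differentiable ℝ fun x => (l.map fun a => f a x).sum := by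
  induction l with
  | nil => simp
  | cons a l ih =>
    simp only [List.map_cons, List.sum_cons]
    exact (h a (by simp)).add (ih fun b hb => h b (by simp [hb]))

lemma partialDeriv_list_sum {ι : Type*} {l : List ι} {f : ι → Space d → ℝ}
    (h : ∀ a ∈ l, Differentiable ℝ (f a)) (i : Fin d) :
    partialDeriv i (fun x => (l.map fun a => f a x).sum) =
      fun x => (l.map fun a => partialDeriv i (f a) x).sum := by
  induction l with
  | nil => funext x; simp [partialDeriv]
  | cons a l ih =>
    simp only [List.map_cons, List.sum_cons]
    have hl : ∀ b ∈ l, Differentiable ℝ (f b) := fun b hb => h b (by simp [hb])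
    rw [partialDeriv_add (h a (by simp)) (differentiable_list_sum hl), ih hl]

lemma differentiable_split {w : List (Fin d)} {n : ℕ} {u v : Space d → ℝ}
    (hu : ContDiff ℝ n u) (hv : ContDiff ℝ n v) (hw : w.length ≤ n) {r} (hr : r ∈ properSplits w) :
    Differentiable ℝ (wordDeriv r.1 u) ∧ Differentiable ℝ (wordDeriv r.2 v) := by
  obtain ⟨h1, h2, h3⟩ := properSplits_spec w r hr
  rw [← List.length_pos_iff] at h1 h2
  exact ⟨differentiable_wordDeriv _ hu (by omega), differentiable_wordDeriv _ hv (by omega)⟩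

lemma partialDeriv_leibnizRest {w : List (Fin d)} {n : ℕ} {u v : Space d → ℝ}
    (hu : ContDiff ℝ n u) (hv : ContDiff ℝ n v) (hw : w.length ≤ n) (i : Fin d) :
    partialDeriv i (leibnizRest w u v) = fun x => ((properSplits w).map fun r =>
      wordDeriv (i :: r.1) u x * wordDeriv r.2 v x +
        wordDeriv r.1 u x * wordDeriv (i :: r.2) v x).sum := by
  unfold leibnizRest
  rw [partialDeriv_list_sum (f := fun (r : List (Fin d) × List (Fin d)) x => wordDeriv r.1 u x * wordDeriv r.2 v x)]
  · funext x
    congr 1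
    refine List.map_congr_left fun r hr => ?_
    have h := differentiable_split hu hv hw hr
    rw [partialDeriv_mul h.1 h.2]
    rfl
  · intro r hr
    have h := differentiable_split hu hv hw hr
    exact h.1.mul h.2

lemma differentiable_leibnizRest {w : List (Fin d)} {n : ℕ} {u v : Space d → ℝ}
    (hu : ContDiff ℝ n u) (hv : ContDiff ℝ n v) (hw : w.length ≤ n) :
    Differentiable ℝ (leibnizRest w u v) :=
  differentiable_list_sum (f := fun (r : List (Fin d) × List (Fin d)) x => wordDeriv r.1 u x * wordDeriv r.2 v x)
    fun _ hr =>
    (differentiable_split hu hv hw hr).1.mul (differentiable_split hu hv hw hr).2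

/-- The two terms with an undifferentiated factor are kept apart because the Poincaré gain is not
available for that factor. There are only two of them per word, so they need no gain. -/
lemma wordDeriv_mul {w : List (Fin d)} (hw : w ≠ []) {u v : Space d → ℝ}
    (hu : ContDiff ℝ w.length u) (hv : ContDiff ℝ w.length v) :
    wordDeriv w (fun x => u x * v x) = fun x =>
      wordDeriv w u x * v x + u x * wordDeriv w v x + leibnizRest w u v x := by
  induction w with
  | nil => exact absurd rfl hw
  | cons i w ih =>
    have du : Differentiable ℝ u := hu.differentiable (by simp)
    have dv : Differentiable ℝ v := hv.differentiable (by simp)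
    cases w with
    | nil =>
      rw [wordDeriv_cons, wordDeriv_nil, partialDeriv_mul du dv]
      funext x
      simp [leibnizRest, properSplits]
    | cons j w =>
      have hu' : ContDiff ℝ (j :: w).length u := hu.of_le (by simp)
      have hv' : ContDiff ℝ (j :: w).length v := hv.of_le (by simp)
      have du' : Differentiable ℝ (wordDeriv (j :: w) u) :=
        differentiable_wordDeriv _ hu (by simp)
      have dv' : Differentiable ℝ (wordDeriv (j :: w) v) :=
        differentiable_wordDeriv _ hv (by simp)
      have dr := differentiable_leibnizRest hu' hv' le_rfl
      rw [wordDeriv_cons, ih (by simp) hu' hv',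
        partialDeriv_add ((du'.fun_mul dv).fun_add (du.fun_mul dv')) dr,
        partialDeriv_add (du'.fun_mul dv) (du.fun_mul dv'), partialDeriv_mul du' dv,
        partialDeriv_mul du dv', partialDeriv_leibnizRest hu' hv' le_rfl]
      funext x
      have e2 : ∀ l : List (List (Fin d) × List (Fin d)),
          ((l.flatMap fun r => [(i :: r.1, r.2), (r.1, i :: r.2)]).map
            fun r => wordDeriv r.1 u x * wordDeriv r.2 v x).sum =
          (l.map fun r => wordDeriv (i :: r.1) u x * wordDeriv r.2 v x +
            wordDeriv r.1 u x * wordDeriv (i :: r.2) v x).sum := by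
        intro l
        induction l with
        | nil => rfl
        | cons r l ih => simp [ih]; ring
      simp only [leibnizRest, properSplits, List.map_cons, List.sum_cons, e2,
        wordDeriv_cons, wordDeriv_nil]
      ring

end Leibniz

/-! ### The algebra property with a constant independent of the order -/

section Product

variable {d : ℕ} {L α : ℝ}

lemma enorm_list_sum_le {ι : Type*} (l : List ι) (f : ι → ℝ) {C : ℝ≥0∞}
    (h : ∀ a ∈ l, ‖f a‖ₑ ≤ C) : ‖(l.map f).sum‖ₑ ≤ l.length * C := by
  induction l with
  | nil => simp
  | cons a l ih =>
    rw [List.map_cons, List.sum_cons, List.length_cons]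
    refine (enorm_add_le _ _).trans ?_
    push_cast
    rw [add_mul, one_mul, add_comm]
    exact add_le_add (ih fun b hb => h b (by simp [hb])) (h a (by simp))

lemma supNorm_mul_le (f g : Space d → ℝ) :
    supNorm L (fun x => f x * g x) ≤ supNorm L f * supNorm L g := by
  refine supNorm_le fun x hx => ?_
  rw [enorm_mul]
  exact mul_le_mul' (enorm_le_supNorm hx) (enorm_le_supNorm hx)

lemma supNorm_add_le (f g : Space d → ℝ) :
    supNorm L (fun x => f x + g x) ≤ supNorm L f + supNorm L g := by
  refine supNorm_le fun x hx => (enorm_add_le _ _).trans ?_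
  exact add_le_add (enorm_le_supNorm hx) (enorm_le_supNorm hx)

lemma holderSeminorm_add_le (hL : 0 < L) (f g : Space d → ℝ) :
    holderSeminorm L α (fun x => f x + g x) ≤ holderSeminorm L α f + holderSeminorm L α g := by
  have := holderSeminorm_le_of_norm_le_sum (α := α) (Finset.univ : Finset (Fin 2))
    (w := fun x => f x + g x) (u := ![f, g]) hL (fun x y => by
      simp only [Fin.sum_univ_two, Matrix.cons_val_zero, Matrix.cons_val_one]
      rw [add_sub_add_comm]
      exact norm_add_le _ _)
  simpa [Fin.sum_univ_two] using this

lemma holderSeminorm_mul_le (hL : 0 < L) (f g : Space d → ℝ) :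
    holderSeminorm L α (fun x => f x * g x) ≤
      supNorm L f * holderSeminorm L α g + holderSeminorm L α f * supNorm L g := by
  refine iSup₂_le fun x hx => iSup₂_le fun y hy => ?_
  have hLα : 0 < L ^ α := Real.rpow_pos_of_pos hL _
  have hle : ∀ h : Space d → ℝ, ENNReal.ofReal (L ^ α * (‖h x - h y‖ / ‖x - y‖ ^ α)) ≤
      holderSeminorm L α h := fun h =>
    (le_iSup₂ (f := fun y (_ : y ∈ cell d L) =>
      ENNReal.ofReal (L ^ α * (‖h x - h y‖ / ‖x - y‖ ^ α))) y hy).trans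
    (le_iSup₂ (f := fun x (_ : x ∈ cell d L) => ⨆ y ∈ cell d L,
      ENNReal.ofReal (L ^ α * (‖h x - h y‖ / ‖x - y‖ ^ α))) x hx)
  have e1 : ‖f x * g x - f y * g y‖ ≤ ‖f x‖ * ‖g x - g y‖ + ‖f x - f y‖ * ‖g y‖ := by
    rw [← norm_mul, ← norm_mul]
    refine (norm_add_le _ _).trans' (le_of_eq ?_)
    congr 1; ring
  calc ENNReal.ofReal (L ^ α * (‖f x * g x - f y * g y‖ / ‖x - y‖ ^ α))
      ≤ ENNReal.ofReal (‖f x‖ * (L ^ α * (‖g x - g y‖ / ‖x - y‖ ^ α)) +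
          (L ^ α * (‖f x - f y‖ / ‖x - y‖ ^ α)) * ‖g y‖) := by
        apply ENNReal.ofReal_le_ofReal
        have := mul_le_mul_of_nonneg_left (div_le_div_of_nonneg_right e1
          (Real.rpow_nonneg (norm_nonneg (x - y)) α)) hLα.le
        refine this.trans_eq ?_
        ring
    _ = ‖f x‖ₑ * ENNReal.ofReal (L ^ α * (‖g x - g y‖ / ‖x - y‖ ^ α)) +
          ENNReal.ofReal (L ^ α * (‖f x - f y‖ / ‖x - y‖ ^ α)) * ‖g y‖ₑ := by
        rw [ENNReal.ofReal_add (by positivity) (by positivity), ENNReal.ofReal_mul (norm_nonneg _),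
          ENNReal.ofReal_mul (by positivity : 0 ≤ L ^ α * (‖f x - f y‖ / ‖x - y‖ ^ α)),
          ofReal_norm, ofReal_norm]
    _ ≤ _ := add_le_add (mul_le_mul' (enorm_le_supNorm hx) (hle g))
        (mul_le_mul' (hle f) (enorm_le_supNorm hy))

lemma card_multiIndices_le (d j : ℕ) : (multiIndices d j).card ≤ (j + 1) ^ d := by
  have hsub : multiIndices d j ⊆ Fintype.piFinset fun _ : Fin d => Finset.range (j + 1) := by
    intro m hm
    rw [mem_multiIndices] at hm
    rw [Fintype.mem_piFinset]
    intro i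
    rw [Finset.mem_range, Nat.lt_succ_iff, ← hm]
    exact Finset.single_le_sum (f := m) (fun _ _ => Nat.zero_le _) (Finset.mem_univ i)
  simpa using Finset.card_le_card hsub

/-- The constant `∑ⱼ (j + 1)ᵈ 2⁻ʲ`. -/
def countConst (d : ℕ) : ℝ≥0∞ := ∑' j : ℕ, ((j : ℝ≥0∞) + 1) ^ d * 2⁻¹ ^ j

lemma countConst_ne_top (d : ℕ) : countConst d ≠ ⊤ := by
  have hs : Summable fun j : ℕ => ((j : ℝ) + 1) ^ d * (1 / 2) ^ j := by
    have h := summable_pow_mul_geometric_of_norm_lt_one (R := ℝ) d (r := 1 / 2) (by norm_num)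
    have h2 := ((summable_nat_add_iff 1).2 h).mul_left 2
    refine h2.congr fun j => ?_
    push_cast
    rw [pow_succ]; ring
  have e : countConst d = ∑' j : ℕ, ENNReal.ofReal (((j : ℝ) + 1) ^ d * (1 / 2) ^ j) := by
    refine tsum_congr fun j => ?_
    rw [ENNReal.ofReal_mul (by positivity), ENNReal.ofReal_pow (by positivity),
      ENNReal.ofReal_pow (by positivity), ENNReal.ofReal_add (by positivity) (by positivity),
      one_div, ENNReal.ofReal_inv_of_pos (by norm_num)]
    simp
  rw [e, ← ENNReal.ofReal_tsum_of_nonneg (fun j => by positivity) hs]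
  exact ENNReal.ofReal_ne_top

lemma two_mul_quarter : (2 : ℝ≥0∞) * 4⁻¹ = 2⁻¹ := by
  have h : (4 : ℝ≥0∞) = 2 * 2 := by norm_num
  rw [h, ENNReal.mul_inv (by simp) (by simp), ← mul_assoc,
    ENNReal.mul_inv_cancel (by simp) (by simp), one_mul]

lemma card_mul_pow_le {j : ℕ} :
    ((multiIndices d j).card : ℝ≥0∞) * (2 ^ j * 4⁻¹ ^ j) ≤ ((j : ℝ≥0∞) + 1) ^ d * 2⁻¹ ^ j := by
  rw [← mul_pow, two_mul_quarter]
  gcongr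
  exact_mod_cast card_multiIndices_le d j

variable {k : ℕ} {u v : Space d → ℝ}

/-- Both factors are genuinely differentiated, so each gains `1/4` for every derivative it is short
of `k`; `n` is the total shortfall. -/
lemma enorm_wordDeriv_mul_le (hL : 0 < L) (hu : ContDiff ℝ k u) (hv : ContDiff ℝ k v)
    (pu : IsPeriodic L u) (pv : IsPeriodic L v) {p q : List (Fin d)} (hp : p ≠ []) (hq : q ≠ [])
    (hpk : p.length ≤ k) (hqk : q.length ≤ k) {n : ℕ} (hn : n + (p.length + q.length) = 2 * k)
    {x : Space d} (hx : x ∈ cell d L) :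
    ENNReal.ofReal (L ^ (p.length + q.length)) * ‖wordDeriv p u x * wordDeriv q v x‖ₑ ≤
      4⁻¹ ^ n * (holderNorm L k α u * holderNorm L k α v) := by
  have h1 := supNorm_wordDeriv_le (α := α) hL hu pu (k - p.length) p hp (by omega)
  have h2 := supNorm_wordDeriv_le (α := α) hL hv pv (k - q.length) q hq (by omega)
  rw [pow_add, ENNReal.ofReal_mul (by positivity), enorm_mul]
  calc _ = (ENNReal.ofReal (L ^ p.length) * ‖wordDeriv p u x‖ₑ) *
        (ENNReal.ofReal (L ^ q.length) * ‖wordDeriv q v x‖ₑ) := by ring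
    _ ≤ (4⁻¹ ^ (k - p.length) * holderNorm L k α u) *
        (4⁻¹ ^ (k - q.length) * holderNorm L k α v) :=
      mul_le_mul' ((mul_le_mul_right (enorm_le_supNorm hx) _).trans h1)
        ((mul_le_mul_right (enorm_le_supNorm hx) _).trans h2)
    _ = _ := by
      rw [show n = (k - p.length) + (k - q.length) by omega, pow_add]; ring

/-- There are at most `2^|w|` terms, each gaining `4^-(2k-|w|)`, which is at most `4^-|w|` because
`|w| ≤ k`. -/
lemma supNorm_leibnizRest_le (hL : 0 < L) (hu : ContDiff ℝ k u) (hv : ContDiff ℝ k v)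
    (pu : IsPeriodic L u) (pv : IsPeriodic L v) {w : List (Fin d)} (hw : w.length ≤ k) :
    ENNReal.ofReal (L ^ w.length) * supNorm L (leibnizRest w u v) ≤
      2 ^ w.length * 4⁻¹ ^ w.length * (holderNorm L k α u * holderNorm L k α v) := by
  rw [supNorm, ENNReal.mul_iSup]
  refine iSup_le fun x => ?_
  rw [ENNReal.mul_iSup]
  refine iSup_le fun hx => ?_
  have hLw : ENNReal.ofReal (L ^ w.length) = ‖L ^ w.length‖ₑ := by
    rw [← ofReal_norm, Real.norm_of_nonneg (by positivity)]
  rw [hLw, ← enorm_mul, leibnizRest, ← List.sum_map_mul_left]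
  refine (enorm_list_sum_le _ _ (C := 4⁻¹ ^ w.length *
    (holderNorm L k α u * holderNorm L k α v)) fun r hr => ?_).trans ?_
  · obtain ⟨h1, h2, h3⟩ := properSplits_spec w r hr
    rw [enorm_mul, ← hLw, ← h3]
    refine (enorm_wordDeriv_mul_le (α := α) hL hu hv pu pv h1 h2 (by omega) (by omega)
      (n := 2 * k - w.length) (by omega) hx).trans ?_
    refine mul_le_mul_left ?_ _
    exact pow_le_pow_right_of_le_one' (by simp) (by omega)
  · rw [mul_assoc]
    refine mul_le_mul_left ?_ _
    exact_mod_cast length_properSplits_le w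

/-- In every remaining term each factor carries fewer than `k` derivatives, so the term can be
differentiated once more and its seminorm bounded by a first derivative. The shortfall is then `k -
1`, and `2 · 4^-(k-1) = 8 · 4^-k` explains the constant. -/
lemma holderSeminorm_leibnizRest_le (hL : 0 < L) (hα₀ : 0 < α) (hα₁ : α < 1)
    (hu : ContDiff ℝ k u) (hv : ContDiff ℝ k v)
    (pu : IsPeriodic L u) (pv : IsPeriodic L v) {w : List (Fin d)} (hw : w.length = k)
    (hk : 1 ≤ k) :
    ENNReal.ofReal (L ^ k) * holderSeminorm L α (leibnizRest w u v) ≤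
      8 * d * d * (2 ^ k * 4⁻¹ ^ k) * (holderNorm L k α u * holderNorm L k α v) := by
  have key : ∀ i, ENNReal.ofReal (L ^ (k + 1)) *
      supNorm L (partialDeriv i (leibnizRest w u v)) ≤
      2 ^ k * (2 * 4⁻¹ ^ (k - 1) * (holderNorm L k α u * holderNorm L k α v)) := by
    intro i
    rw [supNorm, ENNReal.mul_iSup]
    refine iSup_le fun x => ?_
    rw [ENNReal.mul_iSup]
    refine iSup_le fun hx => ?_
    have hLw : ENNReal.ofReal (L ^ (k + 1)) = ‖L ^ (k + 1)‖ₑ := by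
      rw [← ofReal_norm, Real.norm_of_nonneg (by positivity)]
    rw [partialDeriv_leibnizRest hu hv hw.le, hLw, ← enorm_mul, ← List.sum_map_mul_left]
    refine (enorm_list_sum_le _ _ (C := 2 * 4⁻¹ ^ (k - 1) *
      (holderNorm L k α u * holderNorm L k α v)) fun r hr => ?_).trans ?_
    · obtain ⟨h1, h2, h3⟩ := properSplits_spec w r hr
      have h1' := List.length_pos_iff.2 h1
      have h2' := List.length_pos_iff.2 h2
      rw [mul_add]
      refine (enorm_add_le _ _).trans ?_
      rw [mul_assoc 2, two_mul, enorm_mul, enorm_mul (L ^ (k + 1)), ← hLw]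
      refine add_le_add ?_ ?_
      · have := enorm_wordDeriv_mul_le (α := α) hL hu hv pu pv (p := i :: r.1) (q := r.2) (by simp)
          h2 (by simp; omega) (by omega) (n := k - 1) (by simp; omega) hx
        rwa [show (i :: r.1).length + r.2.length = k + 1 by simp; omega] at this
      · have := enorm_wordDeriv_mul_le (α := α) hL hu hv pu pv (p := r.1) (q := i :: r.2) h1
          (by simp) (by omega) (by simp; omega) (n := k - 1) (by simp; omega) hx
        rwa [show r.1.length + (i :: r.2).length = k + 1 by simp; omega] at this
    · refine mul_le_mul_left ?_ _
      rw [← hw]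
      exact_mod_cast length_properSplits_le w
  refine (mul_le_mul_right (holderSeminorm_le_partialDeriv hL hα₀ hα₁
    (differentiable_leibnizRest hu hv hw.le)) _).trans ?_
  rw [mul_left_comm, Finset.mul_sum]
  have hsum : ∑ i, ENNReal.ofReal (L ^ k) * (ENNReal.ofReal L *
      supNorm L (partialDeriv i (leibnizRest w u v))) ≤
      d * (2 ^ k * (2 * 4⁻¹ ^ (k - 1) * (holderNorm L k α u * holderNorm L k α v))) := by
    refine (Finset.sum_le_sum (g := fun _ =>
      2 ^ k * (2 * 4⁻¹ ^ (k - 1) * (holderNorm L k α u * holderNorm L k α v)))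
      fun i _ => ?_).trans_eq ?_
    · rw [← mul_assoc, mul_comm (ENNReal.ofReal (L ^ k)), ← ofReal_pow_succ hL]
      exact key i
    · simp
  refine (mul_le_mul_right hsum _).trans_eq ?_
  obtain ⟨n, rfl⟩ : ∃ n, k = n + 1 := ⟨k - 1, by omega⟩
  have h4 : (4 : ℝ≥0∞) * 4⁻¹ = 1 := ENNReal.mul_inv_cancel (by norm_num) (by norm_num)
  rw [Nat.add_sub_cancel, pow_succ (4⁻¹ : ℝ≥0∞) n]
  calc _ = (d : ℝ≥0∞) * (d * (2 ^ (n + 1) * (2 * (4⁻¹ ^ n * 1) *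
        (holderNorm L (n + 1) α u * holderNorm L (n + 1) α v)))) := by rw [mul_one]
    _ = _ := by rw [← h4]; ring

lemma supNorm_multiDeriv_mul_le (hL : 0 < L) (hu : ContDiff ℝ k u) (hv : ContDiff ℝ k v)
    (pu : IsPeriodic L u) (pv : IsPeriodic L v) {j : ℕ} (hj : j ≤ k) {m : Fin d → ℕ}
    (hm : m ∈ multiIndices d j) :
    ENNReal.ofReal (L ^ j) * supNorm L (multiDeriv m fun x => u x * v x) ≤
      ENNReal.ofReal (L ^ j) * supNorm L (multiDeriv m u) * supNorm L v +
      supNorm L u * (ENNReal.ofReal (L ^ j) * supNorm L (multiDeriv m v)) +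
      2 ^ j * 4⁻¹ ^ j * (holderNorm L k α u * holderNorm L k α v) := by
  have hlen := length_indexWord_of_mem hm
  simp only [multiDeriv_eq_wordDeriv]
  by_cases hw : indexWord m = []
  · rw [hw]
    refine le_add_right (le_add_right ?_)
    simp only [wordDeriv_nil]
    rw [mul_assoc]
    exact mul_le_mul_right (supNorm_mul_le _ _) _
  · rw [wordDeriv_mul hw (hu.of_le (by exact_mod_cast hlen.trans_le hj))
      (hv.of_le (by exact_mod_cast hlen.trans_le hj))]
    have h := supNorm_leibnizRest_le (α := α) hL hu hv pu pv (hlen.trans_le hj)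
    rw [hlen] at h
    calc _ ≤ ENNReal.ofReal (L ^ j) * (supNorm L (wordDeriv (indexWord m) u) * supNorm L v +
          supNorm L u * supNorm L (wordDeriv (indexWord m) v) +
          supNorm L (leibnizRest (indexWord m) u v)) := by
          refine mul_le_mul_right ?_ _
          refine (supNorm_add_le _ _).trans (add_le_add ?_ le_rfl)
          exact (supNorm_add_le _ _).trans (add_le_add (supNorm_mul_le _ _) (supNorm_mul_le _ _))
      _ = ENNReal.ofReal (L ^ j) * supNorm L (wordDeriv (indexWord m) u) * supNorm L v +
          supNorm L u * (ENNReal.ofReal (L ^ j) * supNorm L (wordDeriv (indexWord m) v)) +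
          ENNReal.ofReal (L ^ j) * supNorm L (leibnizRest (indexWord m) u v) := by ring
      _ ≤ _ := add_le_add le_rfl h

/-- Summed over all orders, the extreme terms give `cNorm u · sup v` and `sup u · cNorm v`;
everything else is bounded by the convergent series `countConst`. -/
lemma cNorm_mul_le (hL : 0 < L) (hu : ContDiff ℝ k u) (hv : ContDiff ℝ k v)
    (pu : IsPeriodic L u) (pv : IsPeriodic L v) :
    cNorm L k (fun x => u x * v x) ≤
      (2 + countConst d) * (holderNorm L k α u * holderNorm L k α v) := by
  have h1 : cNorm L k (fun x => u x * v x) ≤ cNorm L k u * supNorm L v +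
      supNorm L u * cNorm L k v +
      (∑ j ∈ Finset.range (k + 1), ((multiIndices d j).card : ℝ≥0∞) * (2 ^ j * 4⁻¹ ^ j)) *
        (holderNorm L k α u * holderNorm L k α v) := by
    simp only [cNorm, Finset.sum_mul, Finset.mul_sum]
    rw [← Finset.sum_add_distrib, ← Finset.sum_add_distrib]
    refine Finset.sum_le_sum fun j hj => ?_
    have hj' : j ≤ k := by simpa [Nat.lt_succ_iff] using hj
    rw [← Finset.sum_add_distrib]
    refine (Finset.sum_le_sum fun m hm =>
      supNorm_multiDeriv_mul_le (α := α) hL hu hv pu pv hj' hm).trans_eq ?_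
    rw [Finset.sum_add_distrib, Finset.sum_const, nsmul_eq_mul]
    ring
  have h2 : ∑ j ∈ Finset.range (k + 1), ((multiIndices d j).card : ℝ≥0∞) * (2 ^ j * 4⁻¹ ^ j) ≤
      countConst d :=
    (Finset.sum_le_sum fun j _ => card_mul_pow_le).trans (ENNReal.sum_le_tsum _)
  refine h1.trans ?_
  rw [add_mul, two_mul]
  refine add_le_add (add_le_add ?_ ?_) (mul_le_mul_left h2 _)
  · exact mul_le_mul' le_self_add (supNorm_le_holderNorm k v)
  · exact mul_le_mul' (supNorm_le_holderNorm k u) le_self_add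

lemma holderSeminorm_le_holderNorm (hL : 0 < L) (hα₀ : 0 < α) (hα₁ : α < 1)
    (hu : ContDiff ℝ k u) : holderSeminorm L α u ≤ (d * d + 1) * holderNorm L k α u := by
  refine le_trans ?_ (sum_holderSeminorm_le hL hα₀ hα₁ hu)
  rw [Finset.sum_range_succ', multiIndices_zero, Finset.sum_singleton, multiDeriv_zero, pow_zero,
    ENNReal.ofReal_one, one_mul]
  exact le_add_self

/-- The constant in the product estimate. -/
def productConst (d : ℕ) : ℝ≥0∞ :=
  2 + countConst d + (2 + 2 * (d * d + 1) + 8 * d * d * countConst d)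

lemma productConst_ne_top (d : ℕ) : productConst d ≠ ⊤ := by
  have h := countConst_ne_top d
  simp only [productConst, ne_eq, ENNReal.add_eq_top, ENNReal.mul_eq_top, h]
  simp

lemma holderSeminorm_multiDeriv_mul_le (hL : 0 < L) (hα₀ : 0 < α) (hα₁ : α < 1) (hk : 1 ≤ k)
    (hu : ContDiff ℝ k u) (hv : ContDiff ℝ k v)
    (pu : IsPeriodic L u) (pv : IsPeriodic L v) {m : Fin d → ℕ} (hm : m ∈ multiIndices d k) :
    ENNReal.ofReal (L ^ k) * holderSeminorm L α (multiDeriv m fun x => u x * v x) ≤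
      (ENNReal.ofReal (L ^ k) * supNorm L (multiDeriv m u) * holderSeminorm L α v +
        ENNReal.ofReal (L ^ k) * holderSeminorm L α (multiDeriv m u) * supNorm L v +
        (supNorm L u * (ENNReal.ofReal (L ^ k) * holderSeminorm L α (multiDeriv m v)) +
        holderSeminorm L α u * (ENNReal.ofReal (L ^ k) * supNorm L (multiDeriv m v)))) +
      8 * d * d * (2 ^ k * 4⁻¹ ^ k) * (holderNorm L k α u * holderNorm L k α v) := by
  have hlen := length_indexWord_of_mem hm
  simp only [multiDeriv_eq_wordDeriv]
  -- This is where `k ≥ 1` is used: the split Leibniz formula needs a nonempty word.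
  have hw : indexWord m ≠ [] := by
    rw [← List.length_pos_iff, hlen]; omega
  rw [wordDeriv_mul hw (hu.of_le (by exact_mod_cast hlen.le))
    (hv.of_le (by exact_mod_cast hlen.le))]
  have h := holderSeminorm_leibnizRest_le hL hα₀ hα₁ hu hv pu pv hlen hk
  set w := indexWord m
  calc _ ≤ ENNReal.ofReal (L ^ k) * ((supNorm L (wordDeriv w u) * holderSeminorm L α v +
          holderSeminorm L α (wordDeriv w u) * supNorm L v) +
        (supNorm L u * holderSeminorm L α (wordDeriv w v) +
          holderSeminorm L α u * supNorm L (wordDeriv w v)) +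
        holderSeminorm L α (leibnizRest w u v)) := by
        refine mul_le_mul_right ?_ _
        refine (holderSeminorm_add_le hL _ _).trans (add_le_add ?_ le_rfl)
        exact (holderSeminorm_add_le hL _ _).trans
          (add_le_add (holderSeminorm_mul_le hL _ _) (holderSeminorm_mul_le hL _ _))
    _ = (ENNReal.ofReal (L ^ k) * supNorm L (wordDeriv w u) * holderSeminorm L α v +
        ENNReal.ofReal (L ^ k) * holderSeminorm L α (wordDeriv w u) * supNorm L v +
        (supNorm L u * (ENNReal.ofReal (L ^ k) * holderSeminorm L α (wordDeriv w v)) +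
        holderSeminorm L α u * (ENNReal.ofReal (L ^ k) * supNorm L (wordDeriv w v)))) +
        ENNReal.ofReal (L ^ k) * holderSeminorm L α (leibnizRest w u v) := by ring
    _ ≤ _ := add_le_add le_rfl h

/-- The spaces of periodic `C^{k,α}` functions are algebras, with a constant independent of `k`. -/
theorem holderNorm_mul_le (hL : 0 < L) (hα₀ : 0 < α) (hα₁ : α < 1) (hk : 1 ≤ k)
    (hu : ContDiff ℝ k u) (hv : ContDiff ℝ k v) (pu : IsPeriodic L u) (pv : IsPeriodic L v) :
    holderNorm L k α (fun x => u x * v x) ≤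
      productConst d * (holderNorm L k α u * holderNorm L k α v) := by
  set U := holderNorm L k α u with hU
  set V := holderNorm L k α v with hV
  set Su := ∑ m ∈ multiIndices d k, ENNReal.ofReal (L ^ k) * supNorm L (multiDeriv m u) with hSu
  set Sv := ∑ m ∈ multiIndices d k, ENNReal.ofReal (L ^ k) * supNorm L (multiDeriv m v) with hSv
  set Hu := ∑ m ∈ multiIndices d k, ENNReal.ofReal (L ^ k) * holderSeminorm L α (multiDeriv m u)
    with hHu
  set Hv := ∑ m ∈ multiIndices d k, ENNReal.ofReal (L ^ k) * holderSeminorm L α (multiDeriv m v)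
    with hHv
  have bSu : Su ≤ U := by
    rw [hU, holderNorm, cNorm, Finset.sum_range_succ]
    exact (le_add_self).trans le_self_add
  have bSv : Sv ≤ V := by
    rw [hV, holderNorm, cNorm, Finset.sum_range_succ]
    exact (le_add_self).trans le_self_add
  have bHu : Hu ≤ U := le_add_self
  have bHv : Hv ≤ V := le_add_self
  have h1 : ∑ m ∈ multiIndices d k,
      ENNReal.ofReal (L ^ k) * holderSeminorm L α (multiDeriv m fun x => u x * v x) ≤
      (Su * holderSeminorm L α v + Hu * supNorm L v + (supNorm L u * Hv +
        holderSeminorm L α u * Sv)) +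
      8 * d * d * (((multiIndices d k).card : ℝ≥0∞) * (2 ^ k * 4⁻¹ ^ k)) * (U * V) := by
    refine (Finset.sum_le_sum fun m hm =>
      holderSeminorm_multiDeriv_mul_le hL hα₀ hα₁ hk hu hv pu pv hm).trans_eq ?_
    rw [Finset.sum_add_distrib, Finset.sum_const, nsmul_eq_mul]
    simp only [Finset.sum_add_distrib, hSu, hSv, hHu, hHv, Finset.sum_mul, Finset.mul_sum]
    congr 1
    ring
  have h2 : ((multiIndices d k).card : ℝ≥0∞) * (2 ^ k * 4⁻¹ ^ k) ≤ countConst d :=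
    card_mul_pow_le.trans (ENNReal.le_tsum k)
  rw [holderNorm, productConst, add_mul]
  refine add_le_add (cNorm_mul_le hL hu hv pu pv) (h1.trans ?_)
  rw [add_mul (2 + 2 * ((d : ℝ≥0∞) * d + 1))]
  refine add_le_add ?_ ?_
  · calc _ ≤ U * ((d * d + 1) * V) + U * V + (U * V + ((d * d + 1) * U) * V) :=
          add_le_add (add_le_add
            (mul_le_mul' bSu (holderSeminorm_le_holderNorm hL hα₀ hα₁ hv))
            (mul_le_mul' bHu (supNorm_le_holderNorm k v)))
            (add_le_add (mul_le_mul' (supNorm_le_holderNorm k u) bHv)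
            (mul_le_mul' (holderSeminorm_le_holderNorm hL hα₀ hα₁ hu) bSv))
      _ = _ := by ring
  · exact mul_le_mul_left (mul_le_mul_right h2 _) _

end Product

/-! ### Linear functionals in coordinates -/

section Coordinates

variable {d : ℕ}

/-- The linear functional with the given coordinates. -/
def coordCLM (a : Fin d → ℝ) : Space d →L[ℝ] ℝ := ∑ l, a l • EuclideanSpace.proj l

lemma coordCLM_apply (a : Fin d → ℝ) (x : Space d) : coordCLM a x = ∑ l, a l * x l := by
  simp [coordCLM]

@[simp] lemma coordCLM_single (a : Fin d → ℝ) (l : Fin d) :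
    coordCLM a (EuclideanSpace.single l 1) = a l := by
  simp [coordCLM_apply]

lemma clm_eq_coordCLM (T : Space d →L[ℝ] ℝ) :
    T = coordCLM fun l => T (EuclideanSpace.single l 1) := by
  ext x
  rw [clm_apply_eq_sum T x, coordCLM_apply]
  simp [mul_comm]

lemma norm_coordCLM_le (a : Fin d → ℝ) : ‖coordCLM a‖ ≤ ∑ l, |a l| := by
  simpa using opNorm_le_sum (coordCLM a)

lemma fderiv_eq_coordCLM (u : Space d → ℝ) (x : Space d) :
    fderiv ℝ u x = coordCLM fun l => partialDeriv l u x := clm_eq_coordCLM _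

end Coordinates

/-! ### Averages against a test kernel at scale `t` -/

section Averages

variable {d : ℕ}

/-- Smooth compactly supported kernels. -/
structure IsTest (ψ : Space d → ℝ) : Prop where
  smooth : ContDiff ℝ (⊤ : ℕ∞) ψ
  compact : HasCompactSupport ψ

namespace IsTest

variable {ψ χ : Space d → ℝ}

lemma continuous (h : IsTest ψ) : Continuous ψ := h.smooth.continuous

lemma differentiable (h : IsTest ψ) : Differentiable ℝ ψ := h.smooth.differentiable (by simp)

lemma partialDeriv (h : IsTest ψ) (i : Fin d) : IsTest (partialDeriv i ψ) := by
  refine ⟨?_, h.compact.fderiv_apply ℝ (EuclideanSpace.single i 1)⟩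
  have h1 : ContDiff ℝ (⊤ : ℕ∞) (fderiv ℝ ψ) := h.smooth.fderiv_right (by simp)
  exact h1.clm_apply contDiff_const

lemma mul_coord (h : IsTest ψ) (l : Fin d) : IsTest fun z => z l * ψ z := by
  refine ⟨ContDiff.mul ?_ h.smooth, h.compact.mul_left⟩
  exact (EuclideanSpace.proj l : Space d →L[ℝ] ℝ).contDiff

lemma integrable_mul (h : IsTest ψ) {g : Space d → ℝ} (hg : Continuous g) :
    Integrable fun z => ψ z * g z :=
  (h.continuous.mul hg).integrable_of_hasCompactSupport h.compact.mul_right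

lemma integrable (h : IsTest ψ) : Integrable ψ :=
  h.continuous.integrable_of_hasCompactSupport h.compact

lemma integral_partialDeriv (h : IsTest ψ) (i : Fin d) :
    ∫ z, PeriodicHolder.partialDeriv i ψ z = 0 := by
  have := integral_mul_fderiv_eq_neg_fderiv_mul_of_integrable (μ := (volume : Measure (Space d)))
    (f := fun _ => (1 : ℝ)) (g := ψ) (v := EuclideanSpace.single i 1) (by simp)
    (by simpa using! (h.partialDeriv i).integrable) (by simpa using h.integrable)
    (fun x _ => differentiableAt_const _) (fun x _ => h.differentiable x)
  simpa using! this

end IsTest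

/-- The average of `f` around `x` at scale `t`, with weight `ψ`. -/
def avg (ψ f : Space d → ℝ) (t : ℝ) (x : Space d) : ℝ := ∫ z, ψ z * f (x + t • z)

variable {ψ χ f : Space d → ℝ} {M H α L : ℝ}

lemma continuous_comp_add_smul (hf : Continuous f) (x : Space d) (t : ℝ) :
    Continuous fun z => f (x + t • z) := hf.comp (by fun_prop)

lemma continuous_avg (hψ : IsTest ψ) (hf : Continuous f) (hM : ∀ x, |f x| ≤ M) :
    Continuous fun q : ℝ × Space d => avg ψ f q.1 q.2 := by
  unfold avg
  refine continuous_of_dominated (μ := (volume : Measure (Space d)))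
    (F := fun (q : ℝ × Space d) z => ψ z * f (q.2 + q.1 • z)) (bound := fun z => |ψ z| * M) (fun q => ?_) (fun q => ?_) ?_ ?_
  · exact (hψ.continuous.mul (continuous_comp_add_smul hf q.2 q.1)).aestronglyMeasurable
  · refine Filter.Eventually.of_forall fun z => ?_
    rw [norm_mul]
    exact mul_le_mul_of_nonneg_left (hM _) (abs_nonneg _)
  · exact hψ.integrable.abs.mul_const M
  · refine Filter.Eventually.of_forall fun z => ?_
    exact continuous_const.mul (hf.comp (by fun_prop : Continuous fun q : ℝ × Space d =>
      q.2 + q.1 • z))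

lemma abs_avg_le (hψ : IsTest ψ) (hM : ∀ x, |f x| ≤ M) (t : ℝ) (x : Space d) :
    |avg ψ f t x| ≤ (∫ z, |ψ z|) * M := by
  rw [← integral_mul_const, ← Real.norm_eq_abs, avg]
  refine norm_integral_le_of_norm_le (hψ.integrable.abs.mul_const M)
    (Filter.Eventually.of_forall fun z => ?_)
  rw [norm_mul]
  exact mul_le_mul_of_nonneg_left (hM _) (abs_nonneg _)

/-- The `α`-th absolute moment of a kernel. -/
def moment (α : ℝ) (ψ : Space d → ℝ) : ℝ := ∫ z, |ψ z| * ‖z‖ ^ α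

lemma moment_nonneg (α : ℝ) (ψ : Space d → ℝ) : 0 ≤ moment α ψ :=
  integral_nonneg fun z => by positivity

lemma integral_abs_nonneg (ψ : Space d → ℝ) : 0 ≤ ∫ z, |ψ z| :=
  integral_nonneg fun _ => abs_nonneg _

/-- Since the kernel has mean zero, the constant `f x` can be subtracted under the integral, and
Hölder continuity gives `|t z|^α`. This is the decay at small scales. -/
lemma abs_avg_le_moment (hψ : IsTest ψ) (h0 : ∫ z, ψ z = 0) (hα : 0 < α) (hf : Continuous f)
    (hH : ∀ x y, |f x - f y| ≤ H * ‖x - y‖ ^ α) {t : ℝ} (ht : 0 ≤ t) (x : Space d) :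
    |avg ψ f t x| ≤ moment α ψ * H * t ^ α := by
  have e : avg ψ f t x = ∫ z, ψ z * (f (x + t • z) - f x) := by
    simp only [mul_sub]
    rw [integral_sub (hψ.integrable_mul (continuous_comp_add_smul hf x t)) (hψ.integrable.mul_const _),
      integral_mul_const, h0, zero_mul, sub_zero]
    rfl
  have hint : Integrable fun z => |ψ z| * ‖z‖ ^ α := by
    refine Continuous.integrable_of_hasCompactSupport ?_ ?_
    · exact hψ.continuous.abs.mul (continuous_norm.rpow_const fun _ => Or.inr hα.le)
    · exact hψ.compact.norm.mul_right
  rw [e, moment, mul_assoc, ← integral_mul_const]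
  rw [← Real.norm_eq_abs]
  refine norm_integral_le_of_norm_le (hint.mul_const _) (Filter.Eventually.of_forall fun z => ?_)
  rw [norm_mul, mul_assoc]
  refine mul_le_mul_of_nonneg_left ((hH _ _).trans_eq ?_) (abs_nonneg _)
  rw [add_sub_cancel_left, norm_smul, Real.norm_of_nonneg ht,
    Real.mul_rpow ht (norm_nonneg _)]
  ring

lemma avg_periodic (hf : IsPeriodic L f) (t : ℝ) : IsPeriodic L (avg ψ f t) := by
  intro x i
  simp only [avg]
  congr 1
  funext z
  rw [add_right_comm, hf]

/-- Substituting `y = -t z` writes the average as a convolution of `f` with a smooth compactly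
supported kernel, so the derivative falls on the kernel and `f` need only be continuous. -/
lemma hasFDerivAt_avg (hψ : IsTest ψ) (hf : Continuous f) {t : ℝ} (ht : t ≠ 0) (x : Space d) :
    HasFDerivAt (avg ψ f t) (coordCLM fun l => -t⁻¹ * avg (partialDeriv l ψ) f t x) x := by
  set c : ℝ := |((-t) ^ Module.finrank ℝ (Space d))⁻¹| with hc
  have hscale : ∀ (φ : Space d → ℝ) (x : Space d),
      avg φ f t x = c * ∫ y, φ (-t⁻¹ • y) * f (x - y) := by
    intro φ x
    have := Measure.integral_comp_smul (volume : Measure (Space d))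
      (fun y => φ (-t⁻¹ • y) * f (x - y)) (-t)
    rw [smul_eq_mul] at this
    rw [← this, avg]
    congr 1
    funext z
    rw [smul_smul, neg_mul_neg, inv_mul_cancel₀ ht, one_smul, neg_smul, sub_neg_eq_add]
  set κ : Space d → ℝ := fun y => ψ (-t⁻¹ • y) with hκ
  have hκs : ContDiff ℝ 1 κ :=
    (hψ.smooth.of_le (by simp)).comp (contDiff_const_smul (-t⁻¹))
  have hκc : HasCompactSupport κ :=
    hψ.compact.comp_homeomorph (Homeomorph.smulOfNeZero (-t⁻¹) (by simpa using ht))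
  have hκd : ∀ y l, fderiv ℝ κ y (EuclideanSpace.single l 1) =
      -t⁻¹ * partialDeriv l ψ (-t⁻¹ • y) := by
    intro y l
    have h2 : HasFDerivAt (fun y : Space d => -t⁻¹ • y)
        (-t⁻¹ • ContinuousLinearMap.id ℝ (Space d)) y :=
      (hasFDerivAt_id y).const_smul (-t⁻¹)
    have h1 := ((hψ.differentiable (-t⁻¹ • y)).hasFDerivAt.comp y h2).fderiv
    rw [show κ = ψ ∘ fun y => -t⁻¹ • y from rfl, h1]
    simp [partialDeriv]
  have hconv := hκc.hasFDerivAt_convolution_left (ContinuousLinearMap.mul ℝ ℝ) hκs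
    (hf.locallyIntegrable (μ := (volume : Measure (Space d)))) x
  have h := hconv.const_mul c
  have hfun : (fun x => c * (convolution κ f (ContinuousLinearMap.mul ℝ ℝ) volume) x) =
      avg ψ f t := by
    funext x
    rw [hscale]; rfl
  rw [hfun] at h
  refine h.congr_fderiv ?_
  rw [clm_eq_coordCLM (c • _)]
  congr 1
  funext l
  have hint := (hκc.fderiv ℝ).convolutionExists_left
    ((ContinuousLinearMap.mul ℝ ℝ).precompL (Space d)) (hκs.continuous_fderiv (by simp))
    (hf.locallyIntegrable (μ := (volume : Measure (Space d)))) x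
  rw [hscale, _root_.smul_apply, convolution, ContinuousLinearMap.integral_apply hint,
    smul_eq_mul, mul_left_comm, ← integral_const_mul (-t⁻¹)]
  congr 2
  funext y
  simp [ContinuousLinearMap.precompL_apply, hκd, mul_assoc]

lemma partialDeriv_avg (hψ : IsTest ψ) (hf : Continuous f) {t : ℝ} (ht : t ≠ 0) (i : Fin d) :
    partialDeriv i (avg ψ f t) = fun x => -t⁻¹ * avg (partialDeriv i ψ) f t x := by
  funext x
  rw [partialDeriv, (hasFDerivAt_avg hψ hf ht x).fderiv, coordCLM_single]

lemma differentiable_avg (hψ : IsTest ψ) (hf : Continuous f) {t : ℝ} (ht : t ≠ 0) :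
    Differentiable ℝ (avg ψ f t) := fun x => (hasFDerivAt_avg hψ hf ht x).differentiableAt

lemma avg_partialDeriv (hψ : IsTest ψ) (hf : ContDiff ℝ 1 f) {t : ℝ} (ht : t ≠ 0) (i : Fin d)
    (x : Space d) : avg ψ (partialDeriv i f) t x = -t⁻¹ * avg (partialDeriv i ψ) f t x := by
  have hd : ∀ z, HasFDerivAt (fun z => f (x + t • z))
      ((fderiv ℝ f (x + t • z)).comp (t • ContinuousLinearMap.id ℝ (Space d))) z := by
    intro z
    have h2 : HasFDerivAt (fun z : Space d => x + t • z)
        (t • ContinuousLinearMap.id ℝ (Space d)) z :=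
      ((hasFDerivAt_id z).const_smul t).const_add x
    exact (hf.differentiable (by simp) _).hasFDerivAt.comp z h2
  have hd' : ∀ z, fderiv ℝ (fun z => f (x + t • z)) z (EuclideanSpace.single i 1) =
      t * partialDeriv i f (x + t • z) := by
    intro z
    rw [(hd z).fderiv]; simp [partialDeriv]
  have hcp : Continuous (partialDeriv i f) :=
    (contDiff_partialDeriv (n := 0) (by simpa using hf) i).continuous
  have h := integral_mul_fderiv_eq_neg_fderiv_mul_of_integrable
    (μ := (volume : Measure (Space d)))
    (f := ψ) (g := fun z => f (x + t • z)) (v := EuclideanSpace.single i 1)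
    ((hψ.partialDeriv i).integrable_mul (hf.continuous.comp (by fun_prop)))
    (by
      simp only [hd']
      exact hψ.integrable_mul (continuous_const.mul (hcp.comp (by fun_prop))))
    (hψ.integrable_mul (hf.continuous.comp (by fun_prop)))
    (fun z _ => hψ.differentiable z) (fun z _ => (hd z).differentiableAt)
  simp only [hd'] at h
  have e : ∫ z, ψ z * (t * partialDeriv i f (x + t • z)) = t * avg ψ (partialDeriv i f) t x := by
    rw [avg, ← integral_const_mul]
    congr 1; funext z; ring
  rw [e] at h
  rw [eq_comm, neg_mul, neg_eq_iff_eq_neg, inv_mul_eq_iff_eq_mul₀ ht]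
  rw [show avg (partialDeriv i ψ) f t x = ∫ z, fderiv ℝ ψ z (EuclideanSpace.single i 1) *
    f (x + t • z) from rfl]
  linarith

/-- Integrating by parts, both sides become the average of `f` against the mixed second derivative
of `χ`. This exchange of indices is behind `hodge_gradient` and `div_hodge`. -/
lemma avg_partialDeriv_comm (hχ : IsTest χ) (hf : ContDiff ℝ 1 f) {t : ℝ} (ht : t ≠ 0)
    (i j : Fin d) (x : Space d) :
    avg (partialDeriv i χ) (partialDeriv j f) t x =
      avg (partialDeriv j χ) (partialDeriv i f) t x := by
  rw [avg_partialDeriv (hχ.partialDeriv i) hf ht, avg_partialDeriv (hχ.partialDeriv j) hf ht,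
    partialDeriv_comm (contDiff_infty.1 hχ.smooth 2)]

/-- As a function of `x` the average against `χ` is periodic, and its first two derivatives in
direction `i` are `-t⁻¹` and `t⁻²` times the averages against `∂ᵢχ` and `∂ᵢ∂ᵢχ`. The one-dimensional
Poincaré inequality compares them; the `1/4` is dropped. This is the decay at large scales. -/
lemma abs_avg_partialDeriv_le (hL : 0 < L) (hχ : IsTest χ) (hf : Continuous f)
    (hper : IsPeriodic L f) (i : Fin d) {t B : ℝ} (ht : 0 < t)
    (hB : ∀ y, |avg (partialDeriv i (partialDeriv i χ)) f t y| ≤ B) (x : Space d) :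
    |avg (partialDeriv i χ) f t x| ≤ L / t * B := by
  have e1 := partialDeriv_avg hχ hf ht.ne' i
  have e2 := partialDeriv_avg (hχ.partialDeriv i) hf ht.ne' i
  have hd2 := hasDerivAt_line (differentiable_avg (hχ.partialDeriv i) hf ht.ne') x i
  rw [e2] at hd2
  have hd1 := hasDerivAt_line (differentiable_avg hχ hf ht.ne') x i
  rw [e1] at hd1
  have h := norm_deriv_le_of_periodic (B := t⁻¹ * (t⁻¹ * B)) hL
    ((avg_periodic (ψ := χ) hper t).line x i) hd1
    (fun s => (hd2 s).const_mul (-t⁻¹)) (fun s => ?_) 0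
  · rw [single_zero, add_zero, norm_mul, norm_neg, Real.norm_of_nonneg (inv_pos.2 ht).le,
      mul_left_comm] at h
    have h2 := le_of_mul_le_mul_left h (inv_pos.2 ht)
    have hB0 : 0 ≤ B := (abs_nonneg _).trans (hB x)
    refine h2.trans ?_
    rw [div_eq_mul_inv L t, mul_assoc]
    refine mul_le_mul_of_nonneg_right (by linarith) (by positivity)
  · rw [norm_mul, norm_mul, norm_neg, Real.norm_of_nonneg (inv_pos.2 ht).le]
    gcongr
    exact hB _

/-- Differentiation under the integral produces `z · ∇f`; integration by parts moves the gradient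
onto `z χ(z)`. -/
lemma hasDerivAt_avg (hχ : IsTest χ) (hf : ContDiff ℝ 1 f) {M' : ℝ}
    (hM' : ∀ x, ‖fderiv ℝ f x‖ ≤ M') (x : Space d) {t : ℝ} (ht : t ≠ 0) :
    HasDerivAt (fun t => avg χ f t x)
      (-t⁻¹ * ∑ l, avg (partialDeriv l fun z => z l * χ z) f t x) t := by
  have hcf : Continuous (fderiv ℝ f) := hf.continuous_fderiv (by simp)
  have hcp : ∀ l, Continuous (partialDeriv l f) := fun l =>
    hcf.clm_apply continuous_const
  have h := (hasDerivAt_integral_of_dominated_loc_of_deriv_le (μ := (volume : Measure (Space d)))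
    (F := fun t z => χ z * f (x + t • z))
    (F' := fun t z => χ z * fderiv ℝ f (x + t • z) z) (x₀ := t) (s := Set.univ)
    (bound := fun z => |χ z| * (M' * ‖z‖)) Filter.univ_mem
    (Filter.Eventually.of_forall fun t =>
      (hχ.integrable_mul (hf.continuous.comp (by fun_prop))).aestronglyMeasurable)
    (hχ.integrable_mul (hf.continuous.comp (by fun_prop)))
    ?_ ?_ ?_ ?_).2
  · refine h.congr_deriv ?_
    have e : ∀ z, χ z * fderiv ℝ f (x + t • z) z =
        ∑ l, (z l * χ z) * partialDeriv l f (x + t • z) := by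
      intro z
      rw [fderiv_eq_coordCLM, coordCLM_apply, Finset.mul_sum]
      refine Finset.sum_congr rfl fun l _ => ?_
      ring
    simp only [e]
    rw [integral_finsetSum _ fun l _ =>
      (hχ.mul_coord l).integrable_mul (continuous_comp_add_smul (hcp l) x t), Finset.mul_sum]
    refine Finset.sum_congr rfl fun l _ => ?_
    exact avg_partialDeriv (hχ.mul_coord l) hf ht l x
  · exact (hχ.continuous.mul ((hcf.comp (by fun_prop)).clm_apply
      continuous_id)).aestronglyMeasurable
  · refine Filter.Eventually.of_forall fun z t _ => ?_
    rw [norm_mul]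
    refine mul_le_mul_of_nonneg_left ?_ (abs_nonneg _)
    exact (ContinuousLinearMap.le_opNorm _ _).trans
      (mul_le_mul_of_nonneg_right (hM' _) (norm_nonneg _))
  · refine Continuous.integrable_of_hasCompactSupport ?_ hχ.compact.norm.mul_right
    exact hχ.continuous.abs.mul (by fun_prop)
  · refine Filter.Eventually.of_forall fun z t _ => ?_
    have h2 : HasDerivAt (fun t : ℝ => x + t • z) z t := by
      simpa using ((hasDerivAt_id t).smul_const z).const_add x
    exact ((hf.differentiable (by simp) _).hasFDerivAt.comp_hasDerivAt t h2).const_mul (χ z)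

end Averages

/-! ### Integrals over all scales -/

section ScaleBound

/-- A bound behaving like `t ^ p` for small and like `t ^ q` for large `t`. -/
def scaleBound (r p q a b t : ℝ) : ℝ := if t ≤ r then a * t ^ p else b * t ^ q

variable {r p q a b : ℝ}

lemma scaleBound_integral (hr : 0 < r) (hp : -1 < p) (hq : q < -1) :
    IntegrableOn (scaleBound r p q a b) (Set.Ioi 0) ∧
    ∫ t in Set.Ioi 0, scaleBound r p q a b t =
      a * (r ^ (p + 1) / (p + 1)) + b * (-r ^ (q + 1) / (q + 1)) := by
  have hdisj : Disjoint (Set.Ioc 0 r) (Set.Ioi r) := by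
    rw [Set.disjoint_left]; intro t h1 h2; exact absurd h1.2 (not_le.2 h2)
  have hunion : Set.Ioc 0 r ∪ Set.Ioi r = Set.Ioi 0 := Set.Ioc_union_Ioi_eq_Ioi hr.le
  have e1 : Set.EqOn (fun t : ℝ => a * t ^ p) (scaleBound r p q a b) (Set.Ioc 0 r) := by
    intro t ht; simp [scaleBound, ht.2]
  have e2 : Set.EqOn (fun t : ℝ => b * t ^ q) (scaleBound r p q a b) (Set.Ioi r) := by
    intro t ht; simp [scaleBound, not_le.2 (Set.mem_Ioi.1 ht)]
  have i1 : IntegrableOn (fun t : ℝ => a * t ^ p) (Set.Ioc 0 r) := by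
    have := (intervalIntegral.intervalIntegrable_rpow' (a := 0) (b := r) hp).const_mul a
    rwa [intervalIntegrable_iff_integrableOn_Ioc_of_le hr.le] at this
  have i2 : IntegrableOn (fun t : ℝ => b * t ^ q) (Set.Ioi r) :=
    (integrableOn_Ioi_rpow_of_lt hq hr).const_mul b
  have i1' := i1.congr_fun e1 measurableSet_Ioc
  have i2' := i2.congr_fun e2 measurableSet_Ioi
  refine ⟨hunion ▸ i1'.union i2', ?_⟩
  rw [← hunion, setIntegral_union hdisj measurableSet_Ioi i1' i2',
    ← setIntegral_congr_fun measurableSet_Ioc e1, ← setIntegral_congr_fun measurableSet_Ioi e2,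
    integral_const_mul, integral_const_mul, integral_Ioi_rpow_of_lt hq hr,
    ← intervalIntegral.integral_of_le hr.le, integral_rpow (Or.inl hp),
    Real.zero_rpow (by linarith), sub_zero]

lemma integrableOn_of_scaleBound (hr : 0 < r) (hp : -1 < p) (hq : q < -1) {g : ℝ → ℝ}
    (hg : ContinuousOn g (Set.Ioi 0)) (h : ∀ t, 0 < t → |g t| ≤ scaleBound r p q a b t) :
    IntegrableOn g (Set.Ioi 0) :=
  (scaleBound_integral hr hp hq).1.mono' (hg.aestronglyMeasurable measurableSet_Ioi)
    ((ae_restrict_iff' measurableSet_Ioi).2 (Filter.Eventually.of_forall fun t ht => h t ht))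

lemma abs_integral_le_of_scaleBound (hr : 0 < r) (hp : -1 < p) (hq : q < -1) {g : ℝ → ℝ}
    (h : ∀ t, 0 < t → |g t| ≤ scaleBound r p q a b t) :
    |∫ t in Set.Ioi 0, g t| ≤ a * (r ^ (p + 1) / (p + 1)) + b * (-r ^ (q + 1) / (q + 1)) := by
  rw [← (scaleBound_integral hr hp hq).2, ← Real.norm_eq_abs]
  exact norm_integral_le_of_norm_le (scaleBound_integral hr hp hq).1
    ((ae_restrict_iff' measurableSet_Ioi).2 (Filter.Eventually.of_forall fun t ht => h t ht))

end ScaleBound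

section ScaleIntegral

variable {d : ℕ}

/-- Periodic continuous functions with a bound and a Hölder bound. -/
structure HolderBound (L α M H : ℝ) (f : Space d → ℝ) : Prop where
  periodic : IsPeriodic L f
  continuous : Continuous f
  bound : ∀ x, |f x| ≤ M
  holder : ∀ x y, |f x - f y| ≤ H * ‖x - y‖ ^ α

/-- The Calderón–Zygmund operator `f ↦ ∫₀^∞ (∫ ψ(z) f(x + t z) dz) dt / t`. -/
def scaleIntegral (ψ f : Space d → ℝ) (x : Space d) : ℝ :=
  ∫ t in Set.Ioi (0 : ℝ), t⁻¹ * avg ψ f t x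

variable {L α M H : ℝ} {χ f : Space d → ℝ}

lemma continuous_avg_left {ψ : Space d → ℝ} (hψ : IsTest ψ) (hf : Continuous f)
    (hM : ∀ x, |f x| ≤ M) (x : Space d) : Continuous fun t => avg ψ f t x :=
  (continuous_avg hψ hf hM).comp (by fun_prop : Continuous fun t : ℝ => (t, x))

lemma continuousOn_inv_mul_avg {ψ : Space d → ℝ} (hψ : IsTest ψ) (hf : Continuous f)
    (hM : ∀ x, |f x| ≤ M) (x : Space d) :
    ContinuousOn (fun t => t⁻¹ * avg ψ f t x) (Set.Ioi 0) :=
  (continuousOn_inv₀.mono fun _ ht => (ne_of_gt ht : _ ≠ (0 : ℝ))).mul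
    (continuous_avg_left hψ hf hM x).continuousOn

/-- The threshold is the period: below it the cancellation bound gives `t^(α-1)`, above it the
periodicity bound gives `t⁻²`. Both are integrable, and with this threshold the powers of `L`
balance. -/
lemma HolderBound.abs_inv_mul_avg_le (hL : 0 < L) (hα : 0 < α) (hχ : IsTest χ)
    (hf : HolderBound L α M H f) (i : Fin d) (x : Space d) {t : ℝ} (ht : 0 < t) :
    |t⁻¹ * avg (partialDeriv i χ) f t x| ≤ scaleBound L (α - 1) (-2)
      (moment α (partialDeriv i χ) * H)
      (L * ((∫ z, |partialDeriv i (partialDeriv i χ) z|) * M)) t := by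
  rw [abs_mul, abs_of_pos (inv_pos.2 ht), scaleBound]
  split_ifs with h
  · have h1 := abs_avg_le_moment (hχ.partialDeriv i) (hχ.integral_partialDeriv i) hα hf.continuous
      hf.holder ht.le x
    rw [Real.rpow_sub_one ht.ne', mul_div_assoc', div_eq_inv_mul]
    gcongr
  · have h1 := abs_avg_partialDeriv_le hL hχ hf.continuous hf.periodic i ht
      (fun y => abs_avg_le ((hχ.partialDeriv i).partialDeriv i) hf.bound t y) x
    rw [Real.rpow_neg ht.le, Real.rpow_two]
    calc _ ≤ t⁻¹ * (L / t * ((∫ z, |partialDeriv i (partialDeriv i χ) z|) * M)) := by gcongr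
      _ = _ := by field_simp

lemma HolderBound.integrableOn (hL : 0 < L) (hα : 0 < α) (hχ : IsTest χ)
    (hf : HolderBound L α M H f) (i : Fin d) (x : Space d) :
    IntegrableOn (fun t => t⁻¹ * avg (partialDeriv i χ) f t x) (Set.Ioi 0) :=
  integrableOn_of_scaleBound hL (by linarith) (by norm_num)
    (continuousOn_inv_mul_avg (hχ.partialDeriv i) hf.continuous hf.bound x)
    fun _ ht => hf.abs_inv_mul_avg_le hL hα hχ i x ht

lemma HolderBound.abs_scaleIntegral_le (hL : 0 < L) (hα : 0 < α) (hχ : IsTest χ)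
    (hf : HolderBound L α M H f) (i : Fin d) (x : Space d) :
    |scaleIntegral (partialDeriv i χ) f x| ≤
      moment α (partialDeriv i χ) / α * (H * L ^ α) +
        (∫ z, |partialDeriv i (partialDeriv i χ) z|) * M := by
  refine (abs_integral_le_of_scaleBound hL (by linarith) (by norm_num)
    fun _ ht => hf.abs_inv_mul_avg_le hL hα hχ i x ht).trans_eq ?_
  rw [sub_add_cancel, show (-2 : ℝ) + 1 = -1 by norm_num, Real.rpow_neg_one]
  field_simp

/-- The Hölder constant of the operator `scaleIntegral`. -/
def holderConst (α : ℝ) (ψ : Space d → ℝ) : ℝ :=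
  2 * moment α ψ / α + (∑ l, moment α (partialDeriv l ψ)) / (1 - α)

/-- Split the scales at `r = |x - y|`. Below `r`, estimate both averages separately by cancellation;
above `r`, use the mean value inequality, where differentiating the kernel gains `r/t`. Both parts
give `r^α`, the second one because `α < 1`, and only the Hölder constant of `f` enters. -/
lemma HolderBound.abs_scaleIntegral_sub_le (hL : 0 < L) (hα : 0 < α) (hα₁ : α < 1)
    (hχ : IsTest χ) (hf : HolderBound L α M H f) (i : Fin d) (x y : Space d) :
    |scaleIntegral (partialDeriv i χ) f x - scaleIntegral (partialDeriv i χ) f y| ≤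
      holderConst α (partialDeriv i χ) * H * ‖x - y‖ ^ α := by
  by_cases hxy : x = y
  · subst hxy
    simp [Real.zero_rpow hα.ne']
  have hr : 0 < ‖x - y‖ := norm_pos_iff.2 (sub_ne_zero.2 hxy)
  have hψ := hχ.partialDeriv i
  set ψ := partialDeriv i χ with hψdef
  set r := ‖x - y‖
  rw [scaleIntegral, scaleIntegral, ← integral_sub (hf.integrableOn hL hα hχ i x)
    (hf.integrableOn hL hα hχ i y)]
  have hsmall : ∀ t, 0 < t → ∀ x, |avg ψ f t x| ≤ moment α ψ * H * t ^ α := fun t ht x =>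
    abs_avg_le_moment hψ (hχ.integral_partialDeriv i) hα hf.continuous hf.holder ht.le x
  have hlip : ∀ t, 0 < t → |avg ψ f t x - avg ψ f t y| ≤
      (t⁻¹ * ∑ l, moment α (partialDeriv l ψ) * H * t ^ α) * r := by
    intro t ht
    refine convex_univ.norm_image_sub_le_of_norm_hasFDerivWithin_le (𝕜 := ℝ)
      (fun z _ => (hasFDerivAt_avg hψ hf.continuous ht.ne' z).hasFDerivWithinAt)
      (fun z _ => (norm_coordCLM_le _).trans ?_) (Set.mem_univ y) (Set.mem_univ x)
    rw [Finset.mul_sum]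
    refine Finset.sum_le_sum fun l _ => ?_
    rw [abs_mul, abs_neg, abs_of_pos (inv_pos.2 ht)]
    gcongr
    exact abs_avg_le_moment (hψ.partialDeriv l) (hψ.integral_partialDeriv l) hα hf.continuous
      hf.holder ht.le z
  refine (abs_integral_le_of_scaleBound (r := r) (p := α - 1) (q := α - 2)
    (a := 2 * moment α ψ * H) (b := (∑ l, moment α (partialDeriv l ψ)) * H * r) hr (by linarith)
    (by linarith) fun t ht => ?_).trans_eq ?_
  · rw [← mul_sub, abs_mul, abs_of_pos (inv_pos.2 ht), scaleBound]
    split_ifs with h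
    · rw [Real.rpow_sub_one ht.ne']
      calc _ ≤ t⁻¹ * (moment α ψ * H * t ^ α + moment α ψ * H * t ^ α) := by
            gcongr
            exact (abs_sub _ _).trans (add_le_add (hsmall t ht x) (hsmall t ht y))
        _ = _ := by ring
    · rw [Real.rpow_sub ht, Real.rpow_two]
      calc _ ≤ t⁻¹ * ((t⁻¹ * ∑ l, moment α (partialDeriv l ψ) * H * t ^ α) * r) := by
            gcongr
            exact hlip t ht
        _ = _ := by
          rw [← Finset.sum_mul, ← Finset.sum_mul]
          field_simp
  · rw [sub_add_cancel, show α - 2 + 1 = α - 1 by ring, Real.rpow_sub_one hr.ne', holderConst]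
    have h1 : 1 - α ≠ 0 := by linarith
    have h2 : α - 1 ≠ 0 := by linarith
    rw [show α - 1 = -(1 - α) by ring, neg_div_neg_eq]
    field_simp

lemma scaleIntegral_periodic {ψ : Space d → ℝ} (hf : IsPeriodic L f) :
    IsPeriodic L (scaleIntegral ψ f) := by
  intro x i
  simp only [scaleIntegral, avg_periodic hf _ x i]

/-- The operator is translation invariant, so derivatives pass to `f`. The scale bounds for the
functions `∂ₗf` are independent of the point and dominate the derivative of the integrand. -/
lemma HolderBound.hasFDerivAt_scaleIntegral (hL : 0 < L) (hα : 0 < α) (hχ : IsTest χ)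
    (hf : HolderBound L α M H f) (hf₁ : ContDiff ℝ 1 f) {M' H' : ℝ}
    (hf' : ∀ l, HolderBound L α M' H' (partialDeriv l f)) (i : Fin d) (x : Space d) :
    HasFDerivAt (scaleIntegral (partialDeriv i χ) f)
      (coordCLM fun l => scaleIntegral (partialDeriv i χ) (partialDeriv l f) x) x := by
  have hψ := hχ.partialDeriv i
  set F' : Space d → ℝ → Space d →L[ℝ] ℝ := fun y t =>
    coordCLM fun l => t⁻¹ * avg (partialDeriv i χ) (partialDeriv l f) t y with hF'
  set bound : ℝ → ℝ := fun t => ∑ _l : Fin d, scaleBound L (α - 1) (-2)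
      (moment α (partialDeriv i χ) * H')
      (L * ((∫ z, |partialDeriv i (partialDeriv i χ) z|) * M')) t with hbound
  have hb : ∀ t, 0 < t → ∀ y, ‖F' y t‖ ≤ bound t := fun t ht y =>
    (norm_coordCLM_le _).trans (Finset.sum_le_sum fun l _ =>
      (hf' l).abs_inv_mul_avg_le hL hα hχ i y ht)
  have hbi : IntegrableOn bound (Set.Ioi 0) :=
    integrable_finsetSum _ fun l _ => (scaleBound_integral hL (by linarith) (by norm_num)).1
  have hmeas : AEStronglyMeasurable (F' x) (volume.restrict (Set.Ioi 0)) := by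
    refine ContinuousOn.aestronglyMeasurable ?_ measurableSet_Ioi
    simp only [hF', coordCLM]
    exact continuousOn_finsetSum _ fun l _ =>
      (continuousOn_inv_mul_avg hψ (hf' l).continuous (hf' l).bound x).smul continuousOn_const
  have h := hasFDerivAt_integral_of_dominated_of_fderiv_le
    (μ := volume.restrict (Set.Ioi (0 : ℝ))) (𝕜 := ℝ)
    (F := fun y t => t⁻¹ * avg (partialDeriv i χ) f t y) (F' := F') (x₀ := x) (s := Set.univ)
    (bound := bound) Filter.univ_mem
    (Filter.Eventually.of_forall fun y => (hf.integrableOn hL hα hχ i y).aestronglyMeasurable)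
    (hf.integrableOn hL hα hχ i x) hmeas
    ((ae_restrict_iff' measurableSet_Ioi).2 (Filter.Eventually.of_forall fun t ht y _ =>
      hb t ht y)) hbi
    ((ae_restrict_iff' measurableSet_Ioi).2 (Filter.Eventually.of_forall fun t ht y _ => by
      have ht0 : t ≠ 0 := ne_of_gt ht
      refine ((hasFDerivAt_avg hψ hf.continuous ht0 y).const_mul t⁻¹).congr_fderiv ?_
      rw [clm_eq_coordCLM (t⁻¹ • _)]
      congr 1
      funext l
      rw [_root_.smul_apply, coordCLM_single, smul_eq_mul, avg_partialDeriv hψ hf₁ ht0]))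
  refine h.congr_fderiv ?_
  have hint : IntegrableOn (F' x) (Set.Ioi 0) := hbi.mono' hmeas
    ((ae_restrict_iff' measurableSet_Ioi).2 (Filter.Eventually.of_forall fun t ht => hb t ht x))
  rw [clm_eq_coordCLM (∫ t in Set.Ioi 0, F' x t)]
  congr 1
  funext l
  rw [ContinuousLinearMap.integral_apply hint]
  simp only [hF', coordCLM_single, scaleIntegral]

lemma HolderBound.scaleIntegral_sum {ι : Type*} (s : Finset ι) {g : ι → Space d → ℝ}
    {M H : ι → ℝ} (hL : 0 < L) (hα : 0 < α) (hχ : IsTest χ)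
    (hg : ∀ a ∈ s, HolderBound L α (M a) (H a) (g a)) (i : Fin d) (x : Space d) :
    scaleIntegral (partialDeriv i χ) (fun y => ∑ a ∈ s, g a y) x =
      ∑ a ∈ s, scaleIntegral (partialDeriv i χ) (g a) x := by
  simp only [scaleIntegral]
  rw [← integral_finsetSum _ fun a ha => (hg a ha).integrableOn hL hα hχ i x]
  congr 1
  funext t
  rw [← Finset.mul_sum]
  congr 1
  simp only [avg]
  rw [← integral_finsetSum _ fun a ha => (hχ.partialDeriv i).integrable_mul
    (continuous_comp_add_smul (hg a ha).continuous x t)]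
  simp only [Finset.mul_sum]

/-- The potential `∫₀^∞ ∫ ψ(z) f(x + t z) dz dt`. -/
def scalePotential (ψ f : Space d → ℝ) (x : Space d) : ℝ :=
  ∫ t in Set.Ioi (0 : ℝ), avg ψ f t x

lemma scalePotential_periodic {ψ : Space d → ℝ} (hf : IsPeriodic L f) :
    IsPeriodic L (scalePotential ψ f) := by
  intro x i
  simp only [scalePotential, avg_periodic hf _ x i]

/-- Differentiating the average puts the derivative on the kernel and produces the weight `-t⁻¹`
that turns the potential into a singular integral. No derivative of `f` is needed. -/
lemma HolderBound.hasFDerivAt_scalePotential (hL : 0 < L) (hα : 0 < α) (hχ : IsTest χ)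
    (hf : HolderBound L α M H f) (i : Fin d) (x : Space d) :
    HasFDerivAt (scalePotential (partialDeriv i χ) f)
      (coordCLM fun l => - scaleIntegral (partialDeriv l (partialDeriv i χ)) f x) x := by
  have hψ := hχ.partialDeriv i
  set ψ := partialDeriv i χ with hψdef
  have hint0 : ∀ y, IntegrableOn (fun t => avg ψ f t y) (Set.Ioi 0) := by
    intro y
    refine integrableOn_of_scaleBound (r := L) (p := 0) (q := -2) (a := (∫ z, |ψ z|) * M)
      (b := L ^ 2 * ((∫ z, |partialDeriv i (partialDeriv i ψ) z|) * M)) hL (by norm_num)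
      (by norm_num) (continuous_avg_left hψ hf.continuous hf.bound y).continuousOn fun t ht => ?_
    rw [scaleBound]
    split_ifs with h
    · simpa using abs_avg_le hψ hf.bound t y
    -- Without the weight `t⁻¹` one Poincaré step would only give `t⁻¹`; two steps give the
    -- integrable `t⁻²`.
    · have h1 := abs_avg_partialDeriv_le hL hψ hf.continuous hf.periodic i ht
        (fun y => abs_avg_le ((hψ.partialDeriv i).partialDeriv i) hf.bound t y)
      have h2 := abs_avg_partialDeriv_le hL hχ hf.continuous hf.periodic i ht h1 y
      refine h2.trans_eq ?_
      rw [Real.rpow_neg ht.le, Real.rpow_two]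
      field_simp
  set F' : Space d → ℝ → Space d →L[ℝ] ℝ := fun y t =>
    coordCLM fun l => -(t⁻¹ * avg (partialDeriv l ψ) f t y) with hF'
  set bound : ℝ → ℝ := fun t => ∑ l : Fin d, scaleBound L (α - 1) (-2)
      (moment α (partialDeriv l ψ) * H)
      (L * ((∫ z, |partialDeriv l (partialDeriv l ψ) z|) * M)) t with hbound
  have hb : ∀ t, 0 < t → ∀ y, ‖F' y t‖ ≤ bound t := fun t ht y =>
    (norm_coordCLM_le _).trans (Finset.sum_le_sum fun l _ => by
      rw [abs_neg]
      exact hf.abs_inv_mul_avg_le hL hα hψ l y ht)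
  have hbi : IntegrableOn bound (Set.Ioi 0) :=
    integrable_finsetSum _ fun l _ => (scaleBound_integral hL (by linarith) (by norm_num)).1
  have hmeas : AEStronglyMeasurable (F' x) (volume.restrict (Set.Ioi 0)) := by
    refine ContinuousOn.aestronglyMeasurable ?_ measurableSet_Ioi
    simp only [hF', coordCLM]
    exact continuousOn_finsetSum _ fun l _ =>
      (continuousOn_inv_mul_avg (hψ.partialDeriv l) hf.continuous hf.bound x).neg.smul
        continuousOn_const
  have h := hasFDerivAt_integral_of_dominated_of_fderiv_le
    (μ := volume.restrict (Set.Ioi (0 : ℝ))) (𝕜 := ℝ)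
    (F := fun y t => avg ψ f t y) (F' := F') (x₀ := x) (s := Set.univ)
    (bound := bound) Filter.univ_mem
    (Filter.Eventually.of_forall fun y => (hint0 y).aestronglyMeasurable)
    (hint0 x) hmeas
    ((ae_restrict_iff' measurableSet_Ioi).2 (Filter.Eventually.of_forall fun t ht y _ =>
      hb t ht y)) hbi
    ((ae_restrict_iff' measurableSet_Ioi).2 (Filter.Eventually.of_forall fun t ht y _ => by
      have ht0 : t ≠ 0 := ne_of_gt ht
      refine (hasFDerivAt_avg hψ hf.continuous ht0 y).congr_fderiv ?_
      simp only [hF', neg_mul]))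
  refine h.congr_fderiv ?_
  have hint : IntegrableOn (F' x) (Set.Ioi 0) := hbi.mono' hmeas
    ((ae_restrict_iff' measurableSet_Ioi).2 (Filter.Eventually.of_forall fun t ht => hb t ht x))
  rw [clm_eq_coordCLM (∫ t in Set.Ioi 0, F' x t)]
  congr 1
  funext l
  rw [ContinuousLinearMap.integral_apply hint]
  simp only [hF', coordCLM_single, scaleIntegral, integral_neg]

lemma scaleIntegral_partialDeriv_comm (hχ : IsTest χ) (hf : ContDiff ℝ 1 f) (i j : Fin d)
    (x : Space d) : scaleIntegral (partialDeriv i χ) (partialDeriv j f) x =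
      scaleIntegral (partialDeriv j χ) (partialDeriv i f) x := by
  refine setIntegral_congr_fun measurableSet_Ioi fun t ht => ?_
  rw [avg_partialDeriv_comm hχ hf (ne_of_gt ht)]

end ScaleIntegral

/-! ### The radial kernel and the reproducing formula -/

section Kernel

variable {d : ℕ}

lemma partialDeriv_radial {h : ℝ → ℝ} (hh : Differentiable ℝ h) (l : Fin d) :
    partialDeriv l (fun z : Space d => h (‖z‖ ^ 2)) = fun z => 2 * z l * deriv h (‖z‖ ^ 2) := by
  funext z
  have h1 : HasFDerivAt (fun z : Space d => ‖z‖ ^ 2) (2 • innerSL ℝ z) z :=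
    (hasStrictFDerivAt_norm_sq z).hasFDerivAt
  have h2 := ((hh (‖z‖ ^ 2)).hasDerivAt.comp_hasFDerivAt z h1).fderiv
  rw [partialDeriv, show (fun z : Space d => h (‖z‖ ^ 2)) = h ∘ fun z => ‖z‖ ^ 2 from rfl, h2]
  simp [EuclideanSpace.inner_single_right]
  ring

lemma isTest_radial {h : ℝ → ℝ} (hh : ContDiff ℝ (⊤ : ℕ∞) h) (h0 : ∀ s, 2 < s → h s = 0) :
    IsTest fun z : Space d => h (‖z‖ ^ 2) := by
  refine ⟨hh.comp (contDiff_norm_sq ℝ), ?_⟩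
  refine HasCompactSupport.intro (isCompact_closedBall (0 : Space d) 2) fun z hz => h0 _ ?_
  rw [Metric.mem_closedBall, dist_zero_right, not_le] at hz
  nlinarith

/-- A radial kernel `η` of mass one, with a potential `ζ` such that `∇ζ(z) = - z η(z)`. -/
lemma exists_kernel (hd : 0 < d) : ∃ ζ η : Space d → ℝ, IsTest ζ ∧ IsTest η ∧
    (∀ l, partialDeriv l ζ = fun z => -(z l * η z)) ∧ ∫ z, η z = 1 := by
  set h : ℝ → ℝ := fun s => Real.smoothTransition (2 - s) with hh
  have hs : ContDiff ℝ (⊤ : ℕ∞) h :=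
    Real.smoothTransition.contDiff.comp (contDiff_const.sub contDiff_id)
  have hs' : ContDiff ℝ (⊤ : ℕ∞) (deriv h) := by
    have := hs.iterate_deriv 1
    simpa using this
  have hz : ∀ s, 2 < s → h s = 0 := fun s h2 =>
    Real.smoothTransition.zero_of_nonpos (by linarith)
  have hz' : ∀ s, 2 < s → deriv h s = 0 := by
    intro s h2
    have : h =ᶠ[nhds s] fun _ => 0 := by
      filter_upwards [lt_mem_nhds h2] with r hr using hz r hr
    rw [this.deriv_eq]; simp
  have hanti : Antitone h := fun a b hab => Real.smoothTransition.monotone (by linarith)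
  set ζ₀ : Space d → ℝ := fun z => h (‖z‖ ^ 2)
  set η₀ : Space d → ℝ := fun z => -2 * deriv h (‖z‖ ^ 2) with hη₀
  have tζ : IsTest ζ₀ := isTest_radial hs hz
  have tη : IsTest η₀ := isTest_radial (h := fun s => -2 * deriv h s) (contDiff_const.mul hs')
    fun s h2 => by rw [hz' s h2, mul_zero]
  have hpos : 0 < ∫ z, η₀ z := by
    -- `η₀` is nonnegative because `h` decreases. As `h` falls from `1` to `0` on `[0, 2]`, its
    -- slope is `-1/2` at some `c`, so `η₀` does not vanish at points of norm `√c`; such a point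
    -- exists because `d > 0`.
    obtain ⟨c, hc, hc'⟩ := exists_deriv_eq_slope h (by norm_num : (0 : ℝ) < 2)
      hs.continuous.continuousOn (hs.differentiable (by simp)).differentiableOn
    have h2 : h 2 = 0 := by simp [hh]
    have h00 : h 0 = 1 := Real.smoothTransition.one_of_one_le (by norm_num)
    refine tη.continuous.integral_pos_of_hasCompactSupport_nonneg_nonzero tη.compact
      (x := EuclideanSpace.single ⟨0, hd⟩ (Real.sqrt c)) (fun z => ?_) ?_
    · have := hanti.deriv_nonpos (x := ‖z‖ ^ 2)
      simp only [hη₀, Pi.zero_apply]; linarith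
    · simp only [hη₀, PiLp.norm_single, Real.norm_eq_abs, sq_abs]
      rw [Real.sq_sqrt hc.1.le, hc', h2, h00]
      norm_num
  refine ⟨fun z => (∫ z, η₀ z)⁻¹ * ζ₀ z, fun z => (∫ z, η₀ z)⁻¹ * η₀ z,
    ⟨contDiff_const.mul tζ.smooth, tζ.compact.mul_left⟩,
    ⟨contDiff_const.mul tη.smooth, tη.compact.mul_left⟩, fun l => ?_, ?_⟩
  · have := partialDeriv_clm_comp ((∫ z, η₀ z)⁻¹ • ContinuousLinearMap.id ℝ ℝ)
      tζ.differentiable l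
    simp only [_root_.smul_apply, ContinuousLinearMap.id_apply, smul_eq_mul] at this
    rw [this, partialDeriv_radial (hs.differentiable (by simp))]
    funext z
    simp only [hη₀]; ring
  · rw [integral_const_mul, inv_mul_cancel₀ hpos.ne']

/-- Differentiating `∂ⱼη + ∑ₗ ∂ₗ(zₗ ∂ⱼη)` out gives `- ∂ⱼ Δζ`. -/
lemma kernel_identity {ζ η : Space d → ℝ} (hζ : IsTest ζ) (hη : IsTest η)
    (h : ∀ l, partialDeriv l ζ = fun z => -(z l * η z)) (j : Fin d) (z : Space d) :
    partialDeriv j η z + ∑ l, partialDeriv l (fun z => z l * partialDeriv j η z) z =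
      -∑ l, partialDeriv j (partialDeriv l (partialDeriv l ζ)) z := by
  have hcoord : ∀ l : Fin d, Differentiable ℝ fun z : Space d => z l := fun l =>
    (EuclideanSpace.proj l : Space d →L[ℝ] ℝ).differentiable
  have hpc : ∀ l : Fin d, partialDeriv j (fun z : Space d => z l) =
      fun _ => if l = j then 1 else 0 := by
    intro l
    funext z
    rw [partialDeriv, show (fun z : Space d => z l) = (EuclideanSpace.proj l : Space d →L[ℝ] ℝ)
      from rfl, ContinuousLinearMap.fderiv]
    simp
  have e1 : ∀ l, (fun z : Space d => z l * partialDeriv j η z) =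
      fun z => -(partialDeriv j (partialDeriv l ζ) z) + -(if l = j then 1 else 0) * η z := by
    intro l
    have h1 : partialDeriv j (partialDeriv l ζ) = fun z =>
        -((if l = j then 1 else 0) * η z + z l * partialDeriv j η z) := by
      rw [h l]
      have := partialDeriv_clm_comp (-ContinuousLinearMap.id ℝ ℝ)
        ((hcoord l).fun_mul hη.differentiable) j
      simp only [_root_.neg_apply, ContinuousLinearMap.id_apply] at this
      rw [this, partialDeriv_mul (hcoord l) hη.differentiable, hpc]
    funext z
    rw [h1]; ring
  have e2 : ∀ l, partialDeriv l (fun z => z l * partialDeriv j η z) z =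
      -partialDeriv j (partialDeriv l (partialDeriv l ζ)) z +
        -(if l = j then 1 else 0) * partialDeriv l η z := by
    intro l
    have d1 := ((hζ.partialDeriv l).partialDeriv j).differentiable
    rw [e1, partialDeriv_add d1.fun_neg (hη.differentiable.const_mul _)]
    have a1 := partialDeriv_clm_comp (-ContinuousLinearMap.id ℝ ℝ) d1 l
    have a2 := partialDeriv_clm_comp
      ((-(if l = j then (1 : ℝ) else 0)) • ContinuousLinearMap.id ℝ ℝ) hη.differentiable l
    simp only [_root_.neg_apply, _root_.smul_apply, ContinuousLinearMap.id_apply,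
      smul_eq_mul] at a1 a2
    rw [a1, a2,
      partialDeriv_comm (contDiff_infty.1 (hζ.partialDeriv l).smooth 2)]
  simp only [e2, Finset.sum_add_distrib, Finset.sum_neg_distrib]
  simp

variable {L α M M' H : ℝ} {q : Space d → ℝ}

/-- The reproducing formula: `∫₀^∞ (Δζ)_t * g dt / t = - g` when `g` is a derivative of a bounded
function. -/
lemma sum_scaleIntegral_eq_neg {ζ η : Space d → ℝ} (hζ : IsTest ζ) (hη : IsTest η)
    (h : ∀ l, partialDeriv l ζ = fun z => -(z l * η z)) (hη₁ : ∫ z, η z = 1)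
    (hL : 0 < L) (hα : 0 < α) (hq : ContDiff ℝ 1 q) (hM : ∀ x, |q x| ≤ M)
    (hM' : ∀ x, ‖fderiv ℝ q x‖ ≤ M') (j : Fin d) {M₁ : ℝ}
    (hg : HolderBound L α M₁ H (partialDeriv j q)) (x : Space d) :
    ∑ i, scaleIntegral (partialDeriv i (partialDeriv i ζ)) (partialDeriv j q) x =
      - partialDeriv j q x := by
  -- The function `∂ⱼq` is only Hölder and cannot be differentiated along `t`. Write its average as
  -- `-t⁻¹` times the average of `q` against `∂ⱼη`; then only the first derivatives of `q` are
  -- needed, and `kernel_identity` collects the result.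
  have hderiv : ∀ t ∈ Set.Ioi (0 : ℝ), HasDerivAt (fun t => avg η (partialDeriv j q) t x)
      (∑ i, t⁻¹ * avg (partialDeriv i (partialDeriv i ζ)) (partialDeriv j q) t x) t := by
    intro t ht
    have ht0 : t ≠ 0 := ne_of_gt ht
    have h1 := (hasDerivAt_inv ht0).neg.mul
      (hasDerivAt_avg (hη.partialDeriv j) hq hM' x ht0)
    have h2 : (fun t => avg η (partialDeriv j q) t x) =ᶠ[nhds t]
        (-fun t => t⁻¹) * fun t => avg (partialDeriv j η) q t x := by
      filter_upwards [isOpen_ne.mem_nhds ht0] with s hs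
      rw [avg_partialDeriv hη hq hs]; rfl
    refine (h1.congr_of_eventuallyEq h2).congr_deriv ?_
    have hsum : avg (partialDeriv j η) q t x +
        ∑ l, avg (partialDeriv l fun z => z l * partialDeriv j η z) q t x =
        -∑ l, avg (partialDeriv j (partialDeriv l (partialDeriv l ζ))) q t x := by
      have hc := continuous_comp_add_smul hq.continuous x t
      simp only [avg]
      rw [← integral_finsetSum _ fun l _ =>
          (((hη.partialDeriv j).mul_coord l).partialDeriv l).integrable_mul hc,
        ← integral_finsetSum _ fun l _ =>
          (((hζ.partialDeriv l).partialDeriv l).partialDeriv j).integrable_mul hc,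
        ← integral_add ((hη.partialDeriv j).integrable_mul hc)
          (integrable_finsetSum _ fun l _ =>
            (((hη.partialDeriv j).mul_coord l).partialDeriv l).integrable_mul hc),
        ← integral_neg]
      congr 1
      funext z
      rw [← Finset.sum_mul, ← Finset.sum_mul, ← add_mul, kernel_identity hζ hη h j z, neg_mul]
    have e : ∀ i, avg (partialDeriv i (partialDeriv i ζ)) (partialDeriv j q) t x =
        -t⁻¹ * avg (partialDeriv j (partialDeriv i (partialDeriv i ζ))) q t x := fun i =>
      avg_partialDeriv ((hζ.partialDeriv i).partialDeriv i) hq ht0 j x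
    simp only [e, ← Finset.mul_sum]
    set S := ∑ i, avg (partialDeriv j (partialDeriv i (partialDeriv i ζ))) q t x
    rw [show S = -(avg (partialDeriv j η) q t x +
        ∑ l, avg (partialDeriv l fun z => z l * partialDeriv j η z) q t x) by rw [hsum, neg_neg]]
    simp only [Pi.neg_apply]
    field_simp
  have hint : ∀ i, IntegrableOn (fun t =>
      t⁻¹ * avg (partialDeriv i (partialDeriv i ζ)) (partialDeriv j q) t x) (Set.Ioi 0) :=
    fun i => hg.integrableOn hL hα (hζ.partialDeriv i) i x
  -- With the derivative moved to the kernel, boundedness of `q` leaves a factor `t⁻¹`. A nonzero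
  -- constant would not tend to zero, which is why the formula is for derivatives.
  have hlim : Filter.Tendsto (fun t => avg η (partialDeriv j q) t x) Filter.atTop (nhds 0) := by
    have hb : ∀ᶠ t : ℝ in Filter.atTop, ‖avg η (partialDeriv j q) t x‖ ≤
        t⁻¹ * ((∫ z, |partialDeriv j η z|) * M) := by
      filter_upwards [Filter.eventually_gt_atTop 0] with t ht
      rw [avg_partialDeriv hη hq ht.ne', norm_mul, norm_neg,
        Real.norm_of_nonneg (inv_pos.2 ht).le]
      gcongr
      exact abs_avg_le (hη.partialDeriv j) hM t x
    refine squeeze_zero_norm' hb ?_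
    simpa using tendsto_inv_atTop_zero.mul_const ((∫ z, |partialDeriv j η z|) * M)
  -- At `t = 0` the average is `∂ⱼq x · ∫ η`, and `∫ η = 1`.
  have hmain := integral_Ioi_of_hasDerivAt_of_tendsto
    (continuous_avg_left hη hg.continuous hg.bound x).continuousAt.continuousWithinAt
    hderiv (integrable_finsetSum _ fun i _ => hint i) hlim
  rw [integral_finsetSum _ fun i _ => hint i] at hmain
  simp only [scaleIntegral]
  rw [hmain]
  simp [avg, integral_mul_const, hη₁]

end Kernel

/-! ### Uniform boundedness of the scale integral in all orders -/

section Bounds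

variable {d : ℕ} {L α : ℝ} {χ u : Space d → ℝ}

lemma HolderBound.of_seminorm (hL : 0 < L) (hα : 0 < α) (hu : Continuous u)
    (pu : IsPeriodic L u) (hfin : holderSeminorm L α u ≠ ⊤) :
    HolderBound L α (supNorm L u).toReal
      (d * (2 * ((holderSeminorm L α u).toReal / L ^ α))) u :=
  ⟨pu, hu, fun x => pu.norm_le_supNorm hL (supNorm_ne_top hu) x,
    fun x y => pu.norm_sub_le_holderSeminorm hα hL hfin x y⟩

/-- The constant in the Hölder estimate of `scaleIntegral`. -/
def scaleConst (α : ℝ) (χ : Space d → ℝ) (i : Fin d) : ℝ :=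
  moment α (partialDeriv i χ) / α * (2 * d) + (∫ z, |partialDeriv i (partialDeriv i χ) z|) +
    holderConst α (partialDeriv i χ) * (2 * d)

lemma holderConst_nonneg (hα : 0 < α) (hα₁ : α < 1) (ψ : Space d → ℝ) : 0 ≤ holderConst α ψ :=
  add_nonneg (div_nonneg (mul_nonneg zero_le_two (moment_nonneg _ _)) hα.le)
    (div_nonneg (Finset.sum_nonneg fun _ _ => moment_nonneg _ _) (by linarith))

/-- The `L^α` from integrating the small scales cancels the normalisation of the seminorm, so the
constant depends on the kernel, `d` and `α` only. Extending the Hölder bound beyond the cell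
contributes the factor `2d`. -/
lemma supNorm_scaleIntegral_le (hL : 0 < L) (hα : 0 < α) (hα₁ : α < 1) (hχ : IsTest χ)
    (hu : Continuous u) (pu : IsPeriodic L u) (hfin : holderSeminorm L α u ≠ ⊤) (i : Fin d) :
    supNorm L (scaleIntegral (partialDeriv i χ) u) ≤
      ENNReal.ofReal (scaleConst α χ i) * (supNorm L u + holderSeminorm L α u) := by
  have hs := supNorm_ne_top (L := L) hu
  have hLα : 0 < L ^ α := Real.rpow_pos_of_pos hL _
  refine supNorm_le fun x _ => ?_
  have h := (HolderBound.of_seminorm hL hα hu pu hfin).abs_scaleIntegral_le hL hα hχ i x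
  rw [← ofReal_norm, ← ENNReal.ofReal_toReal hs, ← ENNReal.ofReal_toReal hfin,
    ← ENNReal.ofReal_add ENNReal.toReal_nonneg ENNReal.toReal_nonneg,
    ← ENNReal.ofReal_mul' (by positivity)]
  refine ENNReal.ofReal_le_ofReal (h.trans ?_)
  set S := (supNorm L u).toReal
  set T := (holderSeminorm L α u).toReal
  have hS : 0 ≤ S := ENNReal.toReal_nonneg
  have hT : 0 ≤ T := ENNReal.toReal_nonneg
  have n1 : 0 ≤ moment α (partialDeriv i χ) / α := div_nonneg (moment_nonneg _ _) hα.le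
  have n2 := integral_abs_nonneg (partialDeriv i (partialDeriv i χ))
  have n3 := holderConst_nonneg hα hα₁ (partialDeriv i χ)
  have e : d * (2 * (T / L ^ α)) * L ^ α = 2 * d * T := by field_simp
  rw [e, scaleConst]
  have hd : (0 : ℝ) ≤ d := Nat.cast_nonneg d
  have m1 := mul_nonneg (mul_nonneg n1 (mul_nonneg zero_le_two hd)) hS
  have m2 := mul_nonneg n2 hT
  have m3 := mul_nonneg (mul_nonneg n3 (mul_nonneg zero_le_two hd)) (add_nonneg hS hT)
  nlinarith

lemma holderSeminorm_scaleIntegral_le (hL : 0 < L) (hα : 0 < α) (hα₁ : α < 1) (hχ : IsTest χ)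
    (hu : Continuous u) (pu : IsPeriodic L u) (hfin : holderSeminorm L α u ≠ ⊤) (i : Fin d) :
    holderSeminorm L α (scaleIntegral (partialDeriv i χ) u) ≤
      ENNReal.ofReal (scaleConst α χ i) * holderSeminorm L α u := by
  have hLα : 0 < L ^ α := Real.rpow_pos_of_pos hL _
  have h := (HolderBound.of_seminorm hL hα hu pu hfin).abs_scaleIntegral_sub_le hL hα hα₁ hχ i
  have n1 : 0 ≤ moment α (partialDeriv i χ) / α := div_nonneg (moment_nonneg _ _) hα.le
  have n2 := integral_abs_nonneg (partialDeriv i (partialDeriv i χ))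
  have n3 := holderConst_nonneg hα hα₁ (partialDeriv i χ)
  refine holderSeminorm_le hL (by positivity) ?_ fun x _ y _ => h x y
  rw [← ENNReal.ofReal_toReal hfin, ← ENNReal.ofReal_mul' ENNReal.toReal_nonneg]
  apply ENNReal.ofReal_le_ofReal
  rw [ENNReal.toReal_ofReal ENNReal.toReal_nonneg]
  set T := (holderSeminorm L α u).toReal
  have hT : 0 ≤ T := ENNReal.toReal_nonneg
  have e : L ^ α * (holderConst α (partialDeriv i χ) * (d * (2 * (T / L ^ α)))) =
      holderConst α (partialDeriv i χ) * (2 * d) * T := by field_simp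
  rw [e, scaleConst]
  refine mul_le_mul_of_nonneg_right ?_ hT
  have : 0 ≤ moment α (partialDeriv i χ) / α * (2 * d) := by positivity
  linarith

lemma IsHolder.partialDeriv {F : Type*} [NormedAddCommGroup F] [NormedSpace ℝ F]
    {u : Space d → F} (hL : 0 < L) {k : ℕ} (hu : IsHolder L (k + 1) α u) (l : Fin d) :
    IsHolder L k α (partialDeriv l u) := by
  have h1 : ContDiff ℝ (k + 1 : ℕ) u := by exact_mod_cast hu.1
  refine ⟨contDiff_partialDeriv h1 l, ?_⟩
  have h2 := (holderNorm_partialDeriv_le (α := α) hL h1 l).trans_lt hu.2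
  by_contra h3
  rw [not_lt, top_le_iff] at h3
  rw [h3, ENNReal.mul_top (by simpa using hL)] at h2
  exact lt_irrefl _ h2

lemma IsHolder.holderSeminorm_ne_top {F : Type*} [NormedAddCommGroup F] [NormedSpace ℝ F]
    {u : Space d → F} (hL : 0 < L) (hα : 0 < α) (hα₁ : α < 1) {k : ℕ}
    (hu : IsHolder L k α u) : holderSeminorm L α u ≠ ⊤ := by
  have h := sum_holderSeminorm_le hL hα hα₁ hu.1
  rw [Finset.sum_range_succ', multiIndices_zero, Finset.sum_singleton, multiDeriv_zero, pow_zero,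
    ENNReal.ofReal_one, one_mul] at h
  refine ne_top_of_le_ne_top (ENNReal.mul_ne_top ?_ hu.2.ne) (le_add_self.trans h)
  simp [ENNReal.mul_eq_top]

lemma IsHolder.holderBound (hL : 0 < L) (hα : 0 < α) (hα₁ : α < 1) {k : ℕ}
    (hu : IsHolder L k α u) (pu : IsPeriodic L u) :
    HolderBound L α (supNorm L u).toReal
      (d * (2 * ((holderSeminorm L α u).toReal / L ^ α))) u :=
  HolderBound.of_seminorm hL hα hu.1.continuous pu (hu.holderSeminorm_ne_top hL hα hα₁)

lemma contDiff_succ_of_hasFDerivAt {k : ℕ} {g : Fin d → Space d → ℝ}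
    (h : ∀ x, HasFDerivAt u (coordCLM fun l => g l x) x) (hg : ∀ l, ContDiff ℝ k (g l)) :
    ContDiff ℝ (k + 1 : ℕ) u := by
  have : ContDiff ℝ (k + 1) u := by
    rw [contDiff_succ_iff_hasFDerivAt]
    refine ⟨fun x => coordCLM fun l => g l x, ?_, h⟩
    simp only [coordCLM]
    exact ContDiff.sum fun l _ => (hg l).smul contDiff_const
  exact_mod_cast this

lemma continuous_of_holder {g : Space d → ℝ} {C : ℝ} (hα : 0 < α)
    (h : ∀ x y, |g x - g y| ≤ C * ‖x - y‖ ^ α) : Continuous g := by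
  rw [continuous_iff_continuousAt]
  intro x
  rw [ContinuousAt, tendsto_iff_norm_sub_tendsto_zero]
  refine squeeze_zero (fun _ => norm_nonneg _) (fun y => h y x) ?_
  have : Continuous fun y : Space d => C * ‖y - x‖ ^ α :=
    continuous_const.mul ((continuous_id.sub continuous_const).norm.rpow_const
      fun _ => Or.inr hα.le)
  simpa [Real.zero_rpow hα.ne'] using this.tendsto x

lemma IsHolder.hasFDerivAt_scaleIntegral (hL : 0 < L) (hα : 0 < α) (hα₁ : α < 1)
    (hχ : IsTest χ) {k : ℕ} (hu : IsHolder L (k + 1) α u) (pu : IsPeriodic L u) (i : Fin d)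
    (x : Space d) : HasFDerivAt (scaleIntegral (PeriodicHolder.partialDeriv i χ) u)
      (coordCLM fun l => scaleIntegral (PeriodicHolder.partialDeriv i χ)
        (PeriodicHolder.partialDeriv l u) x) x := by
  have hp : ∀ l, IsHolder L k α (PeriodicHolder.partialDeriv l u) := fun l => hu.partialDeriv hL l
  -- Sums over the directions serve as bounds common to all partial derivatives.
  set M' := ∑ l, (supNorm L (PeriodicHolder.partialDeriv l u)).toReal with hM'
  set H' := ∑ l : Fin d, d * (2 * ((holderSeminorm L α
    (PeriodicHolder.partialDeriv l u)).toReal / L ^ α)) with hH'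
  have hLα : 0 < L ^ α := Real.rpow_pos_of_pos hL _
  refine (hu.holderBound hL hα hα₁ pu).hasFDerivAt_scaleIntegral hL hα hχ
    (hu.1.of_le (by norm_cast; omega)) (M' := M') (H' := H') (fun l => ?_) i x
  have hb := (hp l).holderBound hL hα hα₁ (pu.partialDeriv l)
  refine ⟨hb.periodic, hb.continuous, fun x => (hb.bound x).trans ?_,
    fun x y => (hb.holder x y).trans ?_⟩
  · exact Finset.single_le_sum (f := fun l => (supNorm L (PeriodicHolder.partialDeriv l u)).toReal)
      (fun _ _ => ENNReal.toReal_nonneg) (Finset.mem_univ l)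
  · refine mul_le_mul_of_nonneg_right ?_ (by positivity)
    exact Finset.single_le_sum (f := fun l : Fin d => d * (2 * ((holderSeminorm L α
      (PeriodicHolder.partialDeriv l u)).toReal / L ^ α)))
      (fun _ _ => by positivity) (Finset.mem_univ l)

lemma IsHolder.partialDeriv_scaleIntegral (hL : 0 < L) (hα : 0 < α) (hα₁ : α < 1)
    (hχ : IsTest χ) {k : ℕ} (hu : IsHolder L (k + 1) α u) (pu : IsPeriodic L u) (i l : Fin d) :
    PeriodicHolder.partialDeriv l (scaleIntegral (PeriodicHolder.partialDeriv i χ) u) =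
      scaleIntegral (PeriodicHolder.partialDeriv i χ) (PeriodicHolder.partialDeriv l u) := by
  funext x
  conv_lhs => rw [PeriodicHolder.partialDeriv]
  rw [(hu.hasFDerivAt_scaleIntegral hL hα hα₁ hχ pu i x).fderiv, coordCLM_single]

lemma IsHolder.contDiff_scaleIntegral (hL : 0 < L) (hα : 0 < α) (hα₁ : α < 1)
    (hχ : IsTest χ) {k : ℕ} (hu : IsHolder L k α u) (pu : IsPeriodic L u) (i : Fin d) :
    ContDiff ℝ k (scaleIntegral (PeriodicHolder.partialDeriv i χ) u) := by
  induction k generalizing u with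
  | zero =>
    rw [Nat.cast_zero, contDiff_zero]
    exact continuous_of_holder hα
      ((hu.holderBound hL hα hα₁ pu).abs_scaleIntegral_sub_le hL hα hα₁ hχ i)
  | succ k ih =>
    exact contDiff_succ_of_hasFDerivAt (hu.hasFDerivAt_scaleIntegral hL hα hα₁ hχ pu i)
      fun l => ih (hu.partialDeriv hL l) (pu.partialDeriv l)

lemma IsHolder.wordDeriv {F : Type*} [NormedAddCommGroup F] [NormedSpace ℝ F]
    {u : Space d → F} (hL : 0 < L) {k : ℕ} (p : List (Fin d))
    (hu : IsHolder L (k + p.length) α u) : IsHolder L k α (wordDeriv p u) := by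
  induction p generalizing k with
  | nil => exact hu
  | cons l p ih =>
    refine (ih (k := k + 1) ?_).partialDeriv hL l
    rwa [List.length_cons, add_comm p.length, ← add_assoc] at hu

/-- Since the operator commutes with every derivative, the order-zero estimates can be applied to
each `Dᵐu`, and the constant is the same for all orders. -/
lemma IsHolder.wordDeriv_scaleIntegral (hL : 0 < L) (hα : 0 < α) (hα₁ : α < 1)
    (hχ : IsTest χ) (p : List (Fin d)) {k : ℕ} (hu : IsHolder L (k + p.length) α u)
    (pu : IsPeriodic L u) (i : Fin d) :
    PeriodicHolder.wordDeriv p (scaleIntegral (PeriodicHolder.partialDeriv i χ) u) =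
      scaleIntegral (PeriodicHolder.partialDeriv i χ) (PeriodicHolder.wordDeriv p u) := by
  induction p generalizing k with
  | nil => rfl
  | cons l p ih =>
    have hu' : IsHolder L (k + 1 + p.length) α u := by
      rwa [List.length_cons, add_comm p.length, ← add_assoc] at hu
    rw [wordDeriv_cons, ih hu', IsHolder.partialDeriv_scaleIntegral hL hα hα₁ hχ
      (hu'.wordDeriv hL p) (pu.wordDeriv p), wordDeriv_cons]

/-- The operator `scaleIntegral` is bounded on periodic `C^{k,α}`, uniformly in `k`. -/
theorem IsHolder.holderNorm_scaleIntegral_le (hL : 0 < L) (hα : 0 < α) (hα₁ : α < 1)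
    (hχ : IsTest χ) {k : ℕ} (hu : IsHolder L k α u) (pu : IsPeriodic L u) (i : Fin d) :
    holderNorm L k α (scaleIntegral (PeriodicHolder.partialDeriv i χ) u) ≤
      ENNReal.ofReal (scaleConst α χ i) * (d * d + 3) * holderNorm L k α u := by
  set K := ENNReal.ofReal (scaleConst α χ i)
  have hcomm : ∀ {j : ℕ} {m : Fin d → ℕ}, m ∈ multiIndices d j → j ≤ k →
      multiDeriv m (scaleIntegral (PeriodicHolder.partialDeriv i χ) u) =
        scaleIntegral (PeriodicHolder.partialDeriv i χ) (multiDeriv m u) ∧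
      Continuous (multiDeriv m u) ∧ holderSeminorm L α (multiDeriv m u) ≠ ⊤ := by
    intro j m hm hj
    have hlen := length_indexWord_of_mem hm
    have hu' : IsHolder L (k - j + (indexWord m).length) α u := by
      rwa [hlen, Nat.sub_add_cancel hj]
    rw [multiDeriv_eq_wordDeriv, multiDeriv_eq_wordDeriv]
    have hw := hu'.wordDeriv hL
    exact ⟨hu'.wordDeriv_scaleIntegral hL hα hα₁ hχ _ pu i, hw.1.continuous,
      hw.holderSeminorm_ne_top hL hα hα₁⟩
  have h1 : cNorm L k (scaleIntegral (PeriodicHolder.partialDeriv i χ) u) ≤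
      K * (cNorm L k u + ∑ j ∈ Finset.range (k + 1), ∑ m ∈ multiIndices d j,
        ENNReal.ofReal (L ^ j) * holderSeminorm L α (multiDeriv m u)) := by
    rw [cNorm, cNorm, ← Finset.sum_add_distrib, Finset.mul_sum]
    refine Finset.sum_le_sum fun j hj => ?_
    rw [← Finset.sum_add_distrib, Finset.mul_sum]
    refine Finset.sum_le_sum fun m hm => ?_
    obtain ⟨e1, e2, e3⟩ := hcomm hm (by simpa [Nat.lt_succ_iff] using hj)
    rw [e1, ← mul_add, mul_left_comm]
    exact mul_le_mul_right (supNorm_scaleIntegral_le hL hα hα₁ hχ e2 (pu.multiDeriv m) e3 i) _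
  have h2 : ∑ m ∈ multiIndices d k, ENNReal.ofReal (L ^ k) * holderSeminorm L α
      (multiDeriv m (scaleIntegral (PeriodicHolder.partialDeriv i χ) u)) ≤
      K * ∑ m ∈ multiIndices d k, ENNReal.ofReal (L ^ k) *
        holderSeminorm L α (multiDeriv m u) := by
    rw [Finset.mul_sum]
    refine Finset.sum_le_sum fun m hm => ?_
    obtain ⟨e1, e2, e3⟩ := hcomm hm le_rfl
    rw [e1, mul_left_comm]
    exact mul_le_mul_right
      (holderSeminorm_scaleIntegral_le hL hα hα₁ hχ e2 (pu.multiDeriv m) e3 i) _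
  calc holderNorm L k α (scaleIntegral (PeriodicHolder.partialDeriv i χ) u)
      ≤ K * (holderNorm L k α u + (d * d + 1) * holderNorm L k α u) + K * holderNorm L k α u :=
        add_le_add (h1.trans (mul_le_mul_right (add_le_add le_self_add
          (sum_holderSeminorm_le hL hα hα₁ hu.1)) _)) (h2.trans (mul_le_mul_right le_add_self _))
    _ = _ := by ring

end Bounds

/-! ### Identifying the L² projection from a Helmholtz decomposition -/

section Projection

variable {d : ℕ} {L : ℝ}

lemma measurableSet_cell (d : ℕ) (L : ℝ) : MeasurableSet (cell d L) :=
  (isCompact_cell d L).isClosed.measurableSet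

/-- The derivative of a periodic function integrates to zero over the period cell. -/
lemma integral_cell_partialDeriv (hL : 0 < L) {g : Space d → ℝ} (hg : ContDiff ℝ 1 g)
    (pg : IsPeriodic L g) (i : Fin d) : ∫ x in cell d L, partialDeriv i g x = 0 := by
  obtain ⟨n, rfl⟩ : ∃ n, d = n + 1 := ⟨d - 1, by have := i.pos; omega⟩
  have hcell : (WithLp.toLp 2 : (Fin (n + 1) → ℝ) → Space (n + 1)) ⁻¹' cell (n + 1) L =
      Set.Icc (fun _ => 0) (fun _ => L) := by
    ext y
    simp only [Set.mem_preimage, cell, Set.mem_ofPred_eq, Set.mem_Icc, Pi.le_def]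
    exact forall_and
  rw [← (PiLp.volume_preserving_toLp (Fin (n + 1))).setIntegral_preimage_emb
    (MeasurableEquiv.toLp 2 (Fin (n + 1) → ℝ)).measurableEmbedding, hcell]
  set e : (Fin (n + 1) → ℝ) →L[ℝ] Space (n + 1) :=
    (EuclideanSpace.equiv (Fin (n + 1)) ℝ).symm.toContinuousLinearMap with he
  have he' : ∀ y, e y = WithLp.toLp 2 y := fun y => rfl
  have hder : ∀ y, HasFDerivAt (fun y => g (e y)) ((fderiv ℝ g (e y)).comp e) y := fun y =>
    (hg.differentiable (by simp) (e y)).hasFDerivAt.comp y e.hasFDerivAt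
  have hsingle : e (Pi.single i 1) = EuclideanSpace.single i 1 := rfl
  have hcont : Continuous (partialDeriv i g) :=
    (contDiff_partialDeriv (n := 0) (by simpa using hg) i).continuous
  have hsum : ∀ y, ∑ j, (if j = i then (fderiv ℝ g (e y)).comp e else 0) (Pi.single j 1) =
      partialDeriv i g (WithLp.toLp 2 y) := by
    intro y
    rw [Finset.sum_eq_single i (fun j _ hj => by simp [hj]) (by simp), if_pos rfl,
      ContinuousLinearMap.comp_apply, hsingle]
    rfl
  -- Apply the divergence theorem on the box to the field whose only component is `g` in direction
  -- `i`; the two faces orthogonal to `i` cancel by periodicity.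
  have h := integral_divergence_of_hasFDerivAt_off_countable' (n := n) (fun _ => (0 : ℝ))
    (fun _ => L) (fun _ => hL.le) (fun j y => if j = i then g (e y) else 0)
    (fun j y => if j = i then (fderiv ℝ g (e y)).comp e else 0) ∅ Set.countable_empty
    (fun j => by
      by_cases hj : j = i
      · simp only [hj, if_true]
        exact (hg.continuous.comp e.continuous).continuousOn
      · simp only [hj, if_false]
        exact continuousOn_const)
    (fun y _ j => by
      by_cases hj : j = i
      · simp only [hj, if_true]
        exact hder y
      · simp only [hj, if_false]
        exact hasFDerivAt_const _ _)
    (by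
      simp only [hsum]
      exact (hcont.comp e.continuous).continuousOn.integrableOn_compact isCompact_Icc)
  simp only [hsum] at h
  rw [h, Finset.sum_eq_zero]
  intro j _
  by_cases hj : j = i
  · subst hj
    simp only [if_true]
    rw [sub_eq_zero]
    congr 1
    funext y
    rw [← pg (e (j.insertNth 0 y)) j]
    congr 1
    ext l
    rw [PiLp.add_apply, he', he']
    refine Fin.succAboveCases j ?_ (fun m => ?_) l
    · simp
    · simp
  · simp [hj]

instance isFiniteMeasure_cellMeasure (d : ℕ) (L : ℝ) : IsFiniteMeasure (cellMeasure d L) :=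
  ⟨by rw [cellMeasure, Measure.restrict_apply_univ]; exact (isCompact_cell d L).measure_lt_top⟩

lemma memLp_cellMeasure {f : Space d → Space d} (hf : Continuous f) :
    MemLp f 2 (cellMeasure d L) := by
  obtain ⟨C, hC⟩ := (isCompact_cell d L).exists_bound_of_continuousOn hf.continuousOn
  refine MemLp.of_bound hf.aestronglyMeasurable C ?_
  exact (ae_restrict_iff' (measurableSet_cell d L)).2 (Filter.Eventually.of_forall hC)

/-- As `w` has zero divergence, `∇φ · w` is the divergence of the periodic field `φ w`. -/
lemma integral_inner_gradient (hL : 0 < L) {w : Space d → Space d} {φ : Space d → ℝ}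
    (hw : ContDiff ℝ 1 w) (pw : IsPeriodic L w)
    (hdiv : ∀ x, ∑ i, partialDeriv i (fun y => w y i) x = 0)
    (hφ : ContDiff ℝ 1 φ) (pφ : IsPeriodic L φ) :
    ∫ x in cell d L, inner ℝ (gradient φ x) (w x) = 0 := by
  have hwi : ∀ i, ContDiff ℝ 1 fun y => w y i := fun i =>
    (EuclideanSpace.proj i : Space d →L[ℝ] ℝ).contDiff.comp hw
  have hprod : ∀ i, ContDiff ℝ 1 fun y => φ y * w y i := fun i => hφ.mul (hwi i)
  have e : ∀ x, inner ℝ (gradient φ x) (w x) =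
      ∑ i, partialDeriv i (fun y => φ y * w y i) x := by
    intro x
    rw [gradient, InnerProductSpace.toDual_symm_apply, fderiv_eq_coordCLM, coordCLM_apply]
    have h2 : ∀ i, partialDeriv i (fun y => φ y * w y i) x =
        partialDeriv i φ x * w x i + φ x * partialDeriv i (fun y => w y i) x := fun i => by
      rw [partialDeriv_mul (hφ.differentiable (by simp)) ((hwi i).differentiable (by simp))]
    simp only [h2, Finset.sum_add_distrib]
    rw [← Finset.mul_sum, hdiv, mul_zero, add_zero]
  simp only [e]
  rw [integral_finsetSum]
  · refine Finset.sum_eq_zero fun i _ => integral_cell_partialDeriv hL (hprod i) ?_ i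
    intro x j
    simp only [pφ x j, pw x j]
  · intro i _
    have hc : Continuous (partialDeriv i fun y => φ y * w y i) :=
      (contDiff_partialDeriv (n := 0) (by simpa using hprod i) i).continuous
    exact hc.continuousOn.integrableOn_compact (isCompact_cell d L)

/-- A Helmholtz decomposition computes the Leray–Hodge projection. -/
theorem isLerayProjection_of_decomposition (hL : 0 < L) {f w : Space d → Space d}
    {φ : Space d → ℝ} (hf : Continuous f) (hw : ContDiff ℝ 1 w) (pw : IsPeriodic L w)
    (hdiv : ∀ x, ∑ i, partialDeriv i (fun y => w y i) x = 0)
    (hφ : ContDiff ℝ 1 φ) (pφ : IsPeriodic L φ) (hdec : ∀ x, f x = w x + gradient φ x) :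
    IsLerayProjection L f w := by
  have mw : MemLp w 2 (cellMeasure d L) := memLp_cellMeasure hw.continuous
  have mf : MemLp f 2 (cellMeasure d L) := memLp_cellMeasure hf
  refine ⟨mf, ?_⟩
  have hproj : leray d L (mf.toLp f) = mw.toLp w := by
    refine Submodule.eq_starProjection_of_mem_orthogonal ?_ ?_
    · have hle : Submodule.span ℝ (periodicGradients d L) ≤ (Submodule.span ℝ {mw.toLp w})ᗮ := by
        rw [Submodule.span_le]
        rintro g ⟨ψ, hψ, pψ, hg⟩
        rw [SetLike.mem_coe, Submodule.mem_orthogonal_singleton_iff_inner_left, L2.inner_def,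
          ← integral_inner_gradient hL hw pw hdiv hψ pψ]
        refine integral_congr_ae ?_
        filter_upwards [hg, mw.coeFn_toLp] with x h1 h2
        rw [h1, h2]
      rw [divergenceFree, Submodule.mem_orthogonal]
      intro g hg
      exact (Submodule.mem_orthogonal_singleton_iff_inner_left).1 (hle hg)
    -- The difference `f - w` is itself a periodic gradient, hence orthogonal to the divergence-free
    -- fields.
    · refine Submodule.le_orthogonal_orthogonal _ (Submodule.subset_span ⟨φ, hφ, pφ, ?_⟩)
      filter_upwards [Lp.coeFn_sub (mf.toLp f) (mw.toLp w), mf.coeFn_toLp, mw.coeFn_toLp]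
        with x h1 h2 h3
      rw [h1, Pi.sub_apply, h2, h3, hdec, add_sub_cancel_left]
  rw [hproj]
  exact mw.coeFn_toLp.symm

end Projection

/-! ### The projection as a singular integral operator -/

section Hodge

variable {d : ℕ} {L α : ℝ} {ζ : Space d → ℝ} {g g' : Fin d → Space d → ℝ} {k : ℕ}

/-- The components of the singular integral operator `g ↦ g - ∇Δ⁻¹ div g`. -/
def hodge (ζ : Space d → ℝ) (g : Fin d → Space d → ℝ) (i : Fin d) (x : Space d) : ℝ :=
  g i x + ∑ j, scaleIntegral (partialDeriv i (partialDeriv j ζ)) (g j) x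

lemma hodge_periodic (pg : ∀ j, IsPeriodic L (g j)) (i : Fin d) : IsPeriodic L (hodge ζ g i) := by
  intro x l
  simp only [hodge, pg i x l, fun j => scaleIntegral_periodic
    (ψ := partialDeriv i (partialDeriv j ζ)) (pg j) x l]

lemma contDiff_hodge (hL : 0 < L) (hα : 0 < α) (hα₁ : α < 1) (hζ : IsTest ζ)
    (hg : ∀ j, IsHolder L k α (g j)) (pg : ∀ j, IsPeriodic L (g j)) (i : Fin d) :
    ContDiff ℝ k (hodge ζ g i) :=
  (hg i).1.add (ContDiff.sum fun j _ =>
    (hg j).contDiff_scaleIntegral hL hα hα₁ (hζ.partialDeriv j) (pg j) i)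

/-- The constant in the Hölder estimate of `hodge`. -/
def hodgeConst (α : ℝ) (ζ : Space d → ℝ) : ℝ≥0∞ :=
  1 + (∑ i, ∑ j, ENNReal.ofReal (scaleConst α (partialDeriv j ζ) i)) * (d * d + 3)

lemma hodgeConst_ne_top (α : ℝ) (ζ : Space d → ℝ) : hodgeConst α ζ ≠ ⊤ := by
  refine ENNReal.add_ne_top.2 ⟨ENNReal.one_ne_top, ENNReal.mul_ne_top ?_ ?_⟩
  · exact ENNReal.sum_ne_top.2 fun i _ => ENNReal.sum_ne_top.2 fun j _ => ENNReal.ofReal_ne_top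
  · simp [ENNReal.mul_eq_top]

lemma holderNorm_hodge_le (hL : 0 < L) (hα : 0 < α) (hα₁ : α < 1) (hζ : IsTest ζ)
    (hg : ∀ j, IsHolder L k α (g j)) (pg : ∀ j, IsPeriodic L (g j)) (i : Fin d) :
    holderNorm L k α (hodge ζ g i) ≤ hodgeConst α ζ * ∑ j, holderNorm L k α (g j) := by
  have hc : ∀ j, ContDiff ℝ k (scaleIntegral (partialDeriv i (partialDeriv j ζ)) (g j)) :=
    fun j => (hg j).contDiff_scaleIntegral hL hα hα₁ (hζ.partialDeriv j) (pg j) i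
  refine (holderNorm_add_le hL (hg i).1 (ContDiff.sum fun j _ => hc j)).trans ?_
  rw [hodgeConst, add_mul, one_mul]
  refine add_le_add ?_ ?_
  · exact Finset.single_le_sum (f := fun j => holderNorm L k α (g j)) (fun _ _ => bot_le)
      (Finset.mem_univ i)
  · refine (holderNorm_sum_le hL _ fun j _ => hc j).trans ?_
    rw [Finset.mul_sum]
    refine Finset.sum_le_sum fun j _ => ?_
    refine ((hg j).holderNorm_scaleIntegral_le hL hα hα₁ (hζ.partialDeriv j) (pg j) i).trans ?_
    refine mul_le_mul_left (mul_le_mul_left ?_ _) _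
    refine le_trans ?_ (Finset.single_le_sum (f := fun i => ∑ j,
      ENNReal.ofReal (scaleConst α (partialDeriv j ζ) i)) (fun _ _ => bot_le) (Finset.mem_univ i))
    exact Finset.single_le_sum (f := fun j =>
      ENNReal.ofReal (scaleConst α (partialDeriv j ζ) i)) (fun _ _ => bot_le) (Finset.mem_univ j)

lemma partialDeriv_hodge (hL : 0 < L) (hα : 0 < α) (hα₁ : α < 1) (hζ : IsTest ζ)
    (hg : ∀ j, IsHolder L (k + 1) α (g j)) (pg : ∀ j, IsPeriodic L (g j)) (i l : Fin d) :
    partialDeriv l (hodge ζ g i) = hodge ζ (fun j => partialDeriv l (g j)) i := by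
  have h1 : ∀ j, Differentiable ℝ (g j) := fun j => (hg j).1.differentiable (by simp)
  have h2 : ∀ j, Differentiable ℝ (scaleIntegral (partialDeriv i (partialDeriv j ζ)) (g j)) :=
    fun j x => ((hg j).hasFDerivAt_scaleIntegral hL hα hα₁ (hζ.partialDeriv j) (pg j) i
      x).differentiableAt
  unfold hodge
  rw [partialDeriv_add (h1 i) (Differentiable.fun_sum fun j _ => h2 j),
    partialDeriv_sum _ fun j _ => h2 j]
  funext x
  congr 1
  refine Finset.sum_congr rfl fun j _ => ?_
  rw [(hg j).partialDeriv_scaleIntegral hL hα hα₁ (hζ.partialDeriv j) (pg j) i l]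

lemma scaleIntegral_add (hL : 0 < L) (hα : 0 < α) (hα₁ : α < 1) {χ u v : Space d → ℝ}
    (hχ : IsTest χ) {n : ℕ} (hu : IsHolder L k α u) (hv : IsHolder L n α v)
    (pu : IsPeriodic L u) (pv : IsPeriodic L v) (i : Fin d) (x : Space d) :
    scaleIntegral (partialDeriv i χ) (fun y => u y + v y) x =
      scaleIntegral (partialDeriv i χ) u x + scaleIntegral (partialDeriv i χ) v x := by
  have bu := hu.holderBound hL hα hα₁ pu
  have bv := hv.holderBound hL hα hα₁ pv
  have := HolderBound.scaleIntegral_sum (Finset.univ : Finset (Fin 2)) (g := ![u, v]) hL hα hχ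
    (M := ![_, _]) (H := ![_, _])
    (fun a _ => by
      fin_cases a
      · exact bu
      · exact bv) i x
  simpa [Fin.sum_univ_two] using this

/-- Two different orders are allowed because in the application the commutator field is one
derivative smoother than the gradient added to it. -/
lemma hodge_add (hL : 0 < L) (hα : 0 < α) (hα₁ : α < 1) (hζ : IsTest ζ) {n : ℕ}
    (hg : ∀ j, IsHolder L k α (g j)) (hg' : ∀ j, IsHolder L n α (g' j))
    (pg : ∀ j, IsPeriodic L (g j)) (pg' : ∀ j, IsPeriodic L (g' j)) (i : Fin d) (x : Space d) :
    hodge ζ (fun j y => g j y + g' j y) i x = hodge ζ g i x + hodge ζ g' i x := by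
  simp only [hodge, fun j => scaleIntegral_add hL hα hα₁ (hζ.partialDeriv j) (hg j) (hg' j)
    (pg j) (pg' j) i x, Finset.sum_add_distrib]
  ring

lemma exists_fderiv_bound {q : Space d → ℝ} (hL : 0 < L) (hq : ContDiff ℝ 1 q)
    (pq : IsPeriodic L q) : ∃ M, ∀ x, ‖fderiv ℝ q x‖ ≤ M := by
  refine ⟨_, fun x => pq.fderiv.norm_le_supNorm hL (supNorm_ne_top ?_) x⟩
  exact hq.continuous_fderiv (by simp)

variable {η : Space d → ℝ}

lemma sum_scaleIntegral_eq_neg_of_isHolder (hL : 0 < L) (hα : 0 < α) (hα₁ : α < 1)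
    (hζ : IsTest ζ) (hη : IsTest η) (h : ∀ l, partialDeriv l ζ = fun z => -(z l * η z))
    (hη₁ : ∫ z, η z = 1) {q : Space d → ℝ} (hq : IsHolder L (k + 1) α q) (pq : IsPeriodic L q)
    (j : Fin d) (x : Space d) :
    ∑ i, scaleIntegral (partialDeriv i (partialDeriv i ζ)) (partialDeriv j q) x =
      - partialDeriv j q x := by
  have hq1 : ContDiff ℝ 1 q := hq.1.of_le (by norm_cast; omega)
  obtain ⟨M', hM'⟩ := exists_fderiv_bound hL hq1 pq
  exact sum_scaleIntegral_eq_neg hζ hη h hη₁ hL hα hq1 (hq.holderBound hL hα hα₁ pq).bound hM' j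
    ((hq.partialDeriv hL j).holderBound hL hα hα₁ (pq.partialDeriv j)) x

/-- Exchanging the indices `i` and `j` turns the sum into `∑ⱼ ∂ⱼ∂ⱼζ` acting on `∂ᵢq`, which the
reproducing formula evaluates as `-∂ᵢq`. -/
lemma hodge_gradient (hL : 0 < L) (hα : 0 < α) (hα₁ : α < 1)
    (hζ : IsTest ζ) (hη : IsTest η) (h : ∀ l, partialDeriv l ζ = fun z => -(z l * η z))
    (hη₁ : ∫ z, η z = 1) {q : Space d → ℝ} (hq : IsHolder L (k + 1) α q) (pq : IsPeriodic L q)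
    (i : Fin d) (x : Space d) : hodge ζ (fun j => partialDeriv j q) i x = 0 := by
  have hq1 : ContDiff ℝ 1 q := hq.1.of_le (by norm_cast; omega)
  rw [hodge]
  simp only [fun j => scaleIntegral_partialDeriv_comm (hζ.partialDeriv j) hq1 i j x]
  rw [sum_scaleIntegral_eq_neg_of_isHolder hL hα hα₁ hζ hη h hη₁ hq pq i x, add_neg_cancel]

/-- The same exchange of indices reduces the divergence of the singular part to the reproducing
formula for each `∂ⱼ(g j)`, which cancels the divergence of `g`. -/
lemma div_hodge (hL : 0 < L) (hα : 0 < α) (hα₁ : α < 1)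
    (hζ : IsTest ζ) (hη : IsTest η) (h : ∀ l, partialDeriv l ζ = fun z => -(z l * η z))
    (hη₁ : ∫ z, η z = 1) (hg : ∀ j, IsHolder L (k + 1) α (g j)) (pg : ∀ j, IsPeriodic L (g j))
    (x : Space d) : ∑ i, partialDeriv i (hodge ζ g i) x = 0 := by
  simp only [partialDeriv_hodge hL hα hα₁ hζ hg pg, hodge]
  have hg1 : ∀ j, ContDiff ℝ 1 (g j) := fun j => (hg j).1.of_le (by norm_cast; omega)
  have e : ∀ i j, scaleIntegral (partialDeriv i (partialDeriv j ζ)) (partialDeriv i (g j)) x =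
      scaleIntegral (partialDeriv i (partialDeriv i ζ)) (partialDeriv j (g j)) x := by
    intro i j
    rw [partialDeriv_comm (contDiff_infty.1 hζ.smooth 2),
      scaleIntegral_partialDeriv_comm (hζ.partialDeriv i) (hg1 j)]
  simp only [e]
  rw [Finset.sum_add_distrib, Finset.sum_comm]
  simp only [fun j => sum_scaleIntegral_eq_neg_of_isHolder hL hα hα₁ hζ hη h hη₁ (hg j) (pg j) j x]
  simp

/-- The potential part of the Helmholtz decomposition. -/
lemma hasFDerivAt_hodgePotential (hL : 0 < L) (hα : 0 < α) (hα₁ : α < 1) (hζ : IsTest ζ)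
    (hg : ∀ j, IsHolder L k α (g j)) (pg : ∀ j, IsPeriodic L (g j)) (x : Space d) :
    HasFDerivAt (fun x => ∑ j, scalePotential (partialDeriv j ζ) (g j) x)
      (coordCLM fun l => g l x - hodge ζ g l x) x := by
  refine (HasFDerivAt.fun_sum fun j (_ : j ∈ Finset.univ) =>
    ((hg j).holderBound hL hα hα₁ (pg j)).hasFDerivAt_scalePotential hL hα hζ j x).congr_fderiv ?_
  rw [clm_eq_coordCLM (∑ j, _)]
  congr 1
  funext l
  simp [hodge, _root_.sum_apply]

end Hodge

/-! ### The commutator structure and the final estimate -/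

section Main

variable {d : ℕ} {L α : ℝ} {k : ℕ}

lemma IsHolder.mul (hL : 0 < L) (hα : 0 < α) (hα₁ : α < 1) (hk : 1 ≤ k) {u v : Space d → ℝ}
    (hu : IsHolder L k α u) (hv : IsHolder L k α v) (pu : IsPeriodic L u) (pv : IsPeriodic L v) :
    IsHolder L k α fun x => u x * v x :=
  ⟨hu.1.mul hv.1, (holderNorm_mul_le hL hα hα₁ hk hu.1 hv.1 pu pv).trans_lt
    (ENNReal.mul_lt_top (productConst_ne_top d).lt_top (ENNReal.mul_lt_top hu.2 hv.2))⟩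

lemma IsHolder.sum (hL : 0 < L) {ι : Type*} (s : Finset ι) {u : ι → Space d → ℝ}
    (hu : ∀ a ∈ s, IsHolder L k α (u a)) : IsHolder L k α fun x => ∑ a ∈ s, u a x :=
  ⟨ContDiff.sum fun a ha => (hu a ha).1, (holderNorm_sum_le hL s fun a ha => (hu a ha).1).trans_lt
    (ENNReal.sum_lt_top.2 fun a ha => (hu a ha).2)⟩

lemma IsHolder.sub (hL : 0 < L) {u v : Space d → ℝ} (hu : IsHolder L k α u)
    (hv : IsHolder L k α v) : IsHolder L k α fun x => u x - v x :=
  ⟨hu.1.sub hv.1, (holderNorm_sub_le hL hu.1 hv.1).trans_lt (ENNReal.add_lt_top.2 ⟨hu.2, hv.2⟩)⟩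

lemma IsHolder.of_succ (hL : 0 < L) (hα : 0 < α) (hα₁ : α < 1) {u : Space d → ℝ}
    (hu : IsHolder L (k + 1) α u) : IsHolder L k α u := by
  have h1 : ContDiff ℝ (k + 1 : ℕ) u := by exact_mod_cast hu.1
  refine ⟨h1.of_le (by norm_cast; omega), (holderNorm_le_succ hL hα hα₁ h1).trans_lt
    (ENNReal.mul_lt_top ?_ hu.2)⟩
  exact lt_top_iff_ne_top.2 (by simp [ENNReal.mul_eq_top])

lemma IsHolder.clm_comp (hL : 0 < L) {F : Type*} [NormedAddCommGroup F] [NormedSpace ℝ F]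
    (T : F →L[ℝ] ℝ) (hT : ‖T‖ ≤ 1) {u : Space d → F} (hu : IsHolder L k α u) :
    IsHolder L k α fun x => T (u x) :=
  ⟨T.contDiff.comp hu.1, (holderNorm_clm_comp_le hL T hT hu.1).trans_lt hu.2⟩

lemma norm_proj_le (i : Fin d) : ‖(EuclideanSpace.proj i : Space d →L[ℝ] ℝ)‖ ≤ 1 :=
  ContinuousLinearMap.opNorm_le_bound _ zero_le_one fun x => by
    simpa using abs_apply_le_norm x i

/-- Evaluation of a matrix entry. -/
def entryCLM (i j : Fin d) : (Space d →L[ℝ] Space d) →L[ℝ] ℝ :=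
  (EuclideanSpace.proj j).comp (ContinuousLinearMap.apply ℝ (Space d) (EuclideanSpace.single i 1))

lemma norm_entryCLM_le (i j : Fin d) : ‖entryCLM i j‖ ≤ 1 := by
  refine ContinuousLinearMap.opNorm_le_bound _ zero_le_one fun T => ?_
  rw [one_mul]
  refine (abs_apply_le_norm _ j).trans ?_
  simpa using T.le_opNorm (EuclideanSpace.single i 1)

lemma apply_eq_inner_single (y : Space d) (i : Fin d) :
    y i = inner ℝ y (EuclideanSpace.single i 1) := by
  simp [EuclideanSpace.inner_single_right]

lemma gradTransposeMul_apply {A v : Space d → Space d} (hA : Differentiable ℝ A) (x : Space d)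
    (i : Fin d) : gradTransposeMul A v x i =
      ∑ j, partialDeriv i (fun y => A y j) x * v x j := by
  have h2 : ∀ j, partialDeriv i (fun y => A y j) x = partialDeriv i A x j := fun j =>
    congrFun (partialDeriv_clm_comp (EuclideanSpace.proj j : Space d →L[ℝ] ℝ) hA i) x
  rw [apply_eq_inner_single, gradTransposeMul, ContinuousLinearMap.adjoint_inner_left, PiLp.inner_apply]
  refine Finset.sum_congr rfl fun j _ => ?_
  rw [h2, partialDeriv]
  simp

lemma holderNorm_of_subsingleton {F : Type*} [NormedAddCommGroup F] [NormedSpace ℝ F]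
    [Subsingleton F] (u : Space d → F) : holderNorm L k α u = 0 := by
  have h : ∀ w : Space d → F, w = 0 := fun w => Subsingleton.elim _ _
  have h1 : supNorm L (0 : Space d → F) = 0 := by simp [supNorm]
  have h2 : holderSeminorm L α (0 : Space d → F) = 0 := by simp [holderSeminorm]
  simp [holderNorm, cNorm, h (multiDeriv _ u), h1, h2]

lemma gradient_apply {φ : Space d → ℝ} {a : Fin d → ℝ} {x : Space d}
    (h : HasFDerivAt φ (coordCLM a) x) (i : Fin d) : gradient φ x i = a i := by
  rw [apply_eq_inner_single, gradient, InnerProductSpace.toDual_symm_apply, h.fderiv, coordCLM_single]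

variable {ζ η : Space d → ℝ}

/-- The constant in the estimate of the projected field. -/
def projectionConst (α : ℝ) (ζ : Space d → ℝ) : ℝ≥0∞ :=
  d * (hodgeConst α ζ * (d * (d * (productConst d * (d * d + 2)))) +
    d * (hodgeConst α ζ * (d * (d * (2 * productConst d)))))

lemma projectionConst_ne_top (α : ℝ) (ζ : Space d → ℝ) : projectionConst α ζ ≠ ⊤ := by
  have hd : (d : ℝ≥0∞) ≠ ⊤ := ENNReal.natCast_ne_top d
  have hP := productConst_ne_top d
  have hH := hodgeConst_ne_top α ζ
  have h2 : ((d : ℝ≥0∞) * d + 2) ≠ ⊤ := by simp [ENNReal.mul_eq_top]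
  exact ENNReal.mul_ne_top hd (ENNReal.add_ne_top.2
    ⟨ENNReal.mul_ne_top hH (ENNReal.mul_ne_top hd (ENNReal.mul_ne_top hd
      (ENNReal.mul_ne_top hP h2))),
    ENNReal.mul_ne_top hd (ENNReal.mul_ne_top hH (ENNReal.mul_ne_top hd (ENNReal.mul_ne_top hd
      (ENNReal.mul_ne_top ENNReal.ofNat_ne_top hP))))⟩)

/-- The field `f` is merely of order `k + 1`, but each derivative of its projection is the
projection of a commutator field of order `k + 1`, which supplies the extra order. The order is
written `k + 1` because the product estimate needs it to be positive. -/
theorem exists_lerayProjection (hL : 0 < L) (hα : 0 < α) (hα₁ : α < 1)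
    (hζ : IsTest ζ) (hη : IsTest η) (h : ∀ l, partialDeriv l ζ = fun z => -(z l * η z))
    (hη₁ : ∫ z, η z = 1) {A v : Space d → Space d} (hA : IsHolder L (k + 1 + 1) α A)
    (pA : IsPeriodic L (fderiv ℝ A)) (hv : IsHolder L (k + 1 + 1) α v) (pv : IsPeriodic L v) :
    ∃ w : Space d → Space d, IsLerayProjection L (gradTransposeMul A v) w ∧
      IsHolder L (k + 1 + 1) α w ∧ IsPeriodic L w ∧
      holderNorm L (k + 1 + 1) α w ≤ projectionConst α ζ *
        (holderNorm L (k + 1) α (fderiv ℝ A) * holderNorm L (k + 1 + 1) α v) := by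
  have hA2 : ContDiff ℝ (k + 1 + 1 : ℕ) A := by exact_mod_cast hA.1
  have hAd : Differentiable ℝ A := hA2.differentiable (by simp)
  have hA' : ContDiff ℝ (k + 1 : ℕ) (fderiv ℝ A) := hA2.fderiv_right (by norm_cast)
  set a := holderNorm L (k + 1) α (fderiv ℝ A) with ha
  set b := holderNorm L (k + 1 + 1) α v with hb
  set B : Fin d → Fin d → Space d → ℝ := fun i j => partialDeriv i fun y => A y j with hBdef
  set V : Fin d → Space d → ℝ := fun j y => v y j with hVdef
  have hAj : ∀ j, IsHolder L (k + 1 + 1) α fun y => A y j := fun j =>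
    hA.clm_comp hL (EuclideanSpace.proj j) (norm_proj_le j)
  have hB : ∀ i j, IsHolder L (k + 1) α (B i j) := fun i j => (hAj j).partialDeriv hL i
  have hBe : ∀ i j, B i j = fun x => entryCLM i j (fderiv ℝ A x) := fun i j =>
    partialDeriv_clm_comp (EuclideanSpace.proj j : Space d →L[ℝ] ℝ) hAd i
  have pB : ∀ i j, IsPeriodic L (B i j) := by
    intro i j x l
    rw [hBe]; simp only [pA x l]
  have nB : ∀ i j, holderNorm L (k + 1) α (B i j) ≤ a := fun i j => by
    rw [hBe]; exact holderNorm_clm_comp_le hL _ (norm_entryCLM_le i j) hA'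
  have hBcomm : ∀ i l j, partialDeriv l (B i j) = partialDeriv i (B l j) := fun i l j =>
    partialDeriv_comm ((hAj j).1.of_le (by norm_cast; omega)) l i
  have hV : ∀ j, IsHolder L (k + 1 + 1) α (V j) := fun j =>
    hv.clm_comp hL (EuclideanSpace.proj j) (norm_proj_le j)
  have hV2 : ∀ j, ContDiff ℝ (k + 1 + 1 : ℕ) (V j) := fun j => by exact_mod_cast (hV j).1
  have pV : ∀ j, IsPeriodic L (V j) := fun j x l => by simp only [hVdef, pv x l]
  have hV1 : ∀ j, IsHolder L (k + 1) α (V j) := fun j => (hV j).of_succ hL hα hα₁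
  have nV' : ∀ j, holderNorm L (k + 1 + 1) α (V j) ≤ b := fun j =>
    holderNorm_clm_comp_le hL (EuclideanSpace.proj j : Space d →L[ℝ] ℝ) (norm_proj_le j)
      (by exact_mod_cast hv.1)
  have nV : ∀ j, holderNorm L (k + 1) α (V j) ≤ (d * d + 2) * b := fun j =>
    (holderNorm_le_succ hL hα hα₁ (hV2 j)).trans (mul_le_mul_right (nV' j) _)
  have hdV : ∀ l j, IsHolder L (k + 1) α (partialDeriv l (V j)) := fun l j =>
    (hV j).partialDeriv hL l
  have pdV : ∀ l j, IsPeriodic L (partialDeriv l (V j)) := fun l j => (pV j).partialDeriv l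
  have ndV : ∀ l j, ENNReal.ofReal L * holderNorm L (k + 1) α (partialDeriv l (V j)) ≤ b :=
    fun l j => (holderNorm_partialDeriv_le hL (hV2 j) l).trans (nV' j)
  have hk : 1 ≤ k + 1 := Nat.le_add_left _ _
  -- the field and the commutator terms
  set f : Fin d → Space d → ℝ := fun i x => ∑ j, B i j x * V j x with hfdef
  have hf : ∀ i, IsHolder L (k + 1) α (f i) := fun i =>
    IsHolder.sum hL _ fun j _ => (hB i j).mul hL hα hα₁ hk (hV1 j) (pB i j) (pV j)
  have pf : ∀ i, IsPeriodic L (f i) := fun i x l => by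
    simp only [hfdef, pB i _ x l, pV _ x l]
  have nf : ∀ i, holderNorm L (k + 1) α (f i) ≤
      d * (productConst d * (d * d + 2)) * (a * b) := by
    intro i
    refine (holderNorm_sum_le hL _ fun j _ => (hB i j).1.mul (hV1 j).1).trans ?_
    refine (Finset.sum_le_sum fun j _ => (holderNorm_mul_le hL hα hα₁ hk (hB i j).1 (hV1 j).1
      (pB i j) (pV j)).trans (mul_le_mul_right (mul_le_mul' (nB i j) (nV j)) _)).trans_eq ?_
    simp; ring
  set e : Fin d → Fin d → Space d → ℝ := fun l i x =>
    ∑ j, (B i j x * partialDeriv l (V j) x - partialDeriv i (V j) x * B l j x) with hedef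
  have he1 : ∀ l i j, IsHolder L (k + 1) α fun x => B i j x * partialDeriv l (V j) x :=
    fun l i j => (hB i j).mul hL hα hα₁ hk (hdV l j) (pB i j) (pdV l j)
  have he2 : ∀ l i j, IsHolder L (k + 1) α fun x => partialDeriv i (V j) x * B l j x :=
    fun l i j => (hdV i j).mul hL hα hα₁ hk (hB l j) (pdV i j) (pB l j)
  have he : ∀ l i, IsHolder L (k + 1) α (e l i) := fun l i =>
    IsHolder.sum hL _ fun j _ => (he1 l i j).sub hL (he2 l i j)
  have pe : ∀ l i, IsPeriodic L (e l i) := fun l i x m => by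
    simp only [hedef, pB _ _ x m, pdV _ _ x m]
  -- The factor `L` is spent on the derivative of `v`, since `L ‖∂ₗv‖` is bounded by the norm of `v`
  -- one order higher.
  have ne : ∀ l i, ENNReal.ofReal L * holderNorm L (k + 1) α (e l i) ≤
      d * (2 * productConst d) * (a * b) := by
    intro l i
    have hterm : ∀ j, ENNReal.ofReal L * holderNorm L (k + 1) α (fun x =>
        B i j x * partialDeriv l (V j) x - partialDeriv i (V j) x * B l j x) ≤
        2 * productConst d * (a * b) := by
      intro j
      refine (mul_le_mul_right ((holderNorm_sub_le hL (he1 l i j).1 (he2 l i j).1).trans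
        (add_le_add (holderNorm_mul_le hL hα hα₁ hk (hB i j).1 (hdV l j).1 (pB i j) (pdV l j))
          (holderNorm_mul_le hL hα hα₁ hk (hdV i j).1 (hB l j).1 (pdV i j) (pB l j)))) _).trans ?_
      calc _ = productConst d * (holderNorm L (k + 1) α (B i j) *
            (ENNReal.ofReal L * holderNorm L (k + 1) α (partialDeriv l (V j)))) +
            productConst d * (holderNorm L (k + 1) α (B l j) *
            (ENNReal.ofReal L * holderNorm L (k + 1) α (partialDeriv i (V j)))) := by ring
        _ ≤ productConst d * (a * b) + productConst d * (a * b) :=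
          add_le_add (mul_le_mul_right (mul_le_mul' (nB i j) (ndV l j)) _)
            (mul_le_mul_right (mul_le_mul' (nB l j) (ndV i j)) _)
        _ = _ := by ring
    refine (mul_le_mul_right (holderNorm_sum_le hL _ fun j _ =>
      ((he1 l i j).sub hL (he2 l i j)).1) _).trans ?_
    rw [Finset.mul_sum]
    refine (Finset.sum_le_sum fun j _ => hterm j).trans_eq ?_
    simp; ring
  have hdf : ∀ l i, partialDeriv l (f i) = fun x => e l i x + partialDeriv i (f l) x := by
    have key : ∀ l i, partialDeriv l (f i) = fun x => ∑ j,
        (partialDeriv l (B i j) x * V j x + B i j x * partialDeriv l (V j) x) := by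
      intro l i
      have dB : ∀ j, Differentiable ℝ (B i j) := fun j => (hB i j).1.differentiable (by simp)
      have dV : ∀ j, Differentiable ℝ (V j) := fun j => (hV j).1.differentiable (by simp)
      rw [hfdef, partialDeriv_sum _ fun j _ => (dB j).fun_mul (dV j)]
      simp only [fun j => partialDeriv_mul (dB j) (dV j) l]
    intro l i
    rw [key l i, key i l]
    funext x
    rw [hedef, ← Finset.sum_add_distrib]
    refine Finset.sum_congr rfl fun j _ => ?_
    -- The terms with second derivatives of `A` agree by symmetry and drop out.
    rw [hBcomm i l j]; ring
  have hdw : ∀ l i, partialDeriv l (hodge ζ f i) = hodge ζ (e l) i := by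
    intro l i
    rw [partialDeriv_hodge hL hα hα₁ hζ hf pf i l]
    funext x
    simp only [fun j => hdf l j]
    rw [hodge_add hL hα hα₁ hζ (he l) (fun j => (hf l).partialDeriv hL j) (pe l)
      (fun j => (pf l).partialDeriv j), hodge_gradient hL hα hα₁ hζ hη h hη₁ (hf l) (pf l), add_zero]
  -- the projected field
  have hw1 : ∀ i, ContDiff ℝ (k + 1 : ℕ) (hodge ζ f i) := fun i =>
    contDiff_hodge hL hα hα₁ hζ hf pf i
  -- The first partial derivatives are the fields `hodge ζ (e l) i`, themselves of order `k + 1`;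
  -- this is the gain of regularity.
  have hw2 : ∀ i, ContDiff ℝ (k + 1 + 1 : ℕ) (hodge ζ f i) := by
    intro i
    refine contDiff_succ_of_hasFDerivAt (g := fun l => hodge ζ (e l) i) (fun x => ?_)
      fun l => contDiff_hodge hL hα hα₁ hζ (he l) (pe l) i
    have hx := ((hw1 i).differentiable (by simp) x).hasFDerivAt
    rw [fderiv_eq_coordCLM] at hx
    simpa only [hdw] using hx
  set w : Space d → Space d := fun x => WithLp.toLp 2 fun i => hodge ζ f i x with hw
  have hwc : ContDiff ℝ (k + 1 + 1 : ℕ) w := contDiff_euclidean.2 hw2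
  have pw : IsPeriodic L w := fun x l => by
    simp only [hw, fun i => hodge_periodic (ζ := ζ) pf i x l]
  have nw : holderNorm L (k + 1 + 1) α w ≤ projectionConst α ζ * (a * b) := by
    refine (holderNorm_le_sum_components hL hwc).trans ?_
    have hcomp : ∀ i, holderNorm L (k + 1 + 1) α (hodge ζ f i) ≤
        (hodgeConst α ζ * (d * (d * (productConst d * (d * d + 2)))) +
          d * (hodgeConst α ζ * (d * (d * (2 * productConst d))))) * (a * b) := by
      intro i
      refine (holderNorm_succ_le hL (hw2 i)).trans ?_
      rw [add_mul]
      refine add_le_add ?_ ?_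
      -- Only the sup norm of the projected field is estimated through `f` itself; all derivatives
      -- go through the commutators.
      · refine (supNorm_le_holderNorm (α := α) (k + 1) _).trans
          ((holderNorm_hodge_le hL hα hα₁ hζ hf pf i).trans ?_)
        refine (mul_le_mul_right (Finset.sum_le_sum fun j _ => nf j) _).trans_eq ?_
        simp; ring
      · have : ∀ l, ENNReal.ofReal L * holderNorm L (k + 1) α (partialDeriv l (hodge ζ f i)) ≤
            hodgeConst α ζ * (d * (d * (2 * productConst d) * (a * b))) := by
          intro l
          rw [hdw]
          refine (mul_le_mul_right (holderNorm_hodge_le hL hα hα₁ hζ (he l) (pe l) i) _).trans ?_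
          rw [mul_left_comm, Finset.mul_sum]
          refine mul_le_mul_right ((Finset.sum_le_sum fun j _ => ne l j).trans_eq ?_) _
          simp
        refine (Finset.sum_le_sum fun l _ => this l).trans_eq ?_
        simp; ring
    refine (Finset.sum_le_sum fun i _ => hcomp i).trans_eq ?_
    rw [projectionConst]
    simp; ring
  refine ⟨w, ?_, ⟨by exact_mod_cast hwc, ?_⟩, pw, nw⟩
  · have hfe : ∀ x i, gradTransposeMul A v x i = f i x := fun x i =>
      gradTransposeMul_apply hAd x i
    have hpot := hasFDerivAt_hodgePotential hL hα hα₁ hζ hf pf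
    refine isLerayProjection_of_decomposition hL
      (φ := fun x => ∑ j, scalePotential (partialDeriv j ζ) (f j) x) ?_
      (hwc.of_le (by norm_cast; omega)) pw
      (fun x => div_hodge hL hα hα₁ hζ hη h hη₁ hf pf x) ?_ ?_ ?_
    · have : ContDiff ℝ 0 (gradTransposeMul A v) := by
        rw [contDiff_euclidean]
        intro i
        simp only [hfe]
        exact (hf i).1.of_le bot_le
      exact this.continuous
    · exact contDiff_succ_of_hasFDerivAt (k := 0) hpot fun l =>
        ((hf l).1.sub (hw1 l)).of_le bot_le
    · intro x l
      simp only [fun j => scalePotential_periodic (ψ := partialDeriv j ζ) (pf j) x l]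
    · intro x
      ext i
      rw [hfe, PiLp.add_apply, gradient_apply (hpot x)]
      simp [hw]
  -- Finiteness of the norm of `∇A` as a matrix-valued function is not a hypothesis; it follows from
  -- that of the columns `∂ᵢA`.
  · have hfin : a < ⊤ := by
      have hsum : a ≤ ∑ i, holderNorm L (k + 1) α (partialDeriv i A) := by
        have hc : ∀ {j : ℕ} {m : Fin d → ℕ}, m ∈ multiIndices d j → j ≤ k + 1 → ∀ i,
            multiDeriv m (partialDeriv i A) =
              fun x => multiDeriv m (fderiv ℝ A) x (EuclideanSpace.single i 1) := fun hm hj i =>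
          multiDeriv_clm_comp (ContinuousLinearMap.apply ℝ (Space d)
            (EuclideanSpace.single i (1 : ℝ))) hm (hA'.of_le (by exact_mod_cast hj))
        rw [ha, ← one_mul (∑ i, _)]
        refine holderNorm_le_sum _ ?_ ?_
        · intro j hj m hm
          simp only [one_mul, hc hm hj]
          exact supNorm_le_of_norm_le_sum _ fun x => opNorm_le_sum _
        · intro m hm
          simp only [one_mul, hc hm le_rfl]
          exact holderSeminorm_le_of_norm_le_sum _ hL fun x y => opNorm_le_sum _
      exact hsum.trans_lt (ENNReal.sum_lt_top.2 fun i _ => (hA.partialDeriv hL i).2)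
    exact nw.trans_lt (ENNReal.mul_lt_top (projectionConst_ne_top α ζ).lt_top
      (ENNReal.mul_lt_top hfin hv.2))

end Main

end PeriodicHolder

end

theorem lemma5p1 (d : ℕ) (α : ℝ) (hα₀ : 0 < α) (hα₁ : α < 1) :
    ∃ c : ℝ≥0, ∀ (L : ℝ), 0 < L → ∀ (k : ℕ), 1 ≤ k →
      ∀ (A v : PeriodicHolder.Space d → PeriodicHolder.Space d),
        PeriodicHolder.IsHolder L (k + 1) α A →
        PeriodicHolder.IsPeriodic L (fderiv ℝ A) →
        PeriodicHolder.IsHolder L (k + 1) α v →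
        PeriodicHolder.IsPeriodic L v →
        ∃ w : PeriodicHolder.Space d → PeriodicHolder.Space d,
          PeriodicHolder.IsLerayProjection L (PeriodicHolder.gradTransposeMul A v) w ∧
          PeriodicHolder.IsHolder L (k + 1) α w ∧
          PeriodicHolder.IsPeriodic L w ∧
          PeriodicHolder.holderNorm L (k + 1) α w ≤
            (c : ℝ≥0∞) * PeriodicHolder.holderNorm L k α (fderiv ℝ A) *
              PeriodicHolder.holderNorm L (k + 1) α v := by
  -- In dimension zero the kernel construction fails, but every field is zero.
  rcases Nat.eq_zero_or_pos d with rfl | hd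
  · refine ⟨0, fun L hL k _ A v _ _ _ _ => ⟨0, ?_, ⟨contDiff_const, ?_⟩, fun _ _ => rfl, ?_⟩⟩
    · refine PeriodicHolder.isLerayProjection_of_decomposition hL (φ := 0) ?_ contDiff_const
        (fun _ _ => rfl) (fun x => by simp) contDiff_const (fun _ _ => rfl)
        (fun x => Subsingleton.elim _ _)
      exact continuous_of_const fun x y => Subsingleton.elim _ _
    · rw [PeriodicHolder.holderNorm_of_subsingleton]; exact ENNReal.zero_lt_top
    · rw [PeriodicHolder.holderNorm_of_subsingleton]; exact bot_le
  · obtain ⟨ζ, η, hζ, hη, h, hη₁⟩ := PeriodicHolder.exists_kernel hd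
    refine ⟨(PeriodicHolder.projectionConst α ζ).toNNReal, fun L hL k hk A v hA pA hv pv => ?_⟩
    obtain ⟨n, rfl⟩ : ∃ n, k = n + 1 := ⟨k - 1, by omega⟩
    obtain ⟨w, h1, h2, h3, h4⟩ := PeriodicHolder.exists_lerayProjection hL hα₀ hα₁ hζ hη h hη₁
      hA pA hv pv
    refine ⟨w, h1, h2, h3, ?_⟩
    rwa [ENNReal.coe_toNNReal (PeriodicHolder.projectionConst_ne_top α ζ), mul_assoc]
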